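/- Let $K$ be a complete discretely valued nonarchimedean field of equal characteristic zero (that is, its residue field has characteristic $0$), and let $n\ge 0$. Let $A=K\langle x_1,\dots,x_n\rangle$ be the Tate algebra with its Gauss norm $|\sum_\alpha a_\alpha x^\alpha|=\max_\alpha|a_\alpha|$, let $\mathcal D_n=A[\partial_1,\dots,\partial_n]$ be the ring of $K$-linear operators on $A$ generated by $A$ (acting by multiplication) and the partial derivatives $\partial_i=\partial/\partial x_i$, and let $\widehat{\mathcal D}_n$ (the completed Weyl algebra) be the completion of $\mathcal D_n$ for the operator norm. For a left $\mathcal D_n$-module $M$ put $\widehat M=\widehat{\mathcal D}_n\otimes_{\mathcal D_n}M$, and let $\mathrm{DR}(M)$ be the complex of $K$-vector spaces $$M\to\bigoplus_{i}M\,dx_i\to\bigoplus_{i<j}M\,dx_i\wedge dx_j\to\cdots\to M\,dx_1\wedge\cdots\wedge dx_n,\qquad m\,dx_I\mapsto\sum_{j}\partial_j m\,dx_j\wedge dx_I;$$ the de Rham complex of a left $\widehat{\mathcal D}_n$-module is that of the underlying $\mathcal D_n$-module. A finitely generated left module $N$ over a ring $R$ is of minimal dimension if $N=0$ or $\inf\{i:\mathrm{Ext}^i_R(N,R)\neq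 0\}$ equals the global homological dimension of $R$. Let $M$ be a finitely generated left $\mathcal D_n$-module. Then: (1) If $M$ is of minimal dimension over $\mathcal D_n$, then $\widehat M$ is of minimal dimension over $\widehat{\mathcal D}_n$. (2) The complexes $\mathrm{DR}(M)$ and $\mathrm{DR}(\widehat M)$ are quasi-isomorphic; more precisely, the morphism $\mathrm{DR}(M)\to\mathrm{DR}(\widehat M)$ induced by $m\mapsto 1\otimes m$ is a quasi-isomorphism of complexes of $K$-vector spaces. -/

import Mathlib

universe u

namespace CompletedWeyl

open CategoryTheory Filter Topology
open scoped TensorProduct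

noncomputable section

/-! ## The Tate algebra with its Gauss norm -/

section Tate

/-- The Tate algebra `K⟨x₁, …, xₙ⟩` as a `K`-subalgebra of the power series ring:
power series whose coefficients tend to zero. -/
def tateSubalgebra (K : Type u) [NormedField K] [IsUltrametricDist K] (n : ℕ) :
    Subalgebra K (MvPowerSeries (Fin n) K) :=
  { MvPowerSeries.IsRestricted.subring (R := K) (σ := Fin n) (fun _ => 1) with
    algebraMap_mem' := fun a => MvPowerSeries.isRestricted_C _ a }

/-- The Tate algebra `K⟨x₁, …, xₙ⟩`. -/
abbrev TateAlgebra (K : Type u) [NormedField K] [IsUltrametricDist K] (n : ℕ) : Type u :=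
  tateSubalgebra K n

variable {K : Type u} [NontriviallyNormedField K] [IsUltrametricDist K] {n : ℕ}

theorem mem_tateSubalgebra_iff {f : MvPowerSeries (Fin n) K} :
    f ∈ tateSubalgebra K n ↔
      Tendsto (fun t => ‖MvPowerSeries.coeff t f‖) cofinite (𝓝 0) := by
  change MvPowerSeries.IsRestricted (fun _ => 1) f ↔ _
  simp [MvPowerSeries.IsRestricted]

theorem hasGaussNorm (f : TateAlgebra K n) :
    MvPowerSeries.HasGaussNorm (norm : K → ℝ) 1 f.1 := by
  have h := (mem_tateSubalgebra_iff.mp f.2).bddAbove_range_of_cofinite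
  simpa [MvPowerSeries.HasGaussNorm] using h

/-- The Gauss norm `|∑ a_α x^α| = max |a_α|` on the Tate algebra. -/
def gaussRingNorm (K : Type u) [NontriviallyNormedField K] [IsUltrametricDist K] (n : ℕ) :
    RingNorm (TateAlgebra K n) where
  toFun f := MvPowerSeries.gaussNorm (norm : K → ℝ) 1 f.1
  map_zero' := MvPowerSeries.gaussNorm_zero _ _ norm_zero
  add_le' f g := (MvPowerSeries.gaussNorm_add_le_max _ _ f.1 g.1 zero_le_one norm_nonneg
    IsUltrametricDist.isNonarchimedean_norm (hasGaussNorm f) (hasGaussNorm g)).trans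
    (max_le_add_of_nonneg (MvPowerSeries.gaussNorm_nonneg _ _ _ norm_nonneg)
      (MvPowerSeries.gaussNorm_nonneg _ _ _ norm_nonneg))
  neg' f := MvPowerSeries.gaussNorm_neg _ _ norm_neg f.1
  mul_le' f g := MvPowerSeries.gaussNorm_mul_le _ _ f.1 g.1 zero_le_one norm_nonneg
    norm_mul_le IsUltrametricDist.isNonarchimedean_norm norm_zero
    (hasGaussNorm f) (hasGaussNorm g)
  eq_zero_of_map_eq_zero' f h := Subtype.ext
    ((MvPowerSeries.gaussNorm_eq_zero_iff _ _ f.1 norm_zero norm_nonneg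
      (fun _ => norm_eq_zero.mp) (fun _ => zero_lt_one) (hasGaussNorm f)).mp h)

instance instNormedCommRingTate : NormedCommRing (TateAlgebra K n) :=
  { (gaussRingNorm K n).toNormedRing with mul_comm := mul_comm }

theorem norm_tate_def (f : TateAlgebra K n) :
    ‖f‖ = ⨆ t : Fin n →₀ ℕ, ‖MvPowerSeries.coeff t f.1‖ := by
  change MvPowerSeries.gaussNorm (norm : K → ℝ) 1 f.1 = _
  simp [MvPowerSeries.gaussNorm]

theorem norm_coeff_le (f : TateAlgebra K n) (t : Fin n →₀ ℕ) :
    ‖MvPowerSeries.coeff t f.1‖ ≤ ‖f‖ := by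
  change _ ≤ MvPowerSeries.gaussNorm (norm : K → ℝ) 1 f.1
  simpa using MvPowerSeries.le_gaussNorm (norm : K → ℝ) 1 f.1 (hasGaussNorm f) t

instance instNormedAlgebraTate : NormedAlgebra K (TateAlgebra K n) where
  norm_smul_le a f := by
    rw [norm_tate_def (a • f)]
    refine Real.iSup_le (fun t => ?_) (mul_nonneg (norm_nonneg _) (norm_nonneg _))
    calc ‖MvPowerSeries.coeff t (a • f.1)‖ = ‖a‖ * ‖MvPowerSeries.coeff t f.1‖ := by
          rw [map_smul, smul_eq_mul, norm_mul]
      _ ≤ ‖a‖ * ‖f‖ := mul_le_mul_of_nonneg_left (norm_coeff_le f t) (norm_nonneg _)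

theorem norm_coeff_pderiv_le (i : Fin n) (f : MvPowerSeries (Fin n) K) (t : Fin n →₀ ℕ) :
    ‖MvPowerSeries.coeff t (MvPowerSeries.pderiv K i f)‖ ≤
      ‖MvPowerSeries.coeff (t + Finsupp.single i 1) f‖ := by
  rw [MvPowerSeries.coeff_pderiv, norm_mul]
  refine mul_le_of_le_one_right (norm_nonneg _) ?_
  exact_mod_cast IsUltrametricDist.norm_natCast_le_one K (t i + 1)

theorem pderiv_mem (i : Fin n) {f : MvPowerSeries (Fin n) K} (hf : f ∈ tateSubalgebra K n) :
    MvPowerSeries.pderiv K i f ∈ tateSubalgebra K n := by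
  rw [mem_tateSubalgebra_iff] at hf ⊢
  exact squeeze_zero (fun _ => norm_nonneg _) (norm_coeff_pderiv_le i f)
    (hf.comp (add_left_injective (Finsupp.single i 1)).tendsto_cofinite)

/-- The partial derivative `∂ᵢ = ∂/∂xᵢ` as a continuous `K`-linear operator on `K⟨x₁, …, xₙ⟩`. -/
def partialOp (K : Type u) [NontriviallyNormedField K] [IsUltrametricDist K] {n : ℕ}
    (i : Fin n) : TateAlgebra K n →L[K] TateAlgebra K n :=
  LinearMap.mkContinuous
    { toFun := fun f => ⟨MvPowerSeries.pderiv K i f.1, pderiv_mem i f.2⟩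
      map_add' := fun f g => Subtype.ext (map_add _ f.1 g.1)
      map_smul' := fun a f => Subtype.ext ((MvPowerSeries.pderiv K i).map_smul a f.1) }
    1 (fun f => by
      rw [one_mul, norm_tate_def]
      exact Real.iSup_le (fun t => (norm_coeff_pderiv_le i f.1 t).trans (norm_coeff_le f _))
        (norm_nonneg _))

end Tate

/-! ## The ring of differential operators and the completed Weyl algebra -/

section Weyl

variable (K : Type u) [NontriviallyNormedField K] [IsUltrametricDist K] (n : ℕ)

/-- The algebra `K⟨x₁, …, xₙ⟩[∂₁, …, ∂ₙ]` of operators on `A = K⟨x₁, …, xₙ⟩` generated by `A`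
(acting by multiplication) and the partial derivatives. All its elements are continuous, so it is
formed inside the continuous `K`-linear endomorphisms of `A`, whence it carries the operator norm
with respect to the Gauss norm on `A`. -/
def diffOpSubalgebra : Subalgebra K (TateAlgebra K n →L[K] TateAlgebra K n) :=
  Algebra.adjoin K
    (Set.range (fun f : TateAlgebra K n => ContinuousLinearMap.mul K (TateAlgebra K n) f) ∪
      Set.range (fun i : Fin n => partialOp K i))

/-- The ring `𝒟ₙ = K⟨x₁, …, xₙ⟩[∂₁, …, ∂ₙ]`, a normed ring under the operator norm. -/
def DiffOp : Type u := diffOpSubalgebra K n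

instance instNormedRingDiffOp : NormedRing (DiffOp K n) :=
  inferInstanceAs (NormedRing (diffOpSubalgebra K n))

instance instRingDiffOp : Ring (DiffOp K n) := NormedRing.toRing

instance instNormedAlgebraDiffOp : NormedAlgebra K (DiffOp K n) :=
  inferInstanceAs (NormedAlgebra K (diffOpSubalgebra K n))

instance instAlgebraDiffOp : Algebra K (DiffOp K n) := NormedAlgebra.toAlgebra

/-- The completed Weyl algebra: the completion of `𝒟ₙ` with respect to the operator norm. -/
def CompletedWeylAlgebra : Type u := UniformSpace.Completion (DiffOp K n)

instance instNormedRingCompleted : NormedRing (CompletedWeylAlgebra K n) :=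
  inferInstanceAs (NormedRing (UniformSpace.Completion (DiffOp K n)))

instance instRingCompleted : Ring (CompletedWeylAlgebra K n) := NormedRing.toRing

/-- The natural ring homomorphism from `𝒟ₙ` to the completed Weyl algebra. -/
def toCompleted : DiffOp K n →+* CompletedWeylAlgebra K n :=
  (UniformSpace.Completion.coeRingHom : DiffOp K n →+* UniformSpace.Completion (DiffOp K n))

variable {n}

/-- The element `∂ᵢ` of `𝒟ₙ`. -/
def del (i : Fin n) : DiffOp K n :=
  ⟨partialOp K i, Algebra.subset_adjoin (Or.inr ⟨i, rfl⟩)⟩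

theorem del_commute (i j : Fin n) : Commute (del K i) (del K j) := by
  have h : ∀ f : MvPowerSeries (Fin n) K,
      MvPowerSeries.pderiv K i (MvPowerSeries.pderiv K j f) =
        MvPowerSeries.pderiv K j (MvPowerSeries.pderiv K i f) := by
    intro f
    ext t
    simp only [MvPowerSeries.coeff_pderiv, Finsupp.add_apply, add_right_comm t]
    rcases eq_or_ne i j with rfl | hij
    · rfl
    · simp [Finsupp.single_eq_of_ne hij, Finsupp.single_eq_of_ne hij.symm]
      ring
  refine Subtype.ext (ContinuousLinearMap.ext fun f => Subtype.ext ?_)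
  exact h f.1

end Weyl

/-! ## Modules of minimal dimension -/

section Minimal

variable (R : Type u) [Ring R]

/-- The (left) global homological dimension of `R`: the supremum of the projective dimensions of
all left `R`-modules. -/
def globalDim : WithBot ℕ∞ :=
  ⨆ M : ModuleCat.{u} R, projectiveDimension M

variable {R}

/-- The grade of `M`: the infimum of all `i` with `Ext^i_R(M, R) ≠ 0`. -/
def grade (M : ModuleCat.{u} R) : ℕ∞ :=
  sInf {d : ℕ∞ | ∃ i : ℕ, d = i ∧ Nontrivial (Abelian.Ext.{u} M (ModuleCat.of R R) i)}

/-- A left `R`-module is of minimal dimension if it is finitely generated and it is either zero or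
its grade equals the global dimension of `R`. -/
def IsOfMinimalDimension (M : ModuleCat.{u} R) : Prop :=
  Module.Finite R M ∧ (Subsingleton M ∨ (grade M : WithBot ℕ∞) = globalDim R)

end Minimal

/-! ## Base change along a homomorphism of noncommutative rings -/

section BaseChange

variable {R S : Type u} [Ring R] [Ring S] (f : R →+* S) (M : ModuleCat.{u} R)

/-- The relations `s f(r) ⊗ m = s ⊗ r m` defining `S ⊗_R M` as a quotient of `S ⊗_ℤ M`. They are
stable under left multiplication by `S`, so their `S`-span is their additive span. -/
def balancingSubmodule : Submodule S (S ⊗[ℤ] M) :=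
  Submodule.span S {z | ∃ (s : S) (r : R) (m : M), z = (s * f r) ⊗ₜ[ℤ] m - s ⊗ₜ[ℤ] (r • m)}

/-- The left `S`-module `S ⊗_R M`. -/
def baseChange : ModuleCat.{u} S :=
  ModuleCat.of S ((S ⊗[ℤ] M) ⧸ balancingSubmodule f M)

/-- The natural `R`-linear map `M → S ⊗_R M`, `m ↦ 1 ⊗ m`. -/
def toBaseChange : M ⟶ (ModuleCat.restrictScalars f).obj (baseChange f M) :=
  ModuleCat.ofHom (Y := (ModuleCat.restrictScalars f).obj (baseChange f M))
    { toFun := fun m => (balancingSubmodule f M).mkQ ((1 : S) ⊗ₜ[ℤ] m)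
      map_add' := fun m m' => by
        rw [TensorProduct.tmul_add, map_add]
        rfl
      map_smul' := fun r m => by
        change _ = (f r • (balancingSubmodule f M).mkQ ((1 : S) ⊗ₜ[ℤ] m) :
          (S ⊗[ℤ] M) ⧸ balancingSubmodule f M)
        rw [← map_smul, TensorProduct.smul_tmul', smul_eq_mul, mul_one, eq_comm, ← sub_eq_zero,
          ← map_sub, Submodule.mkQ_apply, Submodule.Quotient.mk_eq_zero]
        exact Submodule.subset_span ⟨1, r, m, by rw [one_mul]⟩ }

end BaseChange

/-! ## De Rham complexes -/

section DeRham

/-- The index set of the forms `dx_I` of degree `k`: subsets `I ⊆ {1, …, n}` with `k` elements. -/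
abbrev FormIndex (n k : ℕ) : Type := {I : Finset (Fin n) // I.card = k}

/-- Removing an element from an index set. -/
def FormIndex.erase {n k : ℕ} (J : FormIndex n (k + 1)) (j : J.1) : FormIndex n k :=
  ⟨J.1.erase j, by rw [Finset.card_erase_of_mem j.2, J.2, Nat.add_sub_cancel]⟩

/-- The sign in `dx_j ∧ dx_{J ∖ j} = ± dx_J`, for `j ∈ J`. -/
def formSign {n : ℕ} (J : Finset (Fin n)) (j : Fin n) : ℤ :=
  (-1) ^ (J.filter (fun i => i < j)).card

theorem formSign_anticomm {n : ℕ} (J : Finset (Fin n)) {i j : Fin n} (hi : i ∈ J) (hj : j ∈ J)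
    (hij : i ≠ j) :
    formSign J j * formSign (J.erase j) i + formSign J i * formSign (J.erase i) j = 0 := by
  have key : ∀ {i j : Fin n}, i ∈ J → j ∈ J → i < j →
      formSign J j * formSign (J.erase j) i + formSign J i * formSign (J.erase i) j = 0 := by
    intro i j hi hj hij
    have h1 : (J.erase j).filter (fun l => l < i) = J.filter (fun l => l < i) := by
      ext l
      simp only [Finset.mem_filter, Finset.mem_erase]
      exact ⟨fun h => ⟨h.1.2, h.2⟩, fun h => ⟨⟨(h.2.trans hij).ne, h.1⟩, h.2⟩⟩
    have h2 : (J.erase i).filter (fun l => l < j) = (J.filter (fun l => l < j)).erase i := by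
      ext l
      simp only [Finset.mem_filter, Finset.mem_erase]
      tauto
    have h3 : ((J.filter (fun l => l < j)).erase i).card + 1 =
        (J.filter (fun l => l < j)).card :=
      Finset.card_erase_add_one (Finset.mem_filter.mpr ⟨hi, hij⟩)
    unfold formSign
    rw [h1, h2, ← h3]
    ring
  rcases lt_or_gt_of_ne hij with h | h
  · exact key hi hj h
  · rw [add_comm]
    exact key hj hi h

variable {K : Type u} [CommRing K] {n : ℕ} {V W : Type u} [AddCommGroup V] [Module K V]
  [AddCommGroup W] [Module K W]

/-- The differential `m dx_I ↦ ∑_j ∂_j m dx_j ∧ dx_I` on forms of degree `k` with coefficients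
in `V`, where a form `∑_I m_I dx_I` is the family `(m_I)_I`. -/
def formDifferential (δ : Fin n → Module.End K V) (k : ℕ) :
    (FormIndex n k → V) →ₗ[K] (FormIndex n (k + 1) → V) :=
  LinearMap.pi fun J =>
    ∑ j : J.1, formSign J.1 j • (δ j ∘ₗ LinearMap.proj (J.erase j))

theorem formDifferential_apply (δ : Fin n → Module.End K V) (k : ℕ) (ω : FormIndex n k → V)
    (J : FormIndex n (k + 1)) :
    formDifferential δ k ω J = ∑ j : J.1, formSign J.1 j • δ j (ω (J.erase j)) := by
  simp [formDifferential]

theorem formDifferential_comp (δ : Fin n → Module.End K V)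
    (hδ : ∀ i j, Commute (δ i) (δ j)) (k : ℕ) :
    formDifferential δ (k + 1) ∘ₗ formDifferential δ k = 0 := by
  classical
  refine LinearMap.ext fun ω => funext fun J => ?_
  let F : Finset (Fin n) → V := fun I => if h : I.card = k then ω ⟨I, h⟩ else 0
  have hF : ∀ I : FormIndex n k, ω I = F I.1 := fun I => by simp [F, I.2]
  rw [LinearMap.comp_apply, formDifferential_apply]
  have h1 : ∀ j : J.1, formSign J.1 j • δ j (formDifferential δ k ω (J.erase j)) =
      ∑ i ∈ J.1.erase j, (formSign J.1 j * formSign (J.1.erase j) i) •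
        δ j (δ i (F ((J.1.erase j).erase i))) := by
    intro j
    rw [formDifferential_apply, map_sum, Finset.smul_sum]
    rw [← Finset.sum_coe_sort (J.1.erase j)]
    refine Finset.sum_congr rfl fun i _ => ?_
    rw [hF, map_zsmul, smul_smul]
    rfl
  rw [Finset.sum_congr rfl fun j _ => h1 j,
    Finset.sum_coe_sort J.1 (fun j => ∑ i ∈ J.1.erase j,
      (formSign J.1 j * formSign (J.1.erase j) i) • δ j (δ i (F ((J.1.erase j).erase i)))),
    Finset.sum_sigma']
  refine Finset.sum_involution (fun a _ => ⟨a.2, a.1⟩) ?_ ?_ ?_ ?_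
  · rintro ⟨j, i⟩ ha
    simp only [Finset.mem_sigma, Finset.mem_erase] at ha
    have hc : δ i (δ j (F ((J.1.erase i).erase j))) = δ j (δ i (F ((J.1.erase j).erase i))) := by
      rw [Finset.erase_right_comm]
      exact LinearMap.congr_fun (hδ i j).eq _
    dsimp only
    rw [hc, ← add_smul, formSign_anticomm J.1 ha.2.2 ha.1 ha.2.1, zero_smul]
  · rintro ⟨j, i⟩ ha _ h
    simp only [Finset.mem_sigma, Finset.mem_erase] at ha
    exact ha.2.1 (congrArg Sigma.fst h)
  · rintro ⟨j, i⟩ ha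
    simp only [Finset.mem_sigma, Finset.mem_erase] at ha ⊢
    exact ⟨ha.2.2, Ne.symm ha.2.1, ha.1⟩
  · rintro ⟨j, i⟩ _
    rfl

/-- The complex of forms with coefficients in a `K`-module with commuting endomorphisms
`δ₁, …, δₙ`. -/
def formComplex (δ : Fin n → Module.End K V) (hδ : ∀ i j, Commute (δ i) (δ j)) :
    CochainComplex (ModuleCat.{u} K) ℕ :=
  CochainComplex.of (fun k => ModuleCat.of K (FormIndex n k → V))
    (fun k => ModuleCat.ofHom (formDifferential δ k))
    (fun k => by rw [← ModuleCat.ofHom_comp, formDifferential_comp δ hδ k]; rfl)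

theorem formComplex_d (δ : Fin n → Module.End K V) (hδ : ∀ i j, Commute (δ i) (δ j)) (k : ℕ) :
    (formComplex δ hδ).d k (k + 1) = ModuleCat.ofHom (formDifferential δ k) :=
  CochainComplex.of_d (fun k => ModuleCat.of K (FormIndex n k → V))
    (fun k => ModuleCat.ofHom (formDifferential δ k)) k

/-- A linear map commuting with the given endomorphisms induces a morphism of complexes of forms,
coefficient by coefficient. -/
def formComplexMap {δ : Fin n → Module.End K V} (hδ : ∀ i j, Commute (δ i) (δ j))
    {ε : Fin n → Module.End K W} (hε : ∀ i j, Commute (ε i) (ε j))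
    (φ : V →ₗ[K] W) (hφ : ∀ i v, φ (δ i v) = ε i (φ v)) :
    formComplex δ hδ ⟶ formComplex ε hε :=
  CochainComplex.ofHom (X := formComplex δ hδ) (Y := formComplex ε hε)
    (fun k => ModuleCat.ofHom (X := FormIndex n k → V) (Y := FormIndex n k → W)
      (LinearMap.compLeft φ (FormIndex n k)))
    (fun k => by
      rw [formComplex_d, formComplex_d]
      refine (ModuleCat.ofHom_comp _ _).symm.trans (Eq.trans ?_ (ModuleCat.ofHom_comp _ _))
      congr 1
      refine LinearMap.ext fun ω => funext fun J => ?_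
      simp [formDifferential_apply, hφ])

end DeRham

section DeRhamWeyl

variable (K : Type u) [NontriviallyNormedField K] [IsUltrametricDist K] {n : ℕ}

/-- The underlying `K`-vector space of a left `𝒟ₙ`-module. -/
abbrev underlying (M : ModuleCat.{u} (DiffOp K n)) : ModuleCat.{u} K :=
  (ModuleCat.restrictScalars (algebraMap K (DiffOp K n))).obj M

/-- The action of `∂ᵢ` on a left `𝒟ₙ`-module, as a `K`-linear endomorphism. -/
def delAction (M : ModuleCat.{u} (DiffOp K n)) (i : Fin n) :
    Module.End K (underlying K M) where
  toFun m := (del K i • (show M from m) : M)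
  map_add' m m' := smul_add (del K i) (show M from m) (show M from m')
  map_smul' a m := by
    change del K i • algebraMap K (DiffOp K n) a • (show M from m) =
      algebraMap K (DiffOp K n) a • del K i • (show M from m)
    rw [smul_smul, smul_smul, Algebra.commutes]

theorem delAction_commute (M : ModuleCat.{u} (DiffOp K n)) (i j : Fin n) :
    Commute (delAction K M i) (delAction K M j) := by
  refine LinearMap.ext fun m => ?_
  change del K i • del K j • (show M from m) = del K j • del K i • (show M from m)
  rw [smul_smul, smul_smul, (del_commute K i j).eq]

/-- The de Rham complex `[M → ⨁ᵢ M dxᵢ → ⨁_{i<j} M dxᵢ ∧ dxⱼ → ⋯ → M dx₁ ∧ ⋯ ∧ dxₙ]` of a left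
`𝒟ₙ`-module `M`, as a complex of `K`-vector spaces with `M` in degree `0`. -/
def deRham (M : ModuleCat.{u} (DiffOp K n)) : CochainComplex (ModuleCat.{u} K) ℕ :=
  formComplex (delAction K M) (delAction_commute K M)

/-- The morphism of de Rham complexes induced by a homomorphism of left `𝒟ₙ`-modules. -/
def deRhamMap {M N : ModuleCat.{u} (DiffOp K n)} (φ : M ⟶ N) : deRham K M ⟶ deRham K N :=
  formComplexMap _ _
    ((ModuleCat.restrictScalars (algebraMap K (DiffOp K n))).map φ).hom
    (fun i v => map_smul φ.hom (del K i) (show M from v))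

/-- The base change `M̂` of a left `𝒟ₙ`-module `M` to the completed Weyl algebra. -/
def completedModule (M : ModuleCat.{u} (DiffOp K n)) :
    ModuleCat.{u} (CompletedWeylAlgebra K n) :=
  baseChange (toCompleted K n) M

/-- The de Rham complex of a left module over the completed Weyl algebra: that of the underlying
`𝒟ₙ`-module. -/
def completedDeRham (N : ModuleCat.{u} (CompletedWeylAlgebra K n)) :
    CochainComplex (ModuleCat.{u} K) ℕ :=
  deRham K ((ModuleCat.restrictScalars (toCompleted K n)).obj N)

/-- The morphism from the de Rham complex of `M` to that of `M̂` induced by `m ↦ 1 ⊗ m`. -/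
def deRhamComparison (M : ModuleCat.{u} (DiffOp K n)) :
    deRham K M ⟶ completedDeRham K (completedModule K M) :=
  deRhamMap K (toBaseChange (toCompleted K n) M)

end DeRhamWeyl

end

end CompletedWeyl

/-! Only two arithmetic facts about K are used besides completeness and the ultrametric inequality:
there is ϖ ≠ 0 with |ϖ| < 1 such that |a| < 1 forces |a| ≤ |ϖ|, and nonzero natural numbers have
norm 1. Write A for the Tate algebra, D for the ring of differential operators, D̂ for its
completion, A°, D°, D̂° for the unit balls, and k for the field of reduced scalars.

Structure of the rings. If b is such that [·, b] is locally nilpotent and [a, b] = 1, Taylor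
expansion in a exhibits the ring as an Ore extension of the centralizer of b, because factorials are
invertible (`isOre_of_adR`). In this way D̂°/ϖ is a Weyl algebra over k (`isWeyl_residueSystem`) and
D° is a tower of Ore extensions of A°. Hilbert's basis theorem and successive approximation along ϖ
make all these rings Noetherian. Since D̂° is the ϖ-adic completion of the two-sided Noetherian ring
D°, an Artin–Rees argument and inversion of ϖ give that D̂ is flat over D on both sides
(`vflat_toCompleted`, `vflat_op_toCompleted`).

De Rham complexes. Taylor expansion also divides by ∂ᵢ on the left, with a remainder commuting with
xᵢ. Factorials have norm 1, so division is bounded by 1 and extends to D̂. It gives one-sided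
inverses of the ∂ᵢ that make the Koszul complex contractible except for the remainder in top degree
(`formComplex_exactAt`). The total remainder lies in A both for D and for D̂, so the de Rham complex
of D̂/D is acyclic, which settles free modules. A finitely generated M follows from free
presentations, flatness, the four lemmas and descending induction on the degree, as there is no
cohomology above degree n (`quasiIso_deRhamComparison`).

Minimal dimension. For a nonzero completion M̂ of a nonzero M of minimal dimension one has n ≤
gl.dim D = grade M ≤ grade M̂ ≤ pd M̂ ≤ gl.dim D̂ ≤ n. The first inequality holds because a module
of projective dimension below n has no de Rham cohomology in degree 0, whereas A has the class of 1
(`le_globalDim_diffOp`). The second is the base change of vanishing Ext into the ring, using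
flatness on both sides (`ext_baseChange_eq_zero`). The third is a general fact on finitely generated
modules over Noetherian rings (`grade_le_projectiveDimension`).

For the last inequality, cyclic modules suffice by Baer's criterion; D̂/I contains the
ϖ-torsion-free lattice D̂°/(I ∩ D̂°), whose projective dimension is bounded by that of its reduction
(`IsPiComplete.killsEnd_id`). What remains is that the Weyl algebra in n variables has dimension at
most n rather than 2n. For this one allows torsion: `GenDim` asks that some central element
annihilate the high Ext groups. Adjoining ∂ᵢ does not raise the dimension obtained in this sense
over k[x_s], because an annihilator involving xᵢ can be differentiated until xᵢ disappears
(`GenDim.ore_of_derivation`, `CoordSystem.IsWeyl.genDim_dRing`). When all ∂ᵢ have been adjoined the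
annihilators are nonzero constants, hence units. -/

namespace CompletedWeyl
open CategoryTheory Filter Topology
open scoped TensorProduct

/-! ## Ore extensions -/

/-- `S` is an Ore extension `R[θ]` of derivation type along `ι`: the commutator of `θ` with `R`
lies in `R` and the powers of `θ` form a basis of `S` as a right `R`-module. -/
structure IsOre {R S : Type*} [Ring R] [Ring S] (ι : R →+* S) (θ : S) : Prop where
  comm : ∀ r, ∃ r', θ * ι r = ι r * θ + ι r'
  bij : Function.Bijective (fun p : ℕ →₀ R => p.sum fun i r => θ ^ i * ι r)

section Ore

variable {R S : Type*} [Ring R] [Ring S] {ι : R →+* S} {θ : S}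

variable (ι θ) in
/-- The elements of order less than `k` in an Ore extension. -/
def oreFilt (k : ℕ) : AddSubgroup S where
  carrier := {x | ∃ r : ℕ → R, x = ∑ i ∈ Finset.range k, θ ^ i * ι (r i)}
  zero_mem' := ⟨0, by simp⟩
  add_mem' := by
    rintro _ _ ⟨r, rfl⟩ ⟨s, rfl⟩
    exact ⟨r + s, by simp [mul_add, Finset.sum_add_distrib]⟩
  neg_mem' := by
    rintro _ ⟨r, rfl⟩
    exact ⟨-r, by simp⟩

theorem pow_mul_mem_oreFilt {i k : ℕ} (h : i < k) (r : R) : θ ^ i * ι r ∈ oreFilt ι θ k :=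
  ⟨Pi.single i r, by
    rw [Finset.sum_eq_single i]
    · simp
    · intro b _ hb
      simp [Pi.single_eq_of_ne hb]
    · simp [h]⟩

theorem oreFilt_induction {k : ℕ} {P : AddSubgroup S}
    (h : ∀ i < k, ∀ r : R, θ ^ i * ι r ∈ P) : oreFilt ι θ k ≤ P := by
  rintro _ ⟨r, rfl⟩
  exact sum_mem fun i hi => h i (Finset.mem_range.mp hi) _

theorem theta_mul_mem_oreFilt {k : ℕ} {x : S} (hx : x ∈ oreFilt ι θ k) :
    θ * x ∈ oreFilt ι θ (k + 1) := by
  refine oreFilt_induction (P := (oreFilt ι θ (k + 1)).comap (AddMonoidHom.mulLeft θ))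
    (fun i hi r => ?_) hx
  change θ * (θ ^ i * ι r) ∈ oreFilt ι θ (k + 1)
  rw [← mul_assoc, ← pow_succ']
  exact pow_mul_mem_oreFilt (by omega) r

theorem mem_oreFilt_succ {k : ℕ} {x : S} (hx : x ∈ oreFilt ι θ (k + 1)) :
    ∃ r, x - θ ^ k * ι r ∈ oreFilt ι θ k := by
  obtain ⟨r, rfl⟩ := hx
  exact ⟨r k, r, by rw [Finset.sum_range_succ, add_sub_cancel_right]⟩

variable (hcomm : ∀ r, ∃ r', θ * ι r = ι r * θ + ι r')
include hcomm

/-- Each exchange of θ with a coefficient produces an error without that θ, so the leading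
coefficient may be written on either side modulo lower order. -/
theorem mul_pow_sub_mem_oreFilt (k : ℕ) (r : R) : ι r * θ ^ k - θ ^ k * ι r ∈ oreFilt ι θ k := by
  induction k generalizing r with
  | zero => simp
  | succ k ih =>
    have hmulθ : ∀ x ∈ oreFilt ι θ k, x * θ ∈ oreFilt ι θ (k + 1) := by
      intro x hx
      refine oreFilt_induction (P := (oreFilt ι θ (k + 1)).comap (AddMonoidHom.mulRight θ))
        (fun i hi s => ?_) hx
      change θ ^ i * ι s * θ ∈ oreFilt ι θ (k + 1)
      obtain ⟨s', hs'⟩ := hcomm s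
      rw [mul_assoc, eq_sub_of_add_eq hs'.symm, mul_sub, ← mul_assoc, ← pow_succ]
      exact sub_mem (pow_mul_mem_oreFilt (by omega) s) (pow_mul_mem_oreFilt (by omega) s')
    obtain ⟨r', hr'⟩ := hcomm r
    have : ι r * θ ^ (k + 1) - θ ^ (k + 1) * ι r =
        (ι r * θ ^ k - θ ^ k * ι r) * θ - θ ^ k * ι r' := by
      rw [pow_succ, sub_mul, mul_assoc (θ ^ k) θ, hr', mul_add]
      noncomm_ring
    rw [this]
    exact sub_mem (hmulθ _ (ih r)) (pow_mul_mem_oreFilt (by omega) r')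

theorem mul_mem_oreFilt {k : ℕ} {x : S} (r : R) (hx : x ∈ oreFilt ι θ k) :
    ι r * x ∈ oreFilt ι θ k := by
  refine oreFilt_induction (P := (oreFilt ι θ k).comap (AddMonoidHom.mulLeft (ι r)))
    (fun i hi s => ?_) hx
  change ι r * (θ ^ i * ι s) ∈ oreFilt ι θ k
  have h := mul_pow_sub_mem_oreFilt hcomm i r
  obtain ⟨t, ht⟩ := h
  have : ι r * (θ ^ i * ι s) = θ ^ i * ι (r * s) + ∑ j ∈ Finset.range i, θ ^ j * ι (t j * s) := by
    rw [← mul_assoc, eq_add_of_sub_eq ht, add_mul, Finset.sum_mul, add_comm]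
    simp [mul_assoc]
  rw [this]
  exact add_mem (pow_mul_mem_oreFilt hi _) (sum_mem fun j hj =>
    pow_mul_mem_oreFilt ((Finset.mem_range.mp hj).trans hi) _)

/-- The leading coefficients of degree `k` of the elements of a left ideal. -/
def leadingIdeal (I : Submodule S S) (k : ℕ) : Submodule R R where
  carrier := {r | ∃ x ∈ I, x - θ ^ k * ι r ∈ oreFilt ι θ k}
  zero_mem' := ⟨0, zero_mem _, by simp⟩
  add_mem' := by
    rintro r s ⟨x, hx, hxr⟩ ⟨y, hy, hys⟩
    refine ⟨x + y, add_mem hx hy, ?_⟩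
    rw [map_add, mul_add, add_sub_add_comm]
    exact add_mem hxr hys
  smul_mem' := by
    rintro a r ⟨x, hx, hxr⟩
    refine ⟨ι a * x, I.smul_mem _ hx, ?_⟩
    have : ι a * x - θ ^ k * ι (a • r) =
        ι a * (x - θ ^ k * ι r) + (ι a * θ ^ k - θ ^ k * ι a) * ι r := by
      rw [smul_eq_mul, map_mul]
      noncomm_ring
    rw [this]
    refine add_mem (mul_mem_oreFilt hcomm a hxr) ?_
    obtain ⟨t, ht⟩ := mul_pow_sub_mem_oreFilt hcomm k a
    rw [ht, Finset.sum_mul]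
    refine sum_mem fun j hj => ?_
    rw [mul_assoc, ← map_mul]
    exact pow_mul_mem_oreFilt (Finset.mem_range.mp hj) _

omit hcomm in
-- Beyond the index k₀ where the diagonal becomes stationary, every entry with both indices at least
-- k₀ equals the diagonal value; the finitely many rows below k₀ stabilize separately.
theorem exists_forall_stabilizes {R M : Type*} [Ring R] [AddCommGroup M] [Module R M]
    [IsNoetherian R M] (g : ℕ → ℕ → Submodule R M) (h1 : ∀ k, Monotone (g k))
    (h2 : ∀ m, Monotone fun k => g k m) : ∃ N, ∀ m, N ≤ m → ∀ k, g k m = g k N := by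
  have hst := (monotone_stabilizes_iff_noetherian (R := R) (M := M)).mpr inferInstance
  obtain ⟨k₀, hk₀⟩ := hst ⟨fun n => g n n, fun a b h => (h1 a h).trans (h2 b h)⟩
  choose nk hnk using fun k => hst ⟨g k, h1 k⟩
  refine ⟨max k₀ ((Finset.range k₀).sup nk), fun m hm k => ?_⟩
  rcases lt_or_ge k k₀ with hk | hk
  · have hle : nk k ≤ (Finset.range k₀).sup nk := Finset.le_sup (Finset.mem_range.mpr hk)
    exact (hnk k m (hle.trans ((le_max_right _ _).trans hm))).symm.trans
      (hnk k _ (hle.trans (le_max_right _ _)))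
  · have key : ∀ l, k₀ ≤ l → g k l = g k₀ k₀ := fun l hl => by
      refine le_antisymm ?_ ((h1 k₀ hl).trans (h2 l hk))
      have := hk₀ (max k l) (hl.trans (le_max_right _ _))
      exact ((h1 k (le_max_right k l)).trans (h2 _ (le_max_left k l))).trans this.symm.le
    rw [key m ((le_max_left _ _).trans hm), key _ (le_max_left _ _)]

/-- Hilbert's basis theorem. The left ideals of leading coefficients stabilize uniformly in the
degree, and an element of a larger ideal is reduced into the smaller one by cancelling leading
terms. -/
theorem isNoetherianRing_of_ore [IsNoetherianRing R] (hgen : ∀ x, ∃ k, x ∈ oreFilt ι θ k) :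
    IsNoetherianRing S := by
  refine monotone_stabilizes_iff_noetherian.mp fun f => ?_
  have hmono : ∀ {I J : Submodule S S}, I ≤ J → ∀ k,
      leadingIdeal hcomm I k ≤ leadingIdeal hcomm J k := by
    rintro I J h k r ⟨x, hx, hr⟩
    exact ⟨x, h hx, hr⟩
  obtain ⟨N, hN⟩ := exists_forall_stabilizes (fun k m => leadingIdeal hcomm (f m) k)
    (fun k a b h => hmono (f.mono h) k) (fun m => monotone_nat_of_le_succ fun k => by
      rintro r ⟨x, hx, hr⟩
      refine ⟨θ * x, (f m).smul_mem θ hx, ?_⟩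
      rw [pow_succ', mul_assoc, ← mul_sub]
      exact theta_mul_mem_oreFilt hr)
  refine ⟨N, fun m hm => le_antisymm (f.mono hm) ?_⟩
  have : ∀ k, ∀ x ∈ f m, x ∈ oreFilt ι θ k → x ∈ f N := by
    intro k
    induction k with
    | zero =>
      rintro x _ ⟨r, rfl⟩
      simp
    | succ k ih =>
      intro x hx hxk
      obtain ⟨r, hr⟩ := mem_oreFilt_succ hxk
      have hr' : r ∈ leadingIdeal hcomm (f m) k := ⟨x, hx, hr⟩
      rw [hN m hm k] at hr'
      obtain ⟨y, hy, hyr⟩ := hr'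
      have := ih (x - y) (sub_mem hx (f.mono hm hy)) (by
        have := sub_mem hr hyr
        rwa [sub_sub_sub_cancel_right] at this)
      simpa using add_mem this hy
  exact fun x hx => (hgen x).elim fun k hk => this k x hx hk

omit hcomm

theorem IsOre.exists_mem_oreFilt (h : IsOre ι θ) (x : S) : ∃ k, x ∈ oreFilt ι θ k := by
  obtain ⟨p, rfl⟩ := h.bij.2 x
  refine ⟨p.support.sup id + 1, sum_mem fun i hi => pow_mul_mem_oreFilt ?_ _⟩
  exact Nat.lt_succ_of_le (Finset.le_sup (f := id) hi)

theorem IsOre.isNoetherianRing [IsNoetherianRing R] (h : IsOre ι θ) : IsNoetherianRing S :=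
  isNoetherianRing_of_ore h.comm h.exists_mem_oreFilt

end Ore

/-! ## Ore extensions from locally nilpotent inner derivations -/

section Taylor

variable {S : Type*} [Ring S]

/-- The inner derivation `r ↦ r b - b r`. -/
def adR (b : S) : S →+ S := AddMonoidHom.mulRight b - AddMonoidHom.mulLeft b

theorem adR_apply (b r : S) : adR b r = r * b - b * r := rfl

theorem adR_mul (b r s : S) : adR b (r * s) = adR b r * s + r * adR b s := by
  simp only [adR_apply]
  noncomm_ring

theorem adR_pow {a b : S} (hab : adR b a = 1) (m : ℕ) : adR b (a ^ (m + 1)) = (m + 1) * a ^ m := by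
  induction m with
  | zero => simp [hab]
  | succ m ih =>
    rw [pow_succ, adR_mul, ih, hab, mul_one, mul_assoc, ← pow_succ]
    push_cast
    noncomm_ring

theorem iterate_adR_sum {ι : Type*} (b : S) (N : ℕ) (s : Finset ι) (f : ι → S) :
    (adR b)^[N] (∑ i ∈ s, f i) = ∑ i ∈ s, (adR b)^[N] (f i) := by
  induction N with
  | zero => simp
  | succ N ih => simp only [Function.iterate_succ_apply', ih, map_sum]

theorem adR_iterate_pow_mul {a b : S} (hab : adR b a = 1) (m : ℕ) {c : S}
    (hc : adR b c = 0) : (adR b)^[m] (a ^ m * c) = m.factorial * c := by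
  induction m with
  | zero => simp
  | succ m ih =>
    rw [Function.iterate_succ_apply, adR_mul, hc, mul_zero, add_zero, adR_pow hab, mul_assoc]
    have hcast : ∀ (k : ℕ) (x : S), adR b ((k : S) * x) = k * adR b x := fun k x => by
      rw [← nsmul_eq_mul, map_nsmul, nsmul_eq_mul]
    have hit : ∀ (l k : ℕ) (x : S), (adR b)^[l] ((k : S) * x) = k * (adR b)^[l] x := by
      intro l
      induction l with
      | zero => simp
      | succ l ihl =>
        intro k x
        rw [Function.iterate_succ_apply, hcast, ihl, Function.iterate_succ_apply]
    have := hit m (m + 1) (a ^ m * c)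
    push_cast at this
    rw [this, ih, Nat.factorial_succ]
    push_cast
    rw [mul_assoc]

theorem adR_iterate_pow_mul_of_lt {a b : S} (hab : adR b a = 1) {m N : ℕ} (h : m < N) {c : S}
    (hc : adR b c = 0) : (adR b)^[N] (a ^ m * c) = 0 := by
  obtain ⟨k, rfl⟩ := Nat.exists_eq_add_of_lt h
  rw [show m + k + 1 = (k + 1) + m by omega, Function.iterate_add_apply,
    adR_iterate_pow_mul hab m hc, Function.iterate_succ_apply]
  have : adR b ((m.factorial : S) * c) = 0 := by
    rw [← nsmul_eq_mul, map_nsmul, hc, smul_zero]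
  rw [this, iterate_map_zero]

/-- If `[a, b] = 1` in a subring `Q` on which `[·, b]` is locally nilpotent, then `Q` is an Ore
extension of the centralizer of `b` in `Q`, provided the positive integers are invertible. -/
theorem isOre_of_adR {Q P : Subring S} {a b : S} (hinv : ∀ m : ℕ, m ≠ 0 → IsUnit (m : S))
    (hinvQ : ∀ m : ℕ, ∀ q ∈ Q, ∀ s : S, (m : S) * s = q → m ≠ 0 → s ∈ Q)
    (ha : a ∈ Q) (hab : adR b a = 1) (hbQ : ∀ q ∈ Q, adR b q ∈ Q)
    (hnil : ∀ q ∈ Q, ∃ N, (adR b)^[N] q = 0) (hPQ : P ≤ Q)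
    (hP : ∀ q, q ∈ P ↔ q ∈ Q ∧ adR b q = 0) :
    IsOre (Subring.inclusion hPQ) (⟨a, ha⟩ : Q) where
  comm r := by
    have hr := (hP r.1).mp r.2
    have hmem : a * r - r * a ∈ P := by
      refine (hP _).mpr ⟨sub_mem (mul_mem ha hr.1) (mul_mem hr.1 ha), ?_⟩
      rw [map_sub, adR_mul, adR_mul, hr.2, hab]
      simp
    exact ⟨⟨_, hmem⟩, Subtype.ext (by simp)⟩
  bij := by
    have hsum : ∀ p : ℕ →₀ P, ((p.sum fun i r => (⟨a, ha⟩ : Q) ^ i * Subring.inclusion hPQ r : Q) : S)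
        = ∑ i ∈ p.support, a ^ i * (p i : S) := fun p => by
      simp [Finsupp.sum]
    have hadP : ∀ c : P, adR b c = 0 := fun c => ((hP _).mp c.2).2
    constructor
    · intro p q hpq
      rw [← sub_eq_zero]
      set r := p - q with hr
      have h0 : ((r.sum fun i r => (⟨a, ha⟩ : Q) ^ i * Subring.inclusion hPQ r : Q) : S) = 0 := by
        rw [hr, Finsupp.sum_sub_index (by intros; simp [mul_sub])]
        simpa [sub_eq_zero] using hpq
      rw [hsum] at h0
      by_contra hne
      have hs : r.support.Nonempty := Finsupp.support_nonempty_iff.mpr hne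
      -- The N-th bracket with b kills all terms of degree below N and multiplies the top
      -- coefficient by N!.
      set N := r.support.max' hs
      have hN : N ∈ r.support := Finset.max'_mem _ _
      have h1 := congrArg ((adR b)^[N]) h0
      rw [iterate_map_zero, iterate_adR_sum, Finset.sum_eq_single N] at h1
      · rw [adR_iterate_pow_mul hab _ (hadP _)] at h1
        have := (hinv N.factorial (Nat.factorial_ne_zero _)).mul_right_eq_zero.mp h1
        exact Finsupp.mem_support_iff.mp hN (Subtype.ext this)
      · intro i hi hiN
        exact adR_iterate_pow_mul_of_lt hab (lt_of_le_of_ne (Finset.le_max' _ _ hi) hiN) (hadP _)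
      · exact fun h => absurd hN h
    · have key : ∀ N, ∀ q ∈ Q, (adR b)^[N] q = 0 →
          ∃ p : ℕ →₀ P, ∑ i ∈ p.support, a ^ i * (p i : S) = q := by
        intro N
        induction N with
        | zero => exact fun q _ h => ⟨0, by simpa using h.symm⟩
        | succ N ih =>
          intro q hq h
          have hmemQ : ∀ k, (adR b)^[k] q ∈ Q := fun k => by
            induction k with
            | zero => exact hq
            | succ k ihk =>
              rw [Function.iterate_succ_apply']
              exact hbQ _ ihk
          obtain ⟨v, hv⟩ := hinv N.factorial (Nat.factorial_ne_zero _)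
          -- The top Taylor coefficient: a^N c and q have the same N-th bracket, so subtracting a^N
          -- c lowers the order of nilpotency.
          set c : S := ↑v⁻¹ * (adR b)^[N] q with hc
          have hNc : (N.factorial : S) * c = (adR b)^[N] q := by
            rw [hc, ← hv, Units.mul_inv_cancel_left]
          have hcQ : c ∈ Q := hinvQ _ _ (hmemQ N) _ hNc (Nat.factorial_ne_zero _)
          have hcad : adR b c = 0 := by
            refine (hinv N.factorial (Nat.factorial_ne_zero _)).mul_right_eq_zero.mp ?_
            rw [← nsmul_eq_mul, ← map_nsmul, nsmul_eq_mul, hNc,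
              ← Function.iterate_succ_apply' (f := adR b), h]
          have hcP : c ∈ P := (hP c).mpr ⟨hcQ, hcad⟩
          obtain ⟨p, hp⟩ := ih (q - a ^ N * c) (sub_mem hq (mul_mem (pow_mem ha _) hcQ)) (by
            rw [iterate_map_sub, adR_iterate_pow_mul hab N hcad, hNc, sub_self])
          refine ⟨p + Finsupp.single N ⟨c, hcP⟩, ?_⟩
          have hadd : ∀ p' : ℕ →₀ P, ∑ i ∈ p'.support, a ^ i * (p' i : S) =
            p'.sum fun i r => a ^ i * (r : S) := fun _ => rfl
          rw [hadd, Finsupp.sum_add_index' (by simp) (by simp [mul_add]),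
            Finsupp.sum_single_index (by simp), ← hadd, hp]
          simp
      intro q
      obtain ⟨N, hN⟩ := hnil q q.2
      obtain ⟨p, hp⟩ := key N q q.2 hN
      exact ⟨p, Subtype.ext ((hsum p).trans hp)⟩

end Taylor

/-! ## Base change along homomorphisms of noncommutative rings -/

noncomputable section BaseChangeTheory

variable {R S : Type u} [Ring R] [Ring S] (f : R →+* S)

section Basic

variable (M : ModuleCat.{u} R)

/-- The quotient map onto the base change. -/
def bcMk : S ⊗[ℤ] M →ₗ[S] baseChange f M := (balancingSubmodule f M).mkQ

theorem bcMk_surjective : Function.Surjective (bcMk f M) := (balancingSubmodule f M).mkQ_surjective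

theorem bcMk_eq_zero {z : S ⊗[ℤ] M} : bcMk f M z = 0 ↔ z ∈ balancingSubmodule f M :=
  Submodule.Quotient.mk_eq_zero _

/-- The tensors `s ⊗ m` in the base change. -/
def bcTmul : S →+ M →+ baseChange f M :=
  AddMonoidHom.mk' (fun s => AddMonoidHom.mk' (fun m => bcMk f M (s ⊗ₜ[ℤ] m))
    (fun m m' => by rw [TensorProduct.tmul_add, map_add]))
    (fun s s' => AddMonoidHom.ext fun m => by
      change bcMk f M _ = bcMk f M _ + bcMk f M _
      rw [TensorProduct.add_tmul, map_add])

variable {M}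

theorem bcTmul_eq (s : S) (m : M) : bcTmul f M s m = bcMk f M (s ⊗ₜ[ℤ] m) := rfl

theorem smul_bcTmul (s' s : S) (m : M) : s' • bcTmul f M s m = bcTmul f M (s' * s) m :=
  ((bcMk f M).map_smul s' (s ⊗ₜ[ℤ] m)).symm

theorem bcTmul_smul (s : S) (r : R) (m : M) : bcTmul f M s (r • m) = bcTmul f M (s * f r) m := by
  symm
  rw [← sub_eq_zero, bcTmul_eq, bcTmul_eq, ← map_sub, bcMk_eq_zero]
  exact Submodule.subset_span ⟨s, r, m, rfl⟩

theorem exists_eq_sum_bcTmul (z : baseChange f M) :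
    ∃ (k : ℕ) (s : Fin k → S) (m : Fin k → M), z = ∑ i, bcTmul f M (s i) (m i) := by
  obtain ⟨z, rfl⟩ := bcMk_surjective f M z
  induction z with
  | zero => exact ⟨0, 0, 0, by simp⟩
  | tmul s m => exact ⟨1, fun _ => s, fun _ => m, by simp [bcTmul_eq]⟩
  | add x y hx hy =>
    obtain ⟨k, s, m, hx⟩ := hx
    obtain ⟨l, s', m', hy⟩ := hy
    refine ⟨k + l, Fin.append s s', Fin.append m m', ?_⟩
    rw [map_add, hx, hy, Fin.sum_univ_add]
    simp

@[elab_as_elim]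
theorem bc_induction {P : baseChange f M → Prop} (z : baseChange f M)
    (h0 : P 0) (ht : ∀ s m, P (bcTmul f M s m)) (ha : ∀ x y, P x → P y → P (x + y)) : P z := by
  obtain ⟨k, s, m, rfl⟩ := exists_eq_sum_bcTmul f z
  exact Finset.sum_induction _ P ha h0 fun i _ => ht _ _

theorem liftAddHom_eq_zero {X : Type*} [AddCommGroup X] (β : S →+ M →+ X)
    (hβ : ∀ s r m, β (s * f r) m = β s (r • m))
    (hz : ∀ (r : ℤ) (s : S) (m : M), β (r • s) m = β s (r • m)) (z : S ⊗[ℤ] M)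
    (h : z ∈ balancingSubmodule f M) : TensorProduct.liftAddHom β hz z = 0 := by
  -- The lift is merely additive while the relations are an S-span; vanishing on all S-multiples is
  -- the form that survives span induction.
  have key : ∀ s' : S, TensorProduct.liftAddHom β hz (s' • z) = 0 := by
    refine Submodule.span_induction (p := fun z _ => ∀ s' : S, TensorProduct.liftAddHom β
      hz (s' • z) = 0) ?_ ?_ ?_ ?_ h
    · rintro _ ⟨s, r, m, rfl⟩ s'
      rw [smul_sub, TensorProduct.smul_tmul', TensorProduct.smul_tmul', map_sub,
        TensorProduct.liftAddHom_tmul, TensorProduct.liftAddHom_tmul, smul_eq_mul, smul_eq_mul,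
        ← mul_assoc, hβ, sub_self]
    · intro s'
      rw [smul_zero, map_zero]
    · intro x y _ _ hx hy s'
      rw [smul_add, map_add, hx, hy, add_zero]
    · intro a x _ hx s'
      rw [smul_smul, hx]
  simpa using key 1

/-- Balanced biadditive maps factor through the base change. -/
def bcLiftAdd {X : Type*} [AddCommGroup X] (β : S →+ M →+ X)
    (hβ : ∀ s r m, β (s * f r) m = β s (r • m)) : baseChange f M →+ X :=
  QuotientAddGroup.lift (balancingSubmodule f M).toAddSubgroup
    (TensorProduct.liftAddHom β (fun r s m => by
      rw [map_zsmul, map_zsmul, AddMonoidHom.zsmul_apply]))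
    (fun z hz => liftAddHom_eq_zero f β hβ _ z hz)

@[simp]
theorem bcLiftAdd_tmul {X : Type*} [AddCommGroup X] (β : S →+ M →+ X)
    (hβ : ∀ s r m, β (s * f r) m = β s (r • m)) (s : S) (m : M) :
    bcLiftAdd f β hβ (bcTmul f M s m) = β s m :=
  TensorProduct.liftAddHom_tmul β (fun r s m => by
    rw [map_zsmul, map_zsmul, AddMonoidHom.zsmul_apply]) s m

/-- The biadditive map `(s, m) ↦ s • g m`. -/
def smulBiadd {N : ModuleCat.{u} S} (g : M →+ N) : S →+ M →+ N :=
  AddMonoidHom.mk' (fun s => AddMonoidHom.mk' (fun m => s • g m)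
    (fun m m' => by rw [map_add, smul_add]))
    (fun s s' => AddMonoidHom.ext fun m => add_smul s s' (g m))

theorem smulBiadd_apply {N : ModuleCat.{u} S} (g : M →+ N) (s : S) (m : M) :
    smulBiadd g s m = s • g m := rfl

/-- The linear map underlying `bcLift`. -/
def bcLiftLinear {N : ModuleCat.{u} S} (g : M →+ N) (hg : ∀ (r : R) (m : M), g (r • m) = f r • g m) :
    baseChange f M →ₗ[S] N :=
  have hβ : ∀ s r m, smulBiadd g (s * f r) m = smulBiadd g s (r • m) := fun s r m => by
    rw [smulBiadd_apply, smulBiadd_apply, hg, mul_smul]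
  { bcLiftAdd f (smulBiadd g) hβ with
    map_smul' := fun s z => by
      change bcLiftAdd f (smulBiadd g) hβ (s • z) = s • bcLiftAdd f (smulBiadd g) hβ z
      refine bc_induction f z ?_ ?_ ?_
      · rw [smul_zero, map_zero, smul_zero]
      · intro s' m
        rw [smul_bcTmul, bcLiftAdd_tmul, bcLiftAdd_tmul, smulBiadd_apply, smulBiadd_apply, mul_smul]
      · intro x y hx hy
        rw [smul_add, map_add, map_add, hx, hy, smul_add] }

/-- Semilinear maps to an `S`-module extend to the base change. -/
def bcLift {N : ModuleCat.{u} S} (g : M →+ N) (hg : ∀ (r : R) (m : M), g (r • m) = f r • g m) :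
    baseChange f M ⟶ N :=
  ModuleCat.ofHom (bcLiftLinear f g hg)

@[simp]
theorem bcLift_tmul {N : ModuleCat.{u} S} (g : M →+ N)
    (hg : ∀ (r : R) (m : M), g (r • m) = f r • g m) (s : S) (m : M) :
    (bcLift f g hg).hom (bcTmul f M s m) = s • g m :=
  bcLiftAdd_tmul f (smulBiadd g) (fun s r m => by
    rw [smulBiadd_apply, smulBiadd_apply, hg, mul_smul]) s m

theorem bc_hom_ext {N : ModuleCat.{u} S} {g h : baseChange f M ⟶ N}
    (H : ∀ m, g.hom (bcTmul f M 1 m) = h.hom (bcTmul f M 1 m)) : g = h := by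
  refine ModuleCat.hom_ext (LinearMap.ext fun z => ?_)
  refine bc_induction f z (by simp) (fun s m => ?_) (fun x y hx hy => by rw [map_add, map_add, hx, hy])
  have := smul_bcTmul f s 1 m
  rw [mul_one] at this
  rw [← this, map_smul, map_smul, H]

variable {N P : ModuleCat.{u} R}

/-- The functoriality of the base change. -/
def bcMap (g : M ⟶ N) : baseChange f M ⟶ baseChange f N :=
  bcLift f ((bcTmul f N 1).comp g.hom.toAddMonoidHom) (fun r m => by
    change bcTmul f N 1 (g.hom (r • m)) = f r • bcTmul f N 1 (g.hom m)
    rw [map_smul, bcTmul_smul, smul_bcTmul, one_mul, mul_one])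

@[simp]
theorem bcMap_tmul (g : M ⟶ N) (s : S) (m : M) :
    (bcMap f g).hom (bcTmul f M s m) = bcTmul f N s (g.hom m) := by
  rw [bcMap, bcLift_tmul]
  change s • bcTmul f N 1 (g.hom m) = _
  rw [smul_bcTmul, mul_one]

theorem bcMap_id : bcMap f (𝟙 M) = 𝟙 _ := bc_hom_ext f fun m => by simp

theorem bcMap_comp (g : M ⟶ N) (h : N ⟶ P) : bcMap f (g ≫ h) = bcMap f g ≫ bcMap f h :=
  bc_hom_ext f fun m => by simp

theorem bcMap_zero : bcMap f (0 : M ⟶ N) = 0 := bc_hom_ext f fun m => by simp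

theorem bcMap_surjective {g : M ⟶ N} (hg : Function.Surjective g.hom) :
    Function.Surjective (bcMap f g).hom := by
  intro z
  refine bc_induction f z ⟨0, map_zero _⟩ (fun s n => ?_) ?_
  · obtain ⟨m, rfl⟩ := hg n
    exact ⟨_, bcMap_tmul f g s m⟩
  · rintro _ _ ⟨x, rfl⟩ ⟨y, rfl⟩
    exact ⟨x + y, map_add _ _ _⟩

theorem bcMap_exact {g : M ⟶ N} {h : N ⟶ P} (hgh : Function.Exact g.hom h.hom)
    (hh : Function.Surjective h.hom) : Function.Exact (bcMap f g).hom (bcMap f h).hom := by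
  intro z
  constructor
  · intro hz
    let Q := (bcMap f g).hom.range
    -- An inverse on the cokernel: p is lifted along h, and exactness makes the class independent of
    -- the lift.
    let κ : P → (baseChange f N ⧸ Q) := fun p => Q.mkQ (bcTmul f N 1 (Function.surjInv hh p))
    have hκ : ∀ n, κ (h.hom n) = Q.mkQ (bcTmul f N 1 n) := fun n => by
      have h0 : h.hom (Function.surjInv hh (h.hom n) - n) = 0 := by
        rw [map_sub, Function.surjInv_eq hh, sub_self]
      obtain ⟨m, hm⟩ := (hgh _).mp h0
      rw [← sub_eq_zero, ← map_sub, ← map_sub, Submodule.mkQ_apply, Submodule.Quotient.mk_eq_zero,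
        ← hm]
      exact ⟨bcTmul f M 1 m, bcMap_tmul f g 1 m⟩
    let L : baseChange f P ⟶ ModuleCat.of S (baseChange f N ⧸ Q) :=
      bcLift f (N := ModuleCat.of S (baseChange f N ⧸ Q)) (AddMonoidHom.mk' κ (fun p p' => by
        obtain ⟨n, rfl⟩ := hh p
        obtain ⟨n', rfl⟩ := hh p'
        rw [← map_add, hκ, hκ, hκ, map_add, map_add])) (fun r p => by
        obtain ⟨n, rfl⟩ := hh p
        change κ (r • h.hom n) = f r • κ (h.hom n)
        rw [← map_smul, hκ, hκ, bcTmul_smul, ← map_smul, smul_bcTmul, one_mul, mul_one])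
    have hL : bcMap f h ≫ L = ModuleCat.ofHom Q.mkQ := bc_hom_ext f fun n => by
      rw [ModuleCat.hom_comp, LinearMap.comp_apply, bcMap_tmul, bcLift_tmul, one_smul]
      exact hκ n
    have h1 : Q.mkQ z = 0 := by
      have := LinearMap.congr_fun (congrArg ModuleCat.Hom.hom hL) z
      rw [ModuleCat.hom_comp, LinearMap.comp_apply, hz, map_zero] at this
      exact this.symm
    rw [Submodule.mkQ_apply, Submodule.Quotient.mk_eq_zero] at h1
    exact h1
  · rintro ⟨x, rfl⟩
    have h0 : g ≫ h = 0 := ModuleCat.hom_ext (LinearMap.ext fun m => (hgh _).mpr ⟨m, rfl⟩)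
    have := bcMap_comp f g h
    rw [h0, bcMap_zero] at this
    exact (LinearMap.congr_fun (congrArg ModuleCat.Hom.hom this) x).symm

/-- Base change is left adjoint to restriction of scalars, which preserves epimorphisms. -/
instance projective_baseChange [Projective M] : Projective (baseChange f M) where
  factors {E X} h e _ := by
    let e' : (ModuleCat.restrictScalars f).obj E ⟶ (ModuleCat.restrictScalars f).obj X :=
      (ModuleCat.restrictScalars f).map e
    have he : Function.Surjective e.hom := (ModuleCat.epi_iff_surjective e).mp inferInstance
    have : Epi e' := (ModuleCat.epi_iff_surjective e').mpr he
    let h' : M ⟶ (ModuleCat.restrictScalars f).obj X :=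
      toBaseChange f M ≫ (ModuleCat.restrictScalars f).map h
    let l := Projective.factorThru h' e'
    let l' : M →+ E := AddMonoidHom.mk' (fun m => (l.hom m : E)) (fun m m' => l.hom.map_add m m')
    have hl' : ∀ (r : R) (m : M), l' (r • m) = f r • l' m := fun r m => l.hom.map_smul r m
    refine ⟨bcLift f (N := E) l' hl', ?_⟩
    refine bc_hom_ext f fun m => ?_
    rw [ModuleCat.hom_comp, LinearMap.comp_apply, bcLift_tmul, one_smul]
    exact LinearMap.congr_fun (congrArg ModuleCat.Hom.hom (Projective.factorThru_comp h' e')) m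

instance finite_baseChange [Module.Finite R M] : Module.Finite S (baseChange f M) := by
  classical
  obtain ⟨s, hs⟩ := ‹Module.Finite R M›
  refine ⟨⟨s.image (bcTmul f M 1), ?_⟩⟩
  rw [eq_top_iff]
  rintro z -
  refine bc_induction f z (zero_mem _) (fun a m => ?_) (fun _ _ => add_mem)
  have hm : m ∈ Submodule.span R (s : Set M) := hs ▸ Submodule.mem_top
  induction hm using Submodule.span_induction generalizing a with
  | mem x hx =>
    have := smul_bcTmul f a 1 x
    rw [mul_one] at this
    rw [← this]
    exact Submodule.smul_mem _ _ (Submodule.subset_span (by simpa using ⟨x, hx, rfl⟩))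
  | zero => simp
  | add x y _ _ hx hy =>
    rw [map_add]
    exact add_mem (hx a) (hy a)
  | smul r x _ hx =>
    rw [bcTmul_smul]
    exact hx _

instance subsingleton_baseChange [Subsingleton M] : Subsingleton (baseChange f M) := by
  refine subsingleton_of_forall_eq 0 fun z => ?_
  refine bc_induction f z rfl (fun s m => ?_) (fun x y hx hy => by rw [hx, hy, add_zero])
  rw [Subsingleton.elim m 0, map_zero]

end Basic

/-! ### Base change of free modules of finite rank. -/

section Free

variable (m : ℕ)

/-- The comparison `S ⊗ R^m → S^m`. -/
def bcFreeHom : baseChange f (ModuleCat.of R (Fin m → R)) ⟶ ModuleCat.of S (Fin m → S) :=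
  bcLift f (N := ModuleCat.of S (Fin m → S))
    (AddMonoidHom.mk' (fun v i => f (v i)) (fun v w => by ext i; simp))
    (fun r v => by ext i; simp)

theorem bcFreeHom_tmul (s : S) (v : Fin m → R) :
    (bcFreeHom f m).hom (bcTmul f (ModuleCat.of R (Fin m → R)) s v) = fun i => s * f (v i) :=
  bcLift_tmul f _ _ _ _

theorem eq_sum_bcFreeHom (z : baseChange f (ModuleCat.of R (Fin m → R))) :
    z = ∑ i, bcTmul f (ModuleCat.of R (Fin m → R)) ((bcFreeHom f m).hom z i) (Pi.single i 1) := by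
  refine bc_induction f z ?_ (fun s v => ?_) (fun x y hx hy => ?_)
  · rw [map_zero]
    refine (Finset.sum_eq_zero fun i _ => ?_).symm
    exact congrArg (fun g : _ →+ _ => g _) (map_zero (bcTmul f (ModuleCat.of R (Fin m → R))))
  · rw [bcFreeHom_tmul]
    have hv : v = ∑ i, v i • (Pi.single i (1 : R) : Fin m → R) := by
      ext j
      simp [Finset.sum_apply, Pi.single_apply]
    conv_lhs => rw [hv, map_sum]
    exact Finset.sum_congr rfl fun i _ => bcTmul_smul f (M := ModuleCat.of R (Fin m → R)) s _ _
  · conv_lhs => rw [hx, hy]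
    rw [← Finset.sum_add_distrib]
    refine Finset.sum_congr rfl fun i _ => ?_
    rw [map_add]
    exact (congrArg (fun g : _ →+ _ => g _)
      (map_add (bcTmul f (ModuleCat.of R (Fin m → R))) _ _)).symm

theorem bcFreeHom_bijective : Function.Bijective (bcFreeHom f m).hom := by
  constructor
  · intro x y h
    rw [eq_sum_bcFreeHom f m x, eq_sum_bcFreeHom f m y, h]
  · intro w
    refine ⟨∑ i, bcTmul f (ModuleCat.of R (Fin m → R)) (w i) (Pi.single i 1), ?_⟩
    rw [map_sum]
    ext j
    have : ∀ i, (bcFreeHom f m).hom (bcTmul f (ModuleCat.of R (Fin m → R)) (w i) (Pi.single i 1)) j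
        = if i = j then w i else 0 := fun i => by
      rw [bcFreeHom_tmul]
      by_cases h : i = j
      · subst h; simp
      · simp [h, Ne.symm h]
    rw [Finset.sum_apply, Finset.sum_congr rfl fun i _ => this i]
    simp

end Free

/-! ## Flatness -/

/-- The equational criterion for flatness of `S` as a right `R`-module: solutions in `S` of a
homogeneous system over `R` are combinations of solutions in `R`. -/
def VFlat {R S : Type*} [Ring R] [Ring S] (f : R →+* S) : Prop :=
  ∀ (m p : ℕ) (s : Fin m → S) (r : Fin m → Fin p → R), (∀ x, ∑ i, s i * f (r i x) = 0) →
    ∃ (q : ℕ) (t : Fin q → S) (u : Fin q → Fin m → R),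
      (∀ i, s i = ∑ j, t j * f (u j i)) ∧ ∀ j x, ∑ i, u j i * r i x = 0

/-- Base change along `f` preserves injections. -/
def IsFlat : Prop :=
  ∀ ⦃M N : ModuleCat.{u} R⦄ (g : M ⟶ N), Function.Injective g.hom →
    Function.Injective (bcMap f g).hom

variable {f}

/-- The coordinates of an element in the kernel form a homogeneous system over R. Only the finitely
many coordinates in the supports matter, and the solutions supplied by the criterion are relations
between the vectors v i because g is injective. -/
theorem VFlat.injective_of_finsupp (hf : VFlat f) {X : Type u} {G : ModuleCat.{u} R}
    (g : G ⟶ ModuleCat.of R (X →₀ R)) (hg : Function.Injective g.hom) :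
    Function.Injective (bcMap f g).hom := by
  classical
  rw [injective_iff_map_eq_zero]
  intro z hz
  obtain ⟨k, s, v, rfl⟩ := exists_eq_sum_bcTmul f z
  let coord : ∀ x : X, baseChange f (ModuleCat.of R (X →₀ R)) →+ S := fun x =>
    bcLiftAdd f (AddMonoidHom.mk' (fun s => AddMonoidHom.mk'
      (fun v : X →₀ R => s * f (v x)) (fun v w => by simp [mul_add]))
      (fun s t => by ext; simp [add_mul])) (fun s r v => by
        change s * f r * f (v x) = s * f ((r • v) x)
        simp [mul_assoc])
  have hc : ∀ x, ∑ i, s i * f ((g.hom (v i) : X →₀ R) x) = 0 := fun x => by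
    have h1 := congrArg (coord x) hz
    rw [map_sum (bcMap f g).hom, map_sum (coord x), map_zero (coord x)] at h1
    rw [← h1]
    refine Finset.sum_congr rfl fun i _ => ?_
    rw [bcMap_tmul]
    symm
    apply bcLiftAdd_tmul
  let T : Finset X := Finset.univ.biUnion fun i => (g.hom (v i) : X →₀ R).support
  obtain ⟨q, t, w, hs, hw⟩ := hf k T.card s
    (fun i x => (g.hom (v i) : X →₀ R) (T.equivFin.symm x)) (fun x => hc _)
  let g' : G →ₗ[R] (X →₀ R) := g.hom
  have hzero : ∀ j, ∑ i, w j i • v i = 0 := fun j => by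
    apply hg
    rw [map_zero]
    refine Finsupp.ext fun x => ?_
    have hx : g' (∑ i, w j i • v i) x = ∑ i, w j i * g' (v i) x := by
      rw [map_sum, Finsupp.finsetSum_apply]
      refine Finset.sum_congr rfl fun i _ => ?_
      rw [map_smul, Finsupp.smul_apply, smul_eq_mul]
    refine hx.trans ?_
    by_cases hxT : x ∈ T
    · simpa using hw j (T.equivFin ⟨x, hxT⟩)
    · refine Finset.sum_eq_zero fun i _ => ?_
      have : (g.hom (v i) : X →₀ R) x = 0 := by
        by_contra hne
        exact hxT (Finset.mem_biUnion.mpr ⟨i, Finset.mem_univ i, Finsupp.mem_support_iff.mpr hne⟩)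
      rw [this, mul_zero]
  calc ∑ i, bcTmul f G (s i) (v i) = ∑ i, ∑ j, bcTmul f G (t j) (w j i • v i) := by
        refine Finset.sum_congr rfl fun i _ => ?_
        rw [hs i, map_sum, AddMonoidHom.finsetSum_apply]
        exact Finset.sum_congr rfl fun j _ => (bcTmul_smul f _ _ _).symm
    _ = 0 := by
        rw [Finset.sum_comm]
        refine Finset.sum_eq_zero fun j _ => ?_
        rw [← map_sum, hzero, map_zero]

/-- Cover N by a free module F with kernel L, and let G be the preimage of M in F. Both G → F and L
→ F are inclusions into a free module; an element killed in the base change of N lifts to G and then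
comes from L, hence dies in the base change of M. -/
theorem VFlat.isFlat (hf : VFlat f) : IsFlat f := by
  intro M N g hg
  let F : ModuleCat.{u} R := ModuleCat.of R (N →₀ R)
  let p : F ⟶ N := ModuleCat.ofHom (Finsupp.linearCombination R id)
  have hp : Function.Surjective p.hom := fun n => ⟨Finsupp.single n 1, by simp [p, F]⟩
  let G : Submodule R F := g.hom.range.comap p.hom
  let i : ModuleCat.of R G ⟶ F := ModuleCat.ofHom G.subtype
  let L : Submodule R F := LinearMap.ker p.hom
  let l : ModuleCat.of R L ⟶ F := ModuleCat.ofHom L.subtype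
  have hLG : L ≤ G := fun x hx => ⟨0, by rw [map_zero]; exact hx.symm⟩
  let l' : ModuleCat.of R L ⟶ ModuleCat.of R G := ModuleCat.ofHom (Submodule.inclusion hLG)
  let π : ModuleCat.of R G ⟶ M := ModuleCat.ofHom
    ((LinearEquiv.ofInjective g.hom hg).symm.toLinearMap ∘ₗ
      (p.hom ∘ₗ G.subtype).codRestrict g.hom.range (fun x => x.2))
  have hπ : π ≫ g = i ≫ p := ModuleCat.hom_ext (LinearMap.ext fun x => by
    have := LinearEquiv.apply_symm_apply (LinearEquiv.ofInjective g.hom hg)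
      ⟨p.hom x.1, x.2⟩
    exact congrArg Subtype.val this)
  have hl : l' ≫ i = l := rfl
  have hl'π : l' ≫ π = 0 := ModuleCat.hom_ext (LinearMap.ext fun x => hg (by
    have := LinearMap.congr_fun (congrArg ModuleCat.Hom.hom hπ) (l'.hom x)
    exact (this.trans x.2).trans (map_zero g.hom).symm))
  have hπs : Function.Surjective π.hom := fun m => by
    obtain ⟨x, hx⟩ := hp (g.hom m)
    refine ⟨⟨x, m, hx.symm⟩, hg ?_⟩
    have := LinearMap.congr_fun (congrArg ModuleCat.Hom.hom hπ) ⟨x, m, hx.symm⟩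
    exact this.trans hx
  rw [injective_iff_map_eq_zero]
  intro z hz
  obtain ⟨y, rfl⟩ := bcMap_surjective f hπs z
  have h1 : (bcMap f p).hom ((bcMap f i).hom y) = 0 := by
    have := LinearMap.congr_fun (congrArg ModuleCat.Hom.hom
      ((bcMap_comp f π g).symm.trans ((congrArg (bcMap f) hπ).trans (bcMap_comp f i p)))) y
    exact this.symm.trans hz
  have hex : Function.Exact l.hom p.hom := fun x => ⟨fun hx => ⟨⟨x, hx⟩, rfl⟩, by
    rintro ⟨y, rfl⟩
    exact y.2⟩
  obtain ⟨w, hw⟩ := (bcMap_exact f hex hp _).mp h1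
  have h2 : y = (bcMap f l').hom w := hf.injective_of_finsupp i G.injective_subtype (by
    rw [← hw, ← hl, bcMap_comp]
    rfl)
  rw [h2]
  have := LinearMap.congr_fun (congrArg ModuleCat.Hom.hom (bcMap_comp f l' π)) w
  rw [hl'π, bcMap_zero] at this
  exact this.symm

variable (f) in
/-- The base change of a short complex. -/
def bcShortComplex (X : ShortComplex (ModuleCat.{u} R)) : ShortComplex (ModuleCat.{u} S) :=
  ShortComplex.mk (bcMap f X.f) (bcMap f X.g) (by rw [← bcMap_comp, X.zero, bcMap_zero])

theorem shortExact_of_exact {X : ShortComplex (ModuleCat.{u} R)} (hi : Function.Injective X.f.hom)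
    (he : Function.Exact X.f.hom X.g.hom) (hs : Function.Surjective X.g.hom) : X.ShortExact :=
  ModuleCat.shortComplex_shortExact X he hi hs

theorem IsFlat.shortExact (hf : IsFlat f) {X : ShortComplex (ModuleCat.{u} R)}
    (hX : X.ShortExact) : (bcShortComplex f X).ShortExact := by
  have := hX.mono_f
  have := hX.epi_g
  have hs : Function.Surjective X.g.hom := (ModuleCat.epi_iff_surjective _).mp inferInstance
  exact shortExact_of_exact (X := bcShortComplex f X)
    (hf _ ((ModuleCat.mono_iff_injective X.f).mp inferInstance))
    (bcMap_exact f ((ShortComplex.ShortExact.moduleCat_exact_iff_function_exact X).mp hX.exact) hs)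
    (bcMap_surjective f hs)

/-- S is a free right R-module on the powers of θ, so an equation over S splits into the equations
of its coefficients. -/
theorem IsOre.vflat {R S : Type*} [Ring R] [Ring S] {ι : R →+* S} {θ : S} (h : IsOre ι θ) :
    VFlat ι := by
  intro m p s r hs
  choose c hc using fun i => h.bij.2 (s i)
  obtain ⟨q, hq⟩ : ∃ q, ∀ i, ∀ j, q ≤ j → c i j = 0 := by
    refine ⟨Finset.univ.sup (fun i => (c i).support.sup id + 1), fun i j hj => ?_⟩
    by_contra hne
    have h1 := Finset.le_sup (f := fun i => (c i).support.sup id + 1) (Finset.mem_univ i)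
    have h2 : j ≤ (c i).support.sup id :=
      Finset.le_sup (f := id) (Finsupp.mem_support_iff.mpr hne)
    omega
  have hsum : ∀ a : ℕ →₀ R, (∀ j, q ≤ j → a j = 0) →
      (a.sum fun i r => θ ^ i * ι r) = ∑ j : Fin q, θ ^ (j : ℕ) * ι (a j) := by
    intro a ha
    rw [Finsupp.sum_of_support_subset (s := Finset.range q) _ (fun j hj => by
      by_contra hne
      exact Finsupp.mem_support_iff.mp hj (ha j (by simpa using hne))) _ (by simp),
      Finset.sum_range]
  refine ⟨q, fun j => θ ^ (j : ℕ), fun j i => c i j, fun i => ?_, fun j x => ?_⟩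
  · rw [← hc i]
    exact hsum _ (hq i)
  · let a : ℕ →₀ R := ∑ i, (c i).mapRange (· * r i x) (zero_mul _)
    have ha : ∀ j, a j = ∑ i, c i j * r i x := fun j => by
      simp [a, Finsupp.finsetSum_apply]
    have h0 : a = 0 := by
      apply h.bij.1
      refine Eq.trans ?_ (Finsupp.sum_zero_index (h := fun i r => θ ^ i * ι r)).symm
      change (a.sum fun i r => θ ^ i * ι r) = 0
      rw [hsum a (fun j hj => by
        rw [ha]
        exact Finset.sum_eq_zero fun i _ => by rw [hq i j hj, zero_mul]), ← hs x]
      simp only [ha, map_sum, Finset.mul_sum, map_mul]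
      rw [Finset.sum_comm]
      refine Finset.sum_congr rfl fun i _ => ?_
      have : ((c i).sum fun i r => θ ^ i * ι r) = s i := hc i
      rw [← this, hsum _ (hq i), Finset.sum_mul]
      simp [mul_assoc]
    rw [← ha, h0]
    rfl

end BaseChangeTheory

/-! ## Endomorphisms annihilating `Ext` in high degrees -/

section Kills

universe w v

variable {C : Type u} [Category.{v} C] [Abelian C] [HasExt.{w} C]

/-- Precomposition of an `Ext` class with a morphism. -/
noncomputable def extPre {X Y N : C} (φ : X ⟶ Y) {i : ℕ} (e : Abelian.Ext.{w} Y N i) :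
    Abelian.Ext.{w} X N i :=
  (Abelian.Ext.mk₀ φ).comp e (zero_add i)

theorem extPre_extPre {X Y Z N : C} (φ : X ⟶ Y) (ψ : Y ⟶ Z) {i : ℕ} (e : Abelian.Ext.{w} Z N i) :
    extPre φ (extPre ψ e) = extPre (φ ≫ ψ) e := by
  simp [extPre]

@[simp]
theorem extPre_id {X N : C} {i : ℕ} (e : Abelian.Ext.{w} X N i) : extPre (𝟙 X) e = e := by
  simp [extPre]

@[simp]
theorem extPre_zero {X Y N : C} (φ : X ⟶ Y) {i : ℕ} :
    extPre φ (0 : Abelian.Ext.{w} Y N i) = 0 := by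
  simp [extPre]

@[simp]
theorem zero_extPre {X Y N : C} {i : ℕ} (e : Abelian.Ext.{w} Y N i) :
    extPre (0 : X ⟶ Y) e = 0 := by
  simp [extPre]

theorem add_extPre {X Y N : C} (φ ψ : X ⟶ Y) {i : ℕ} (e : Abelian.Ext.{w} Y N i) :
    extPre (φ + ψ) e = extPre φ e + extPre ψ e := by
  simp [extPre, Abelian.Ext.mk₀_add, Abelian.Ext.add_comp]

/-- The connecting map of the contravariant long exact sequence of `Ext`. -/
noncomputable def extDelta {X : ShortComplex C} (hX : X.ShortExact) {N : C} {i : ℕ}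
    (e : Abelian.Ext.{w} X.X₁ N i) : Abelian.Ext.{w} X.X₃ N (1 + i) :=
  hX.extClass.comp e rfl

theorem extPre_extDelta {X Y : ShortComplex C} (hX : X.ShortExact) (hY : Y.ShortExact)
    (φ : X ⟶ Y) {N : C} {i : ℕ} (e : Abelian.Ext.{w} Y.X₁ N i) :
    extPre φ.τ₃ (extDelta hY e) = extDelta hX (extPre φ.τ₁ e) := by
  unfold extPre extDelta
  rw [← Abelian.Ext.comp_assoc (a₁₂ := 1) _ _ _ (by omega) (by omega) (by omega),
    ← ShortComplex.ShortExact.extClass_naturality hX hY φ,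
    Abelian.Ext.comp_assoc (a₂₃ := i) _ _ _ (by omega) (by omega) (by omega)]

theorem extDelta_extPre {X : ShortComplex C} (hX : X.ShortExact) {N : C} {i : ℕ}
    (e : Abelian.Ext.{w} X.X₂ N i) : extDelta hX (extPre X.f e) = 0 := by
  unfold extPre extDelta
  rw [ShortComplex.ShortExact.extClass_comp_assoc]

theorem exists_extPre_of_extDelta {X : ShortComplex C} (hX : X.ShortExact) {N : C} {i : ℕ}
    (e : Abelian.Ext.{w} X.X₁ N i) (he : extDelta hX e = 0) : ∃ e', extPre X.f e' = e :=
  Abelian.Ext.contravariant_sequence_exact₁ hX N e rfl he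

theorem exists_extPre_of_extPre {X : ShortComplex C} (hX : X.ShortExact) {N : C} {i : ℕ}
    (e : Abelian.Ext.{w} X.X₂ N i) (he : extPre X.f e = 0) : ∃ e', extPre X.g e' = e :=
  Abelian.Ext.contravariant_sequence_exact₂ hX N e he

theorem exists_extDelta_of_extPre {X : ShortComplex C} (hX : X.ShortExact) {N : C} {i : ℕ}
    (e : Abelian.Ext.{w} X.X₃ N (1 + i)) (he : extPre X.g e = 0) : ∃ e', extDelta hX e' = e :=
  Abelian.Ext.contravariant_sequence_exact₃ hX N e he rfl

/-- The endomorphism `φ` annihilates `Ext^i(M, -)` for all `i > d`. -/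
def KillsEnd {M : C} (φ : M ⟶ M) (d : ℕ) : Prop :=
  ∀ (N : C) (i : ℕ), d < i → ∀ e : Abelian.Ext.{w} M N i, extPre φ e = 0

theorem killsEnd_of_factors {M P : C} [Projective P] (s : M ⟶ P) (p : P ⟶ M) (d : ℕ) :
    KillsEnd.{u, w} (s ≫ p) d := by
  intro N i hi e
  rw [← extPre_extPre]
  have : extPre p e = 0 := by
    obtain ⟨j, rfl⟩ := Nat.exists_eq_succ_of_ne_zero (by omega : i ≠ 0)
    exact Abelian.Ext.eq_zero_of_projective _
  rw [this, extPre_zero]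

/-- After φ a class on the middle term restricts to zero on the subobject, hence comes from the
quotient, where ψ kills it. Two endomorphisms are spent, so annihilators multiply along extensions.
-/
theorem KillsEnd.mid {X : ShortComplex C} (hX : X.ShortExact) (φ ψ : X ⟶ X) {d : ℕ}
    (h₁ : KillsEnd.{u, w} φ.τ₁ d) (h₃ : KillsEnd.{u, w} ψ.τ₃ d) :
    KillsEnd.{u, w} (ψ.τ₂ ≫ φ.τ₂) d := by
  intro N i hi e
  rw [← extPre_extPre]
  obtain ⟨e', he'⟩ := exists_extPre_of_extPre hX (extPre φ.τ₂ e) (by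
    rw [extPre_extPre, ← φ.comm₁₂, ← extPre_extPre, h₁ _ _ hi])
  rw [← he', extPre_extPre, ψ.comm₂₃, ← extPre_extPre, h₃ _ _ hi, extPre_zero]

/-- After ψ a class dies on the middle term and is therefore a connecting image from one degree
lower, where φ kills it. -/
theorem KillsEnd.right {X : ShortComplex C} (hX : X.ShortExact) (φ ψ : X ⟶ X) {d : ℕ}
    (h₁ : KillsEnd.{u, w} φ.τ₁ d) (h₂ : KillsEnd.{u, w} ψ.τ₂ (d + 1)) :
    KillsEnd.{u, w} (φ.τ₃ ≫ ψ.τ₃) (d + 1) := by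
  intro N i hi e
  obtain ⟨j, rfl⟩ : ∃ j, i = 1 + j := ⟨i - 1, by omega⟩
  rw [← extPre_extPre]
  obtain ⟨e', he'⟩ := exists_extDelta_of_extPre hX (extPre ψ.τ₃ e) (by
    rw [extPre_extPre, ← ψ.comm₂₃, ← extPre_extPre, h₂ _ _ hi])
  rw [← he', extPre_extDelta hX hX, h₁ _ _ (by omega)]
  exact map_zero (hX.extClass.precomp N rfl)

theorem KillsEnd.left {X : ShortComplex C} (hX : X.ShortExact) (φ : X ⟶ X) [Projective X.X₂]
    {d : ℕ} (h₃ : KillsEnd.{u, w} φ.τ₃ (d + 1)) : KillsEnd.{u, w} φ.τ₁ d := by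
  intro N i hi e
  obtain ⟨e', he'⟩ := exists_extPre_of_extDelta hX (extPre φ.τ₁ e) (by
    rw [← extPre_extDelta hX hX φ e, h₃ _ _ (by omega)])
  have := killsEnd_of_factors.{u, w} (𝟙 X.X₂) (𝟙 X.X₂) d N i hi e'
  rw [Category.comp_id, extPre_id] at this
  rw [← he', this, extPre_zero]

/-- The obstruction to lifting φ is the pullback of the extension class along φ, a class in Ext¹. -/
theorem KillsEnd.exists_lift {X : ShortComplex C} (hX : X.ShortExact) {φ : X.X₃ ⟶ X.X₃}
    (h : KillsEnd.{u, w} φ 0) : ∃ s : X.X₃ ⟶ X.X₂, s ≫ X.g = φ := by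
  obtain ⟨e, he⟩ := Abelian.Ext.covariant_sequence_exact₃ X.X₃ hX (Abelian.Ext.mk₀ φ)
    (zero_add 1) (h _ 1 zero_lt_one hX.extClass)
  obtain ⟨s, rfl⟩ := (Abelian.Ext.addEquiv₀ (X := X.X₃) (Y := X.X₂)).symm.surjective e
  refine ⟨s, (Abelian.Ext.addEquiv₀ (X := X.X₃) (Y := X.X₃)).symm.injective ?_⟩
  simpa using he

omit [HasExt.{w} C] in
theorem exists_endo {X : ShortComplex C} (hX : X.ShortExact) [Projective X.X₂]
    (φ : X.X₃ ⟶ X.X₃) : ∃ Φ : X ⟶ X, Φ.τ₃ = φ := by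
  have := hX.epi_g
  have := hX.mono_f
  let φ₂ := Projective.factorThru (X.g ≫ φ) X.g
  have h₂ : φ₂ ≫ X.g = X.g ≫ φ := Projective.factorThru_comp _ _
  let φ₁ := hX.exact.lift (X.f ≫ φ₂) (by
    rw [Category.assoc, h₂, X.zero_assoc, Limits.zero_comp])
  exact ⟨{ τ₁ := φ₁, τ₂ := φ₂, τ₃ := φ, comm₁₂ := hX.exact.lift_f _ _, comm₂₃ := h₂ }, rfl⟩

end Kills

/-! ### Projective dimension up to central torsion. -/

noncomputable section GenericDimension

variable {R S : Type u} [Ring R] [Ring S]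

/-- For d = 0 the endomorphism factors through a projective, and base change keeps such a
factorization. Otherwise it is lifted to a projective presentation, whose exactness survives by
flatness, and the degree is shifted down with `KillsEnd.left` and up again with `KillsEnd.right`. -/
theorem KillsEnd.baseChange {f : R →+* S} (hf : IsFlat f) {M : ModuleCat.{u} R} {φ : M ⟶ M}
    {d : ℕ} (h : KillsEnd.{u + 1, u} φ d) : KillsEnd.{u + 1, u} (bcMap f φ) d := by
  induction d generalizing M with
  | zero =>
    obtain ⟨s, hs⟩ := h.exists_lift M.shortExact_projectiveShortComplex
    have hs' : s ≫ M.projectiveShortComplex.g = φ := hs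
    rw [← hs', bcMap_comp]
    exact killsEnd_of_factors _ _ 0
  | succ d ih =>
    have hX := M.shortExact_projectiveShortComplex
    obtain ⟨Φ, hΦ⟩ := exists_endo hX (φ : M.projectiveShortComplex.X₃ ⟶ _)
    have h₁ := ih (KillsEnd.left hX Φ (hΦ ▸ h))
    let Φ' : bcShortComplex f M.projectiveShortComplex ⟶ bcShortComplex f M.projectiveShortComplex :=
      { τ₁ := bcMap f Φ.τ₁
        τ₂ := bcMap f Φ.τ₂
        τ₃ := bcMap f Φ.τ₃
        comm₁₂ := by
          change bcMap f _ ≫ bcMap f _ = bcMap f _ ≫ bcMap f _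
          rw [← bcMap_comp, ← bcMap_comp, Φ.comm₁₂]
        comm₂₃ := by
          change bcMap f _ ≫ bcMap f _ = bcMap f _ ≫ bcMap f _
          rw [← bcMap_comp, ← bcMap_comp, Φ.comm₂₃] }
    have h₂ := KillsEnd.right (hf.shortExact hX) Φ' (𝟙 _) h₁ (by
      have := killsEnd_of_factors (𝟙 (CompletedWeyl.baseChange f M.projectiveShortComplex.X₂))
        (𝟙 _) (d + 1)
      rw [Category.comp_id] at this
      exact this)
    have h₃ : Φ'.τ₃ ≫ ShortComplex.Hom.τ₃ (𝟙 (bcShortComplex f M.projectiveShortComplex)) =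
        bcMap f φ := by
      rw [ShortComplex.id_τ₃, Category.comp_id, ← hΦ]
    rw [← h₃]
    exact h₂

/-- Multiplication by a central element. -/
def cMul (c : R) (hc : ∀ r, Commute c r) (M : ModuleCat.{u} R) : M ⟶ M :=
  ModuleCat.ofHom
    { toFun := fun m => c • m
      map_add' := smul_add c
      map_smul' := fun r m => by
        rw [RingHom.id_apply, smul_smul, smul_smul, (hc r).eq] }

@[simp]
theorem cMul_apply (c : R) (hc : ∀ r, Commute c r) (M : ModuleCat.{u} R) (m : M) :
    (cMul c hc M).hom m = c • m := rfl

theorem cMul_comp {c : R} (hc : ∀ r, Commute c r) {M N : ModuleCat.{u} R} (g : M ⟶ N) :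
    cMul c hc M ≫ g = g ≫ cMul c hc N :=
  ModuleCat.hom_ext (LinearMap.ext fun m => g.hom.map_smul c m)

theorem cMul_mul {c c' : R} (hc : ∀ r, Commute c r) (hc' : ∀ r, Commute c' r)
    (M : ModuleCat.{u} R) :
    cMul (c * c') (fun r => (hc r).mul_left (hc' r)) M = cMul c' hc' M ≫ cMul c hc M :=
  ModuleCat.hom_ext (LinearMap.ext fun m => mul_smul c c' m)

/-- Multiplication by a central element on a short complex. -/
def cMulShort (c : R) (hc : ∀ r, Commute c r) (X : ShortComplex (ModuleCat.{u} R)) : X ⟶ X where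
  τ₁ := cMul c hc _
  τ₂ := cMul c hc _
  τ₃ := cMul c hc _
  comm₁₂ := cMul_comp hc _
  comm₂₃ := cMul_comp hc _

theorem bcMap_cMul (f : R →+* S) {c : R} (hc : ∀ r, Commute c r) (hfc : ∀ s, Commute (f c) s)
    (M : ModuleCat.{u} R) : bcMap f (cMul c hc M) = cMul (f c) hfc _ :=
  bc_hom_ext f fun m => by
    rw [bcMap_tmul, cMul_apply, cMul_apply, bcTmul_smul, smul_bcTmul, one_mul, mul_one]

/-- Up to torsion by the central elements in `Z`, finitely generated `R`-modules have projective
dimension at most `d`. -/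
def GenDim (R : Type u) [Ring R] (Z : Set R) (d : ℕ) : Prop :=
  ∀ M : ModuleCat.{u} R, Module.Finite R M →
    ∃ c ∈ Z, ∃ hc : ∀ r, Commute c r, KillsEnd.{u + 1, u} (cMul c hc M) d

/-- Over a commutative ring a cyclic module is either killed by a nonzero element or free. Induction
on the number of generators multiplies the annihilators of the successive quotients. -/
theorem genDim_zero_of_domain {Z : Set R} (hZ : ∀ r, r ≠ 0 → r ∈ Z)
    (hmul : ∀ c ∈ Z, ∀ c' ∈ Z, c * c' ∈ Z) (h1 : (1 : R) ∈ Z)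
    (hcomm : ∀ r s : R, Commute r s) : GenDim R Z 0 := by
  have key : ∀ k : ℕ, ∀ M : ModuleCat.{u} R, ∀ v : Fin k → M,
      Submodule.span R (Set.range v) = ⊤ → ∃ c ∈ Z, KillsEnd.{u + 1, u} (cMul c (hcomm c) M) 0 := by
    intro k
    induction k with
    | zero =>
      intro M v hv
      refine ⟨1, h1, ?_⟩
      have hM : ∀ m : M, m = 0 := fun m => by
        have : m ∈ Submodule.span R (Set.range v) := hv ▸ Submodule.mem_top
        simpa using this
      have : cMul 1 (hcomm 1) M = 0 := ModuleCat.hom_ext (LinearMap.ext fun m => hM _)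
      rw [this]
      intro N i _ e
      exact zero_extPre e
    | succ k ih =>
      intro M v hv
      let N : Submodule R M := Submodule.span R (Set.range fun i : Fin k => v i.castSucc)
      let X : ShortComplex (ModuleCat.{u} R) := ShortComplex.mk
        (ModuleCat.ofHom N.subtype : ModuleCat.of R N ⟶ M)
        (ModuleCat.ofHom N.mkQ : M ⟶ ModuleCat.of R (M ⧸ N)) (by
          ext x
          exact (Submodule.Quotient.mk_eq_zero N).mpr x.2)
      have hX : X.ShortExact := shortExact_of_exact N.injective_subtype
        (LinearMap.exact_subtype_mkQ N) N.mkQ_surjective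
      obtain ⟨c, hc, hcN⟩ := ih (ModuleCat.of R N)
        (fun i => ⟨v i.castSucc, Submodule.subset_span ⟨i, rfl⟩⟩) (by
          have := Submodule.span_span_coe_preimage (R := R) (s := Set.range fun i : Fin k => v i.castSucc)
          convert! this using 2
          ext x
          constructor
          · rintro ⟨i, rfl⟩
            exact ⟨i, rfl⟩
          · rintro ⟨i, hi⟩
            exact ⟨i, Subtype.ext hi⟩)
      have hcyc : ∃ c ∈ Z, KillsEnd.{u + 1, u} (cMul c (hcomm c) (ModuleCat.of R (M ⧸ N))) 0 := by
        let w : M ⧸ N := N.mkQ (v (Fin.last k))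
        have hw : ∀ x : M ⧸ N, ∃ r : R, r • w = x := by
          intro x
          obtain ⟨m, rfl⟩ := N.mkQ_surjective x
          have hm : m ∈ Submodule.span R (Set.range v) := hv ▸ Submodule.mem_top
          induction hm using Submodule.span_induction with
          | mem x hx =>
            obtain ⟨i, rfl⟩ := hx
            refine Fin.lastCases ?_ (fun i => ?_) i
            · exact ⟨1, one_smul _ _⟩
            · refine ⟨0, ?_⟩
              rw [zero_smul]
              exact ((Submodule.Quotient.mk_eq_zero N).mpr (Submodule.subset_span ⟨i, rfl⟩)).symm
          | zero => exact ⟨0, by rw [zero_smul, map_zero]⟩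
          | add x y _ _ hx hy =>
            obtain ⟨a, ha⟩ := hx
            obtain ⟨b, hb⟩ := hy
            exact ⟨a + b, by rw [add_smul, ha, hb, map_add]⟩
          | smul a x _ hx =>
            obtain ⟨b, hb⟩ := hx
            exact ⟨a * b, by rw [mul_smul, hb, map_smul]⟩
        by_cases h0 : ∃ c : R, c ≠ 0 ∧ c • w = 0
        · obtain ⟨c, hc0, hcw⟩ := h0
          refine ⟨c, hZ c hc0, ?_⟩
          have : cMul c (hcomm c) (ModuleCat.of R (M ⧸ N)) = 0 :=
            ModuleCat.hom_ext (LinearMap.ext fun x => by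
              obtain ⟨r, rfl⟩ := hw x
              change c • r • w = 0
              rw [smul_smul, (hcomm c r).eq, mul_smul, hcw, smul_zero])
          rw [this]
          intro _ _ _ e
          exact zero_extPre e
        · push Not at h0
          refine ⟨1, h1, ?_⟩
          let e : R ≃ₗ[R] (M ⧸ N) := LinearEquiv.ofBijective (LinearMap.toSpanSingleton R _ w)
            ⟨(injective_iff_map_eq_zero _).mpr fun r hr => by
              by_contra hne
              exact h0 r hne hr, hw⟩
          have : Module.Projective R (M ⧸ N) := Module.Projective.of_equiv e
          have hp : Projective (ModuleCat.of R (M ⧸ N)) :=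
            (IsProjective.iff_projective (R := R) (M ⧸ N)).mp this
          have h2 := killsEnd_of_factors (𝟙 (ModuleCat.of R (M ⧸ N)))
            (cMul 1 (hcomm 1) (ModuleCat.of R (M ⧸ N))) 0
          rwa [Category.id_comp] at h2
      obtain ⟨c', hc', hcQ⟩ := hcyc
      refine ⟨c * c', hmul _ hc _ hc', ?_⟩
      rw [cMul_mul (hcomm c) (hcomm c')]
      exact KillsEnd.mid hX (cMulShort c (hcomm c) X) (cMulShort c' (hcomm c') X) hcN hcQ
  intro M hM
  obtain ⟨k, v, hv⟩ := Module.Finite.exists_fin (R := R) (M := M)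
  obtain ⟨c, hc, h⟩ := key k M v hv
  exact ⟨c, hc, hcomm c, h⟩

end GenericDimension

/-! ## Presentations of modules over Ore extensions by induced modules -/

noncomputable section OreModules

variable {R S : Type u} [Ring R] [Ring S] {ι : R →+* S} {θ : S}

/-- The coefficient maps of an Ore extension. -/
def IsOre.coeff (h : IsOre ι θ) (j : ℕ) : S →+ R :=
  (Finsupp.applyAddHom j).comp (AddEquiv.ofBijective
    (AddMonoidHom.mk' (fun p : ℕ →₀ R => p.sum fun i r => θ ^ i * ι r) (fun p q =>
      Finsupp.sum_add_index' (by simp) (by simp [mul_add]))) h.bij).symm.toAddMonoidHom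

theorem IsOre.coeff_pow_mul (h : IsOre ι θ) (i j : ℕ) (r : R) :
    h.coeff j (θ ^ i * ι r) = if i = j then r else 0 := by
  have : θ ^ i * ι r = (Finsupp.single i r).sum fun i r => θ ^ i * ι r := by simp
  rw [this]
  have h2 : (AddEquiv.ofBijective (AddMonoidHom.mk' (fun p : ℕ →₀ R => p.sum fun i r => θ ^ i * ι r)
      (fun p q => Finsupp.sum_add_index' (by simp) (by simp [mul_add]))) h.bij).symm
      ((Finsupp.single i r).sum fun i r => θ ^ i * ι r) = Finsupp.single i r :=
    (AddEquiv.symm_apply_eq _).mpr rfl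
  change (Finsupp.applyAddHom j) ((AddEquiv.ofBijective _ h.bij).symm _) = _
  rw [h2]
  simp [Finsupp.single_apply]

theorem IsOre.exists_eq_sum (h : IsOre ι θ) (s : S) :
    ∃ (k : ℕ) (r : ℕ → R), s = ∑ j ∈ Finset.range k, θ ^ j * ι (r j) :=
  (h.exists_mem_oreFilt s).imp fun _ hk => hk

theorem IsOre.coeff_mul (h : IsOre ι θ) (j : ℕ) (s : S) (r : R) :
    h.coeff j (s * ι r) = h.coeff j s * r := by
  obtain ⟨k, t, rfl⟩ := h.exists_eq_sum s
  rw [Finset.sum_mul, map_sum, map_sum, Finset.sum_mul]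
  refine Finset.sum_congr rfl fun i _ => ?_
  rw [mul_assoc, ← map_mul, h.coeff_pow_mul, h.coeff_pow_mul]
  split_ifs <;> simp

variable (N : ModuleCat.{u} R)

/-- The coefficient maps of an induced module along an Ore extension. -/
def IsOre.bcCoeff (h : IsOre ι θ) (j : ℕ) : baseChange ι N →+ N :=
  bcLiftAdd ι (AddMonoidHom.mk' (fun s => AddMonoidHom.mk' (fun n => h.coeff j s • n)
    (fun n n' => smul_add _ n n')) (fun s s' => AddMonoidHom.ext fun n => by
      change h.coeff j (s + s') • n = h.coeff j s • n + h.coeff j s' • n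
      rw [map_add, add_smul]))
    (fun s r n => by
      change h.coeff j (s * ι r) • n = h.coeff j s • r • n
      rw [h.coeff_mul, mul_smul])

theorem IsOre.bcCoeff_tmul (h : IsOre ι θ) (i j : ℕ) (n : N) :
    h.bcCoeff N j (bcTmul ι N (θ ^ i) n) = if i = j then n else 0 := by
  refine (bcLiftAdd_tmul ι _ _ _ _).trans ?_
  change h.coeff j (θ ^ i) • n = _
  have := h.coeff_pow_mul i j 1
  rw [map_one, mul_one] at this
  rw [this]
  split_ifs <;> simp

/-- The elements of degree less than `k` of an induced module. -/
def bcSum (θ : S) (k : ℕ) (n : ℕ → N) : baseChange ι N :=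
  ∑ j ∈ Finset.range k, bcTmul ι N (θ ^ j) (n j)

theorem IsOre.exists_eq_bcSum (h : IsOre ι θ) (z : baseChange ι N) :
    ∃ (k : ℕ) (n : ℕ → N), z = bcSum N θ k n := by
  refine bc_induction ι z ⟨0, 0, rfl⟩ (fun s n => ?_) ?_
  · obtain ⟨k, r, rfl⟩ := h.exists_eq_sum s
    refine ⟨k, fun j => r j • n, ?_⟩
    rw [map_sum, AddMonoidHom.finsetSum_apply]
    exact Finset.sum_congr rfl fun j _ => (bcTmul_smul ι _ _ _).symm
  · rintro _ _ ⟨k, n, rfl⟩ ⟨l, n', rfl⟩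
    have key : ∀ k l : ℕ, ∀ n : ℕ → N, k ≤ l →
        bcSum (ι := ι) N θ k n = bcSum N θ l (fun j => if j < k then n j else 0) := by
      intro k l n hkl
      unfold bcSum
      rw [← Finset.sum_subset (Finset.range_mono hkl)]
      · exact Finset.sum_congr rfl fun j hj => by
          dsimp only
          rw [if_pos (Finset.mem_range.mp hj)]
      · intro j _ hj
        dsimp only
        rw [if_neg (fun h => hj (Finset.mem_range.mpr h)), map_zero]
    refine ⟨max k l, fun j => (if j < k then n j else 0) + (if j < l then n' j else 0), ?_⟩
    rw [key k _ n (le_max_left k l), key l _ n' (le_max_right k l)]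
    unfold bcSum
    rw [← Finset.sum_add_distrib]
    exact Finset.sum_congr rfl fun j _ => (map_add _ _ _).symm

theorem IsOre.bcSum_eq_zero (h : IsOre ι θ) {k : ℕ} {n : ℕ → N}
    (h0 : bcSum (ι := ι) N θ k n = 0) {j : ℕ} (hj : j < k) : n j = 0 := by
  have h1 := congrArg (h.bcCoeff N j) h0
  rw [map_zero, bcSum, map_sum, Finset.sum_eq_single j] at h1
  · rwa [h.bcCoeff_tmul, if_pos rfl] at h1
  · intro i _ hij
    rw [h.bcCoeff_tmul, if_neg hij]
  · intro hn
    exact absurd (Finset.mem_range.mpr hj) hn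

variable {N}

/-- A module over an Ore extension `S = R[θ]` presented by induced modules: `P ⊆ Q` are
`R`-submodules with `θ P ⊆ Q`. -/
structure OrePresentation (ι : R →+* S) (θ : S) (M : ModuleCat.{u} S) where
  /-- The smaller `R`-module. -/
  P : ModuleCat.{u} R
  /-- The larger `R`-module. -/
  Q : ModuleCat.{u} R
  /-- The inclusion. -/
  i : P ⟶ Q
  /-- The inclusion into `M`. -/
  inc : Q →+ M
  /-- Multiplication by `θ`. -/
  t : P →+ Q
  hinc : Function.Injective inc
  inc_smul : ∀ (r : R) (m : Q), inc (r • m) = ι r • inc m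
  inc_t : ∀ m, inc (t m) = θ • inc (i.hom m)
  finP : Module.Finite R P
  finQ : Module.Finite R Q

namespace OrePresentation

variable {M : ModuleCat.{u} S} (D : OrePresentation ι θ M)

theorem t_smul {r r' : R} (hr : θ * ι r = ι r * θ + ι r') (m : D.P) :
    D.t (r • m) = r • D.t m + r' • D.i.hom m := by
  apply D.hinc
  rw [D.inc_t, map_add, D.inc_smul, D.inc_smul, map_smul, D.inc_smul, smul_smul, hr, D.inc_t,
    add_smul, mul_smul]

/-- The map `s ⊗ m ↦ sθ ⊗ m - s ⊗ θm`. -/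
def α (hcomm : ∀ r, ∃ r', θ * ι r = ι r * θ + ι r') : baseChange ι D.P ⟶ baseChange ι D.Q :=
  bcLift ι ((bcTmul ι D.Q θ).comp D.i.hom.toAddMonoidHom - (bcTmul ι D.Q 1).comp D.t)
    (fun r m => by
      obtain ⟨r', hr'⟩ := hcomm r
      change bcTmul ι D.Q θ (D.i.hom (r • m)) - bcTmul ι D.Q 1 (D.t (r • m)) =
        ι r • (bcTmul ι D.Q θ (D.i.hom m) - bcTmul ι D.Q 1 (D.t m))
      rw [D.t_smul hr', map_add, map_smul, bcTmul_smul, bcTmul_smul, bcTmul_smul, smul_sub,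
        smul_bcTmul, smul_bcTmul, hr', map_add (bcTmul ι D.Q)]
      simp)

variable (hcomm : ∀ r, ∃ r', θ * ι r = ι r * θ + ι r')

theorem α_tmul (s : S) (m : D.P) : (D.α hcomm).hom (bcTmul ι D.P s m) =
    bcTmul ι D.Q (s * θ) (D.i.hom m) - bcTmul ι D.Q s (D.t m) := by
  rw [α, bcLift_tmul]
  change s • (bcTmul ι D.Q θ (D.i.hom m) - bcTmul ι D.Q 1 (D.t m)) = _
  rw [smul_sub, smul_bcTmul, smul_bcTmul, mul_one]

/-- Multiplication by f on the module factor commutes with α up to multiplication by the derivative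
f'. This error term is what allows an annihilator to be replaced by its derivative in
`GenDim.ore_of_derivation`. -/
theorem α_cMul {f f' : R} (hf : ∀ r, Commute f r) (hf' : ∀ r, Commute f' r)
    (hff' : θ * ι f = ι f * θ + ι f') :
    D.α hcomm ≫ bcMap ι (cMul f hf D.Q) =
      bcMap ι (cMul f hf D.P) ≫ D.α hcomm + bcMap ι (cMul f' hf' D.P) ≫ bcMap ι D.i :=
  bc_hom_ext ι fun m => by
    simp only [ModuleCat.hom_comp, ModuleCat.hom_add, LinearMap.comp_apply, LinearMap.add_apply,
      α_tmul, map_sub, bcMap_tmul, cMul_apply, D.t_smul hff', map_add, map_smul]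
    abel

/-- The map `s ⊗ m ↦ s m`. -/
def π : baseChange ι D.Q ⟶ M := bcLift ι D.inc D.inc_smul

theorem π_tmul (s : S) (m : D.Q) : D.π.hom (bcTmul ι D.Q s m) = s • D.inc m := bcLift_tmul ι _ _ _ _

theorem α_π : D.α hcomm ≫ D.π = 0 :=
  bc_hom_ext ι fun m => by
    rw [ModuleCat.hom_comp, LinearMap.comp_apply, α_tmul, map_sub, π_tmul, π_tmul, D.inc_t]
    simp

/-- The image of an element of degree k has the same leading coefficient, moved to degree k + 1. -/
theorem α_injective (h : IsOre ι θ) (hi : Function.Injective D.i.hom) :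
    Function.Injective (D.α h.comm).hom := by
  rw [injective_iff_map_eq_zero]
  have key : ∀ k, ∀ n : ℕ → D.P, (D.α h.comm).hom (bcSum D.P θ k n) = 0 →
      bcSum (ι := ι) D.P θ k n = 0 := by
    intro k
    induction k with
    | zero => exact fun n _ => rfl
    | succ k ih =>
      intro n hn
      have hz : (D.α h.comm).hom (bcSum D.P θ (k + 1) n) = bcSum D.Q θ (k + 2)
          (fun j => (if j = 0 then 0 else D.i.hom (n (j - 1))) -
            (if j < k + 1 then D.t (n j) else 0)) := by
        unfold bcSum
        simp only [map_sub (bcTmul ι D.Q _), Finset.sum_sub_distrib]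
        rw [map_sum]
        simp only [α_tmul, Finset.sum_sub_distrib]
        congr 1
        · rw [Finset.sum_range_succ' _ (k + 1)]
          simp [pow_succ]
        · rw [Finset.sum_range_succ _ (k + 1)]
          simp only [lt_irrefl, if_false, map_zero, add_zero]
          exact Finset.sum_congr rfl fun j hj => by rw [if_pos (Finset.mem_range.mp hj)]
      have h0 := h.bcSum_eq_zero D.Q (hz.symm.trans hn) (j := k + 1) (by omega)
      simp only [Nat.add_eq_zero_iff, one_ne_zero, and_false, if_false, Nat.add_sub_cancel,
        lt_irrefl, sub_zero] at h0
      have hnk : n k = 0 := hi (h0.trans (map_zero _).symm)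
      have hs : bcSum (ι := ι) D.P θ (k + 1) n = bcSum D.P θ k n := by
        unfold bcSum
        rw [Finset.sum_range_succ, hnk, map_zero, add_zero]
      rw [hs] at hn ⊢
      exact ih n hn
  intro z hz
  obtain ⟨k, n, rfl⟩ := h.exists_eq_bcSum D.P z
  exact key k n hz

/-- By `hex` the leading coefficient of an element of the kernel lies in P, so the leading term is
cancelled by an element of the image of α and the degree drops. -/
theorem exact_α_π (h : IsOre ι θ)
    (hex : ∀ (k : ℕ) (n : ℕ → D.Q), ∑ j ∈ Finset.range (k + 2), θ ^ j • D.inc (n j) = 0 →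
      ∃ m, D.i.hom m = n (k + 1)) :
    Function.Exact (D.α h.comm).hom D.π.hom := by
  intro z
  constructor
  · have key : ∀ k, ∀ n : ℕ → D.Q, D.π.hom (bcSum D.Q θ k n) = 0 →
        ∃ y, (D.α h.comm).hom y = bcSum D.Q θ k n := by
      intro k
      induction k with
      | zero => exact fun n _ => ⟨0, map_zero _⟩
      | succ k ih =>
        intro n hn
        have hπ : ∑ j ∈ Finset.range (k + 1), θ ^ j • D.inc (n j) = 0 := by
          rw [← hn, bcSum, map_sum]
          exact Finset.sum_congr rfl fun j _ => (D.π_tmul _ _).symm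
        rcases k with - | k
        · rw [Finset.sum_range_one, pow_zero, one_smul] at hπ
          have : n 0 = 0 := D.hinc (hπ.trans (map_zero _).symm)
          refine ⟨0, ?_⟩
          rw [map_zero, bcSum, Finset.sum_range_one, this, map_zero]
        · obtain ⟨m, hm⟩ := hex k n hπ
          -- The relation θ^(k+1) ⊗ m ≡ θ^k ⊗ θm modulo α moves the leading term into degree k.
          let n' : ℕ → D.Q := Function.update n k (n k + D.t m)
          have hn' : bcSum (ι := ι) D.Q θ (k + 1 + 1) n =
              bcSum D.Q θ (k + 1) n' + (D.α h.comm).hom (bcTmul ι D.P (θ ^ k) m) := by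
            unfold bcSum
            rw [α_tmul, Finset.sum_range_succ, Finset.sum_range_succ, Finset.sum_range_succ, hm,
              ← pow_succ]
            have : ∑ j ∈ Finset.range k, bcTmul ι D.Q (θ ^ j) (n' j) =
                ∑ j ∈ Finset.range k, bcTmul ι D.Q (θ ^ j) (n j) :=
              Finset.sum_congr rfl fun j hj => by
                rw [show n' j = n j from
                  Function.update_of_ne (Finset.mem_range.mp hj).ne _ _]
            rw [this, show n' k = n k + D.t m from Function.update_self _ _ _, map_add]
            abel
          obtain ⟨y, hy⟩ := ih n' (by
            have h1 := hn
            rw [hn', map_add] at h1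
            have h2 : D.π.hom ((D.α h.comm).hom (bcTmul ι D.P (θ ^ k) m)) = 0 := by
              rw [α_tmul, map_sub, π_tmul, π_tmul, D.inc_t, mul_smul, sub_self]
            rwa [h2, add_zero] at h1)
          exact ⟨y + bcTmul ι D.P (θ ^ k) m, by rw [map_add, hy, hn']⟩
    intro hz
    obtain ⟨k, n, rfl⟩ := h.exists_eq_bcSum D.Q z
    exact key k n hz
  · rintro ⟨y, rfl⟩
    exact LinearMap.congr_fun (congrArg ModuleCat.Hom.hom (D.α_π h.comm)) y

/-- The presentation as a short complex. -/
def shortComplex : ShortComplex (ModuleCat.{u} S) := ShortComplex.mk (D.α hcomm) D.π (D.α_π hcomm)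

end OrePresentation

/-! ### Filtrations of finitely generated modules over an Ore extension. -/

section Existence

variable (ι θ) (M : ModuleCat.{u} S) (G : Set M)

/-- The `R`-module underlying an `S`-module. -/
abbrev resMod : ModuleCat.{u} R := (ModuleCat.restrictScalars ι).obj M

/-- The filtration of a module over an Ore extension defined by a set of generators. -/
def oreModFilt (k : ℕ) : Submodule R (resMod ι M) :=
  Submodule.span R {m | ∃ j ≤ k, ∃ g ∈ G, m = (θ ^ j • g : M)}

theorem oreModFilt_mono : Monotone (oreModFilt ι θ M G) := fun _ _ h =>
  Submodule.span_mono fun _ ⟨j, hj, g, hg, hm⟩ => ⟨j, hj.trans h, g, hg, hm⟩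

variable {ι θ M G}

theorem theta_smul_mem (hcomm : ∀ r, ∃ r', θ * ι r = ι r * θ + ι r') {k : ℕ} {m : M}
    (hm : (show resMod ι M from m) ∈ oreModFilt ι θ M G k) :
    (show resMod ι M from θ • m) ∈ oreModFilt ι θ M G (k + 1) := by
  refine Submodule.span_induction (p := fun (m : resMod ι M) _ =>
    (show resMod ι M from θ • (show M from m)) ∈ oreModFilt ι θ M G (k + 1)) ?_ ?_ ?_ ?_ hm
  · rintro _ ⟨j, hj, g, hg, rfl⟩
    refine Submodule.subset_span ⟨j + 1, by omega, g, hg, ?_⟩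
    rw [pow_succ', mul_smul]
  · change (show resMod ι M from θ • (0 : M)) ∈ _
    rw [smul_zero]
    exact zero_mem _
  · intro x y _ _ hx hy
    change (show resMod ι M from θ • ((show M from x) + (show M from y))) ∈ _
    rw [smul_add]
    exact add_mem hx hy
  · intro r x hx hx'
    obtain ⟨r', hr'⟩ := hcomm r
    change (show resMod ι M from θ • ι r • (show M from x)) ∈ _
    rw [smul_smul, hr', add_smul, mul_smul]
    exact add_mem (Submodule.smul_mem _ r hx')
      (Submodule.smul_mem _ r' (oreModFilt_mono ι θ M G (Nat.le_succ k) hx))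

theorem theta_pow_smul_mem (hcomm : ∀ r, ∃ r', θ * ι r = ι r * θ + ι r') {k : ℕ} {m : M}
    (hm : (show resMod ι M from m) ∈ oreModFilt ι θ M G k) (j : ℕ) :
    (show resMod ι M from θ ^ j • m) ∈ oreModFilt ι θ M G (k + j) := by
  induction j with
  | zero => simpa using hm
  | succ j ih =>
    rw [pow_succ', mul_smul]
    exact theta_smul_mem hcomm ih

theorem oreFilt_smul_mem (hcomm : ∀ r, ∃ r', θ * ι r = ι r * θ + ι r') {k l : ℕ} {m : M}
    (hm : (show resMod ι M from m) ∈ oreModFilt ι θ M G k) {s : S} (hs : s ∈ oreFilt ι θ (l + 1)) :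
    (show resMod ι M from s • m) ∈ oreModFilt ι θ M G (k + l) := by
  obtain ⟨r, rfl⟩ := hs
  rw [Finset.sum_smul]
  refine Submodule.sum_mem (oreModFilt ι θ M G (k + l)) fun j hj => ?_
  rw [mul_smul]
  exact oreModFilt_mono ι θ M G (by have := Finset.mem_range.mp hj; omega)
    (theta_pow_smul_mem hcomm (m := ι (r j) • m) (Submodule.smul_mem _ (r j) hm) j)

/-- Each graded piece is generated by θ^(k+1) applied to degree zero; commuting coefficients past
the power costs only lower terms. -/
theorem exists_leading (hcomm : ∀ r, ∃ r', θ * ι r = ι r * θ + ι r') {k : ℕ} {m : M}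
    (hm : (show resMod ι M from m) ∈ oreModFilt ι θ M G (k + 1)) :
    ∃ m₀ : M, (show resMod ι M from m₀) ∈ oreModFilt ι θ M G 0 ∧
      (show resMod ι M from m - θ ^ (k + 1) • m₀) ∈ oreModFilt ι θ M G k := by
  refine Submodule.span_induction (p := fun (m : resMod ι M) _ =>
    ∃ m₀ : M, (show resMod ι M from m₀) ∈ oreModFilt ι θ M G 0 ∧
      (show resMod ι M from (show M from m) - θ ^ (k + 1) • m₀) ∈ oreModFilt ι θ M G k)
    ?_ ?_ ?_ ?_ hm
  · rintro _ ⟨j, hj, g, hg, rfl⟩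
    rcases Nat.lt_or_ge j (k + 1) with h | h
    · refine ⟨0, zero_mem _, ?_⟩
      rw [smul_zero, sub_zero]
      exact Submodule.subset_span ⟨j, by omega, g, hg, rfl⟩
    · obtain rfl : j = k + 1 := by omega
      refine ⟨g, Submodule.subset_span ⟨0, le_rfl, g, hg, by rw [pow_zero, one_smul]⟩, ?_⟩
      rw [sub_self]
      exact zero_mem _
  · refine ⟨0, zero_mem _, ?_⟩
    rw [smul_zero, sub_zero]
    exact zero_mem _
  · rintro x y _ _ ⟨m₁, h₁, h₁'⟩ ⟨m₂, h₂, h₂'⟩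
    refine ⟨m₁ + m₂, add_mem h₁ h₂, ?_⟩
    have : (show M from x) + (show M from y) - θ ^ (k + 1) • (m₁ + m₂) =
        ((show M from x) - θ ^ (k + 1) • m₁) + ((show M from y) - θ ^ (k + 1) • m₂) := by
      rw [smul_add]
      abel
    change (show M from x) + (show M from y) - θ ^ (k + 1) • (m₁ + m₂) ∈ oreModFilt ι θ M G k
    rw [this]
    exact add_mem h₁' h₂'
  · rintro r x _ ⟨m₁, h₁, h₁'⟩
    refine ⟨ι r • m₁, Submodule.smul_mem _ r h₁, ?_⟩
    have : ι r • (show M from x) - θ ^ (k + 1) • ι r • m₁ =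
        ι r • ((show M from x) - θ ^ (k + 1) • m₁) +
          (ι r * θ ^ (k + 1) - θ ^ (k + 1) * ι r) • m₁ := by
      rw [smul_sub, sub_smul, mul_smul, mul_smul]
      abel
    change ι r • (show M from x) - θ ^ (k + 1) • ι r • m₁ ∈ oreModFilt ι θ M G k
    rw [this]
    refine add_mem (Submodule.smul_mem _ r h₁') ?_
    have := oreFilt_smul_mem hcomm h₁ (mul_pow_sub_mem_oreFilt hcomm (k + 1) r)
    rwa [zero_add] at this

theorem fg_oreModFilt (hG : G.Finite) (k : ℕ) : (oreModFilt ι θ M G k).FG := by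
  refine Submodule.fg_span ?_
  have : {m : M | ∃ j ≤ k, ∃ g ∈ G, m = θ ^ j • g} =
      ⋃ j ∈ Set.Iic k, (fun g => θ ^ j • g) '' G := by
    ext m
    simp only [Set.mem_ofPred_eq, Set.mem_iUnion, Set.mem_Iic, Set.mem_image, exists_prop]
    exact ⟨fun ⟨j, hj, g, hg, h⟩ => ⟨j, hj, g, hg, h.symm⟩,
      fun ⟨j, hj, g, hg, h⟩ => ⟨j, hj, g, hg, h.symm⟩⟩
  exact this ▸ (Set.finite_Iic k).biUnion fun j _ => hG.image _

/-- All graded pieces are quotients of the degree-zero part through powers of θ, and the kernels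
increase. By Noetherianity they become stationary, after which θ is injective on the graded pieces.
-/
theorem exists_gr_injective [IsNoetherianRing R] (hcomm : ∀ r, ∃ r', θ * ι r = ι r * θ + ι r')
    (hG : G.Finite) : ∃ i, ∀ (N : ℕ) (m : M),
      (show resMod ι M from m) ∈ oreModFilt ι θ M G (i + 1) →
      (show resMod ι M from θ ^ N • m) ∈ oreModFilt ι θ M G (i + N) →
      (show resMod ι M from m) ∈ oreModFilt ι θ M G i := by
  let M₀ := oreModFilt ι θ M G 0
  have : Module.Finite R M₀ := Module.Finite.iff_fg.mpr (fg_oreModFilt hG 0)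
  have hN : IsNoetherian R M₀ := inferInstance
  -- The kernel of θ^(i+1) from degree zero to the graded piece of degree i + 1.
  let Kf : ℕ → Submodule R M₀ := fun i =>
    { carrier := {m | (show resMod ι M from θ ^ (i + 1) • (show M from m.1)) ∈ oreModFilt ι θ M G i}
      zero_mem' := by
        change (show resMod ι M from θ ^ (i + 1) • (0 : M)) ∈ oreModFilt ι θ M G i
        rw [smul_zero]
        exact zero_mem _
      add_mem' := by
        intro x y hx hy
        change (show resMod ι M from θ ^ (i + 1) • ((show M from x.1) + (show M from y.1))) ∈
          oreModFilt ι θ M G i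
        rw [smul_add]
        exact add_mem hx hy
      smul_mem' := by
        intro r x hx
        change (show resMod ι M from θ ^ (i + 1) • ι r • (show M from x.1)) ∈ oreModFilt ι θ M G i
        have : θ ^ (i + 1) • ι r • (show M from x.1) =
            ι r • θ ^ (i + 1) • (show M from x.1) -
              (ι r * θ ^ (i + 1) - θ ^ (i + 1) * ι r) • (show M from x.1) := by
          rw [sub_smul, mul_smul, mul_smul]
          abel
        rw [this]
        have h2 := oreFilt_smul_mem hcomm (m := (show M from x.1)) x.2
          (mul_pow_sub_mem_oreFilt hcomm (i + 1) r)
        rw [zero_add] at h2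
        exact sub_mem (Submodule.smul_mem (oreModFilt ι θ M G i) r hx) h2 }
  obtain ⟨i, hi⟩ := monotone_stabilizes_iff_noetherian.mpr hN
    ⟨Kf, monotone_nat_of_le_succ fun i x hx => by
      change (show resMod ι M from θ ^ (i + 1 + 1) • (show M from x.1)) ∈ oreModFilt ι θ M G (i + 1)
      rw [pow_succ', mul_smul]
      exact theta_smul_mem hcomm hx⟩
  refine ⟨i, fun N m hm hNm => ?_⟩
  obtain ⟨m₀, h₀, hm₀⟩ := exists_leading hcomm hm
  have h1 := theta_pow_smul_mem hcomm hm₀ N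
  have h2 : (show resMod ι M from θ ^ (i + N + 1) • m₀) ∈ oreModFilt ι θ M G (i + N) := by
    have h3 : θ ^ (i + N + 1) • m₀ = θ ^ N • m - θ ^ N • (m - θ ^ (i + 1) • m₀) := by
      rw [smul_sub, sub_sub_cancel, smul_smul, ← pow_add]
      congr 2
      omega
    rw [h3]
    exact sub_mem (S := Submodule R (resMod ι M)) hNm h1
  have h4 : (⟨m₀, h₀⟩ : M₀) ∈ Kf i := by
    have h5 := hi (i + N) (Nat.le_add_right i N)
    change Kf i = Kf (i + N) at h5
    rw [h5]
    exact h2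
  have h6 : m = (m - θ ^ (i + 1) • m₀) + θ ^ (i + 1) • m₀ := by abel
  rw [h6]
  exact add_mem (S := Submodule R (resMod ι M)) hm₀ h4

/-- Take two consecutive steps of the filtration, far enough out that θ is injective on the graded
pieces; this gives the hypothesis of `exact_α_π`. -/
theorem exists_orePresentation [IsNoetherianRing R] (h : IsOre ι θ) (M : ModuleCat.{u} S)
    [Module.Finite S M] :
    ∃ D : OrePresentation ι θ M, Function.Injective D.i.hom ∧ (D.shortComplex h.comm).ShortExact := by
  obtain ⟨G, hG⟩ := ‹Module.Finite S M›
  have hGf : (G : Set M).Finite := G.finite_toSet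
  obtain ⟨i, hi⟩ := exists_gr_injective (ι := ι) (θ := θ) (M := M) h.comm hGf
  let P := oreModFilt ι θ M G i
  let Q := oreModFilt ι θ M G (i + 1)
  have hPQ : P ≤ Q := oreModFilt_mono ι θ M G (Nat.le_succ i)
  let inc : Q →+ M := AddMonoidHom.mk' (fun q => (q.1 : M)) (fun _ _ => rfl)
  let D : OrePresentation ι θ M :=
    { P := ModuleCat.of R P
      Q := ModuleCat.of R Q
      i := ModuleCat.ofHom (Submodule.inclusion hPQ)
      inc := inc
      t := AddMonoidHom.mk' (fun m => (⟨θ • (show M from m.1), theta_smul_mem h.comm m.2⟩ : Q))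
        (fun m m' => Subtype.ext (smul_add θ (show M from m.1) (show M from m'.1)))
      hinc := Subtype.val_injective
      inc_smul := fun _ _ => rfl
      inc_t := fun _ => rfl
      finP := Module.Finite.iff_fg.mpr (fg_oreModFilt hGf i)
      finQ := Module.Finite.iff_fg.mpr (fg_oreModFilt hGf (i + 1)) }
  have hDi : Function.Injective D.i.hom := Submodule.inclusion_injective hPQ
  refine ⟨D, hDi, shortExact_of_exact (X := D.shortComplex h.comm) (D.α_injective h hDi)
    (D.exact_α_π h fun k n hn => ?_) ?_⟩
  · refine ⟨⟨(n (k + 1)).1, ?_⟩, rfl⟩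
    refine hi (k + 1) (D.inc (n (k + 1))) (n (k + 1)).2 ?_
    rw [Finset.sum_range_succ] at hn
    rw [eq_neg_of_add_eq_zero_right hn]
    refine (oreModFilt ι θ M G (i + k + 1)).neg_mem (Submodule.sum_mem _ fun j hj => ?_)
    exact oreModFilt_mono ι θ M G (by have := Finset.mem_range.mp hj; omega)
      (theta_pow_smul_mem h.comm (m := D.inc (n j)) (n j).2 j)
  · change Function.Surjective D.π.hom
    rw [← LinearMap.range_eq_top, eq_top_iff, ← hG, Submodule.span_le]
    intro g hg
    have hgQ : (show resMod ι M from g) ∈ Q :=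
      Submodule.subset_span ⟨0, Nat.zero_le _, g, hg, by rw [pow_zero, one_smul]⟩
    exact ⟨bcTmul ι D.Q 1 ⟨g, hgQ⟩, by rw [D.π_tmul, one_smul]; rfl⟩

end Existence

end OreModules

/-! ### Growth of the dimension up to torsion in an Ore extension. -/

section GenericDimensionOre

variable {R S : Type u} [Ring R] [Ring S] {ι : R →+* S} {θ : S}

theorem KillsEnd.mono {C : Type*} [Category C] [Abelian C] [HasExt.{u} C] {M : C} {φ : M ⟶ M}
    {d d' : ℕ} (h : KillsEnd φ d) (hd : d ≤ d') : KillsEnd φ d' :=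
  fun N i hi e => h N i (hd.trans_lt hi) e

theorem extPre_cMul_comm {c : R} (hc : ∀ r, Commute c r) {M M' N : ModuleCat.{u} R} (g : M ⟶ M')
    {i : ℕ} (e : Abelian.Ext.{u} M' N i) :
    extPre (cMul c hc M) (extPre g e) = extPre g (extPre (cMul c hc M') e) := by
  rw [extPre_extPre, extPre_extPre, cMul_comp hc]

theorem exists_connecting {A B C : ModuleCat.{u} R} {a : A ⟶ B} {b : B ⟶ C} {w : a ≫ b = 0}
    (hX : (ShortComplex.mk a b w).ShortExact) (N : ModuleCat.{u} R) (j : ℕ) :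
    ∃ δ : Abelian.Ext.{u} A N j →+ Abelian.Ext.{u} C N (1 + j),
      (∀ e : Abelian.Ext.{u} B N j, δ (extPre a e) = 0) ∧
      (∀ (c : R) (hc : ∀ r, Commute c r) (y : Abelian.Ext.{u} A N j),
        extPre (cMul c hc C) (δ y) = δ (extPre (cMul c hc A) y)) ∧
      (∀ y, δ y = 0 → ∃ e : Abelian.Ext.{u} B N j, extPre a e = y) ∧
      (∀ e, extPre b e = 0 → ∃ y, δ y = e) :=
  ⟨hX.extClass.precomp N rfl, extDelta_extPre hX,
    fun c hc y => extPre_extDelta hX hX (cMulShort c hc _) y,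
    fun y hy => exists_extPre_of_extDelta hX y hy, fun e he => exists_extDelta_of_extPre hX e he⟩

theorem extPre_addHom {M N : ModuleCat.{u} R} (φ : M ⟶ N) {L : ModuleCat.{u} R} {i : ℕ}
    (e e' : Abelian.Ext.{u} N L i) : extPre φ (e + e') = extPre φ e + extPre φ e' := by
  simp [extPre]

/-- The presentation by two induced modules raises the dimension by at most one, and the
annihilators of both pieces are multiplied. -/
theorem GenDim.ore [IsNoetherianRing R] (h : IsOre ι θ) {Z : Set R} {d : ℕ} (hR : GenDim R Z d)
    (hmul : ∀ c ∈ Z, ∀ c' ∈ Z, c * c' ∈ Z) (hZ : ∀ c ∈ Z, ∀ s, Commute (ι c) s) :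
    GenDim S (ι '' Z) (d + 1) := by
  intro M hM
  obtain ⟨D, hi, hX⟩ := exists_orePresentation h M
  obtain ⟨c₁, h₁, hc₁, hk₁⟩ := hR D.P D.finP
  obtain ⟨c₂, h₂, hc₂, hk₂⟩ := hR D.Q D.finQ
  have hf : IsFlat ι := h.vflat.isFlat
  have e₁ := hk₁.baseChange hf
  have e₂ := (hk₂.baseChange hf).mono (Nat.le_succ d)
  rw [bcMap_cMul ι hc₁ (hZ c₁ h₁)] at e₁
  rw [bcMap_cMul ι hc₂ (hZ c₂ h₂)] at e₂
  refine ⟨ι (c₂ * c₁), ⟨_, hmul _ h₂ _ h₁, rfl⟩, hZ _ (hmul _ h₂ _ h₁), ?_⟩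
  have := KillsEnd.right hX (cMulShort (ι c₁) (hZ _ h₁) _) (cMulShort (ι c₂) (hZ _ h₂) _) e₁ e₂
  have h3 : cMul (ι (c₂ * c₁)) (hZ _ (hmul _ h₂ _ h₁)) M =
      cMul (ι c₁) (hZ _ h₁) M ≫ cMul (ι c₂) (hZ _ h₂) M := by
    rw [← cMul_mul (hZ _ h₂) (hZ _ h₁)]
    congr 1
    exact map_mul ι _ _
  rw [h3]
  exact this

/-- The presentation alone would give d + 2 with annihilators in Z. The gain comes from the larger
set Z', which does better on P: its element f need not commute with θ, but by `α_cMul` its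
successive derivatives g k still annihilate modulo the image of α, until one of them lands in Z. -/
theorem GenDim.ore_of_derivation [IsNoetherianRing R] (h : IsOre ι θ) {Z Z' : Set R} {d : ℕ}
    (hR' : GenDim R Z' d) (hR : GenDim R Z (d + 1))
    (hmul : ∀ c ∈ Z, ∀ c' ∈ Z, c * c' ∈ Z) (hZ : ∀ c ∈ Z, ∀ s, Commute (ι c) s)
    (hZ' : ∀ f ∈ Z', ∃ (m : ℕ) (g : ℕ → R), g 0 = f ∧ (∀ k r, Commute (g k) r) ∧
      (∀ k, θ * ι (g k) = ι (g k) * θ + ι (g (k + 1))) ∧ g m ∈ Z) :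
    GenDim S (ι '' Z) (d + 1) := by
  intro M hM
  obtain ⟨D, hi, hX⟩ := exists_orePresentation h M
  have hf : IsFlat ι := h.vflat.isFlat
  let Y : ShortComplex (ModuleCat.{u} R) :=
    ShortComplex.mk D.i (ModuleCat.ofHom (LinearMap.range D.i.hom).mkQ)
      (ModuleCat.hom_ext (LinearMap.range_mkQ_comp D.i.hom))
  have hY : Y.ShortExact := shortExact_of_exact (X := Y) hi
    (LinearMap.exact_map_mkQ_range D.i.hom) (Submodule.mkQ_surjective _)
  have hbY := hf.shortExact hY
  have := D.finQ
  obtain ⟨f, hfZ, hfc, hkf⟩ := hR' D.P D.finP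
  obtain ⟨c₂, h₂, hc₂, hk₂⟩ := hR D.Q D.finQ
  obtain ⟨c₃, h₃, hc₃, hk₃⟩ := hR Y.X₃
    (Module.Finite.of_surjective (LinearMap.range D.i.hom).mkQ (Submodule.mkQ_surjective _))
  obtain ⟨m, g, hg0, hgc, hgθ, hgm⟩ := hZ' f hfZ
  have e₁ := hkf.baseChange hf
  have e₂ := hk₂.baseChange hf
  have e₃ := hk₃.baseChange hf
  rw [bcMap_cMul ι hc₂ (hZ c₂ h₂)] at e₂
  rw [bcMap_cMul ι hc₃ (hZ c₃ h₃)] at e₃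
  -- The factor c may grow with k but must not depend on N, j or y. Of the connecting map only its
  -- vanishing on the image of α is used.
  have key : ∀ k, ∃ c, ∃ hc : c ∈ Z, ∀ (N : ModuleCat.{u} S) (j : ℕ), d < j →
      ∀ δ : Abelian.Ext.{u} (baseChange ι D.P) N j →+ Abelian.Ext.{u} M N (1 + j),
        (∀ e, δ (extPre (D.α h.comm) e) = 0) → ∀ y,
        δ (extPre (cMul (ι c) (hZ c hc) (baseChange ι D.P))
          (extPre (bcMap ι (cMul (g k) (hgc k) D.P)) y)) = 0 := by
    intro k
    induction k with
    | zero =>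
      -- Any element of Z would serve, since g 0 = f already kills Ext of the module induced from P
      -- in degrees above d.
      refine ⟨c₂, h₂, fun N j hj δ _ y => ?_⟩
      have h0 : cMul (g 0) (hgc 0) D.P = cMul f hfc D.P := by
        congr 1
      rw [h0, e₁ N j hj y, extPre_zero, map_zero]
    | succ k ih =>
      obtain ⟨c, hc, ih⟩ := ih
      refine ⟨c * c₃, hmul _ hc _ h₃, fun N j hj δ hδ y => ?_⟩
      obtain ⟨ε, -, hε, hε', -⟩ := exists_connecting hbY N j
      -- The obstruction to extending y from P to Q lies in Ext^(1+j) of the module induced from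
      -- Q/P, and c₃ annihilates it.
      obtain ⟨w, hw⟩ : ∃ w : Abelian.Ext.{u} (baseChange ι D.Q) N j,
          extPre (bcMap ι D.i) w = extPre (cMul (ι c₃) (hZ _ h₃) (baseChange ι D.P)) y := hε' (extPre (cMul (ι c₃) (hZ _ h₃) (baseChange ι D.P)) y)
        ((hε _ _ y).symm.trans (e₃ N (1 + j) (by omega) _))
      have h1 := congrArg (fun φ => extPre φ w) (D.α_cMul h.comm (hgc k) (hgc (k + 1)) (hgθ k))
      rw [add_extPre, ← extPre_extPre, ← extPre_extPre, ← extPre_extPre, hw] at h1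
      have h2 := congrArg (fun z => δ
        (extPre (cMul (ι c) (hZ c hc) (baseChange ι D.P)) z)) h1
      rw [extPre_cMul_comm (hZ c hc), hδ, extPre_addHom, map_add, ih N j hj δ hδ, zero_add,
        ← extPre_cMul_comm (hZ _ h₃)] at h2
      have h3 : cMul (ι (c * c₃)) (hZ _ (hmul _ hc _ h₃)) (baseChange ι D.P) =
          cMul (ι c) (hZ _ hc) (baseChange ι D.P) ≫ cMul (ι c₃) (hZ _ h₃) _ := by
        rw [cMul_comp, ← cMul_mul (hZ _ hc) (hZ _ h₃)]
        congr 1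
        exact map_mul ι _ _
      rw [h3, ← extPre_extPre]
      exact h2.symm
  obtain ⟨c, hc, hk⟩ := key m
  have hcg := hmul _ hc _ hgm
  have hcc := hmul _ h₂ _ hcg
  refine ⟨ι (c₂ * (c * g m)), ⟨_, hcc, rfl⟩, hZ _ hcc, fun N i hi e => ?_⟩
  have h3 : cMul (ι (c₂ * (c * g m))) (hZ _ hcc) M =
      (cMul (ι (g m)) (hZ _ hgm) M ≫ cMul (ι c) (hZ _ hc) M) ≫ cMul (ι c₂) (hZ _ h₂) M := by
    rw [← cMul_mul (hZ _ hc) (hZ _ hgm), ← cMul_mul (hZ _ h₂)]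
    congr 1
    rw [map_mul, map_mul]
  obtain ⟨j, rfl⟩ : ∃ j, i = 1 + j := ⟨i - 1, by omega⟩
  obtain ⟨δ, hδ, hδ', -, hδ₃⟩ := exists_connecting hX N j
  obtain ⟨y, hy⟩ := hδ₃ (extPre (cMul (ι c₂) (hZ _ h₂) M) e) (by
    rw [← extPre_cMul_comm]
    exact e₂ N _ hi _)
  rw [h3, ← extPre_extPre, ← hy, ← extPre_extPre, hδ', hδ', extPre_cMul_comm,
    ← bcMap_cMul ι (hgc m) (hZ _ hgm)]
  exact hk N j (by omega) δ hδ y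

end GenericDimensionOre

/-! ### Towers of Ore extensions from dual coordinates. -/

section Coordinates

/-- Elements `g k` and `b k` with `[g k, b l] = δ_{kl}`, central commutators `[b k, b l]` and
locally nilpotent `[·, b k]`, in a ring in which the positive integers are invertible. -/
structure CoordSystem (I W : Type*) [DecidableEq I] [Ring W] where
  /-- The coordinates. -/
  g : I → W
  /-- The dual coordinates. -/
  b : I → W
  isUnit_natCast : ∀ m : ℕ, m ≠ 0 → IsUnit (m : W)
  dual : ∀ k l, adR (b k) (g l) = if k = l then 1 else 0
  comm : ∀ k l w, Commute (b k * b l - b l * b k) w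
  nil : ∀ k w, ∃ N, (adR (b k))^[N] w = 0

namespace CoordSystem

variable {I W : Type*} [DecidableEq I] [Ring W] (C : CoordSystem I W)

/-- The centralizer of the `b k` for `k ∉ T`. -/
def ring (T : Finset I) : Subring W := Subring.centralizer (C.b '' {k | k ∉ T})

theorem mem_ring {T : Finset I} {w : W} : w ∈ C.ring T ↔ ∀ k ∉ T, adR (C.b k) w = 0 := by
  simp only [ring, adR_apply, Subring.mem_centralizer_iff, Set.forall_mem_image, sub_eq_zero]
  exact ⟨fun h k hk => (h hk).symm, fun h k hk => (h k hk).symm⟩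

theorem ring_mono {T T' : Finset I} (h : T ⊆ T') : C.ring T ≤ C.ring T' := fun _ hw =>
  C.mem_ring.mpr fun k hk => C.mem_ring.mp hw k fun hk' => hk (h hk')

theorem ring_univ [Fintype I] : C.ring Finset.univ = ⊤ :=
  eq_top_iff.mpr fun _ _ => C.mem_ring.mpr fun k hk => absurd (Finset.mem_univ k) hk

theorem g_mem {T : Finset I} {k : I} (hk : k ∈ T) : C.g k ∈ C.ring T :=
  C.mem_ring.mpr fun l hl => by rw [C.dual, if_neg (fun h : l = k => hl (h ▸ hk))]

/-- The Jacobi identity: the commutator of b k and b l is central, so the two brackets commute. -/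
theorem adR_mem {T : Finset I} (k : I) {w : W} (hw : w ∈ C.ring T) : adR (C.b k) w ∈ C.ring T := by
  refine C.mem_ring.mpr fun l hl => ?_
  have h1 := C.mem_ring.mp hw l hl
  have h2 := (C.comm k l w).eq
  rw [adR_apply, sub_eq_zero] at h1
  rw [adR_apply, adR_apply]
  have h3 : (w * C.b k - C.b k * w) * C.b l - C.b l * (w * C.b k - C.b k * w) =
      (w * C.b l - C.b l * w) * C.b k - C.b k * (w * C.b l - C.b l * w) -
        ((C.b k * C.b l - C.b l * C.b k) * w - w * (C.b k * C.b l - C.b l * C.b k)) := by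
    noncomm_ring
  rw [h3, h2, h1]
  simp

theorem adR_iterate_mem {T : Finset I} (k : I) {w : W} (hw : w ∈ C.ring T) (N : ℕ) :
    (adR (C.b k))^[N] w ∈ C.ring T := by
  induction N with
  | zero => exact hw
  | succ N ih =>
    rw [Function.iterate_succ_apply']
    exact C.adR_mem k ih

/-- Taylor expansion in g k, whose coefficients commute with b k as well. -/
theorem isOre {T : Finset I} {k : I} (hk : k ∉ T) :
    IsOre (Subring.inclusion (C.ring_mono (Finset.subset_insert k T)))
      (⟨C.g k, C.g_mem (Finset.mem_insert_self k T)⟩ : C.ring (insert k T)) := by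
  refine isOre_of_adR (b := C.b k) C.isUnit_natCast ?_ _ ?_ (fun q => C.adR_mem k)
    (fun q _ => C.nil k q) _ ?_
  · intro m q hq s hs hm
    refine C.mem_ring.mpr fun l hl => ?_
    have h1 := C.mem_ring.mp hq l hl
    rw [← hs, ← nsmul_eq_mul, map_nsmul, nsmul_eq_mul] at h1
    exact (C.isUnit_natCast m hm).mul_right_eq_zero.mp h1
  · rw [C.dual, if_pos rfl]
  · intro q
    rw [C.mem_ring, C.mem_ring]
    constructor
    · exact fun h => ⟨fun l hl => h l fun h' => hl (Finset.mem_insert_of_mem h'), h k hk⟩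
    · rintro ⟨h, h'⟩ l hl
      by_cases hlk : l = k
      · rwa [hlk]
      · exact h l fun h' => (Finset.mem_insert.mp h').elim hlk hl

theorem isNoetherianRing_ring (h : IsNoetherianRing (C.ring ∅)) (T : Finset I) :
    IsNoetherianRing (C.ring T) := by
  induction T using Finset.induction_on with
  | empty => exact h
  | insert k T hk ih => exact (C.isOre hk).isNoetherianRing

theorem isNoetherianRing [Fintype I] (h : IsNoetherianRing (C.ring ∅)) : IsNoetherianRing W := by
  have := C.isNoetherianRing_ring h Finset.univ
  refine isNoetherianRing_of_surjective _ _ (C.ring Finset.univ).subtype fun w => ⟨⟨w, ?_⟩, rfl⟩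
  rw [C.ring_univ]
  trivial

theorem commute_insert {T : Finset I} {k : I} (hk : k ∉ T) {y : W}
    (hT : ∀ w ∈ C.ring T, Commute y w) (hy : Commute y (C.g k)) :
    ∀ w ∈ C.ring (insert k T), Commute y w := by
  intro w hw
  obtain ⟨m, r, hr⟩ := (C.isOre hk).exists_mem_oreFilt ⟨w, hw⟩
  have h2 : w = ∑ j ∈ Finset.range m, C.g k ^ j * (r j).1 := by
    have := congrArg Subtype.val hr
    simpa using this
  rw [h2]
  exact Commute.sum_right _ _ _ fun j _ => (hy.pow_right j).mul_right (hT _ (r j).2)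

end CoordSystem

/-- When θ commutes with the coefficients, S is the polynomial ring over R. -/
theorem IsOre.noZeroDivisors {R S : Type u} [Ring R] [Ring S] {ι : R →+* S} {θ : S}
    (h : IsOre ι θ) [NoZeroDivisors R] (hθ : ∀ r, Commute (ι r) θ) : NoZeroDivisors S := by
  let φ := Polynomial.eval₂RingHom' ι θ hθ
  have hφ : ∀ p j, h.coeff j (φ p) = p.coeff j := by
    intro p j
    have h1 : φ p = ∑ i ∈ p.support, θ ^ i * ι (p.coeff i) := by
      change Polynomial.eval₂ ι θ p = _
      rw [Polynomial.eval₂_eq_sum, Polynomial.sum]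
      exact Finset.sum_congr rfl fun i _ => ((hθ _).pow_right i).eq
    rw [h1, map_sum]
    simp only [h.coeff_pow_mul]
    simpa using fun h0 => h0.symm
  have hinj : Function.Injective φ := fun p q hpq => Polynomial.ext fun j => by
    rw [← hφ, ← hφ, hpq]
  have hsurj : Function.Surjective φ := by
    intro s
    obtain ⟨k, r, rfl⟩ := h.exists_eq_sum s
    refine ⟨∑ j ∈ Finset.range k, Polynomial.X ^ j * Polynomial.C (r j), ?_⟩
    rw [map_sum]
    refine Finset.sum_congr rfl fun j _ => ?_
    rw [map_mul, map_pow]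
    congr 1
    · congr 1
      exact Polynomial.eval₂_X _ _
    · exact Polynomial.eval₂_C _ _
  let e := RingEquiv.ofBijective φ ⟨hinj, hsurj⟩
  exact e.symm.injective.noZeroDivisors e.symm (map_zero _) (map_mul _)

theorem isNoetherianRing_of_isUnit {R : Type*} [Ring R] (h : ∀ r : R, r ≠ 0 → IsUnit r) :
    IsNoetherianRing R := by
  refine isNoetherianRing_iff_ideal_fg R |>.mpr fun J => ?_
  by_cases hJ : J = ⊥
  · rw [hJ]
    exact Submodule.fg_bot
  · obtain ⟨r, hr, hr0⟩ := (Submodule.ne_bot_iff J).mp hJ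
    rw [Ideal.eq_top_of_isUnit_mem J hr (h r hr0)]
    exact Module.Finite.fg_top

end Coordinates

/-! ### The Weyl algebra and its dimension. -/

section WeylTower

variable {W : Type u} [Ring W] {n : ℕ} (C : CoordSystem (Fin n ⊕ Fin n) W)

namespace CoordSystem

/-- The centralizer of the `b (inl i)` for `i ∉ s` and of all `b (inr i)`. -/
abbrev xRing (s : Finset (Fin n)) : Subring W := C.ring (s.map ⟨Sum.inl, Sum.inl_injective⟩)

/-- The centralizer of the `b (inr i)` for `i ∉ t`. -/
abbrev dRing (t : Finset (Fin n)) : Subring W :=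
  C.ring (Finset.univ.map ⟨Sum.inl, Sum.inl_injective⟩ ∪ t.map ⟨Sum.inr, Sum.inr_injective⟩)

/-- A coordinate system `x_i, ∂_i` is a Weyl system if the dual of `x_i` is `-∂_i` and the dual of
`∂_i` is `x_i`, and if the centralizer of all coordinates is a field. -/
structure IsWeyl : Prop where
  b_inr : ∀ i, C.b (Sum.inr i) = C.g (Sum.inl i)
  b_inl : ∀ i, C.b (Sum.inl i) = - C.g (Sum.inr i)
  commute : ∀ w ∈ C.ring ∅, ∀ w' ∈ C.ring ∅, Commute w w'
  isUnit : ∀ w ∈ C.ring ∅, w ≠ 0 → IsUnit w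

variable {C} (hC : C.IsWeyl)

theorem xRing_insert (i : Fin n) (s : Finset (Fin n)) :
    C.xRing (insert i s) = C.ring (insert (Sum.inl i) (s.map ⟨Sum.inl, Sum.inl_injective⟩)) := by
  rw [xRing, Finset.map_insert]
  rfl

theorem dRing_insert (i : Fin n) (t : Finset (Fin n)) :
    C.dRing (insert i t) = C.ring (insert (Sum.inr i) (Finset.univ.map ⟨Sum.inl, Sum.inl_injective⟩
      ∪ t.map ⟨Sum.inr, Sum.inr_injective⟩)) := by
  rw [dRing, Finset.map_insert, Finset.union_insert]
  rfl

theorem inl_notMem {i : Fin n} {s : Finset (Fin n)} (hi : i ∉ s) :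
    (Sum.inl i : Fin n ⊕ Fin n) ∉ s.map ⟨Sum.inl, Sum.inl_injective⟩ := by
  simpa using hi

theorem inr_notMem {i : Fin n} {t : Finset (Fin n)} (hi : i ∉ t) :
    (Sum.inr i : Fin n ⊕ Fin n) ∉ (Finset.univ : Finset (Fin n)).map ⟨Sum.inl, Sum.inl_injective⟩
      ∪ t.map ⟨Sum.inr, Sum.inr_injective⟩ := by
  simpa using hi

include hC in
theorem IsWeyl.commute_x {s : Finset (Fin n)} {w : W} (hw : w ∈ C.xRing s) (i : Fin n) :
    Commute w (C.g (Sum.inl i)) := by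
  have := C.mem_ring.mp hw (Sum.inr i) (by simp)
  rw [hC.b_inr, adR_apply, sub_eq_zero] at this
  exact this

include hC in
theorem IsWeyl.commute_d {s : Finset (Fin n)} {w : W} (hw : w ∈ C.xRing s) {i : Fin n}
    (hi : i ∉ s) : Commute w (C.g (Sum.inr i)) := by
  have := C.mem_ring.mp hw (Sum.inl i) (inl_notMem hi)
  rw [hC.b_inl, adR_apply, sub_eq_zero, mul_neg, neg_mul, neg_inj] at this
  exact this

include hC in
theorem IsWeyl.xRing_commute (s s' : Finset (Fin n)) :
    ∀ w ∈ C.xRing s, ∀ w' ∈ C.xRing s', Commute w w' := by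
  induction s' using Finset.induction_on with
  | empty =>
    intro w hw w' hw'
    refine Commute.symm ?_
    revert w
    induction s using Finset.induction_on with
    | empty => exact fun w hw => (hC.commute w hw w' hw').symm
    | insert i s hi ih =>
      rw [xRing_insert]
      exact C.commute_insert (inl_notMem hi) ih (hC.commute_x hw' i)
  | insert i s' hi ih =>
    intro w hw
    rw [xRing_insert]
    exact C.commute_insert (inl_notMem hi) (ih w hw) (hC.commute_x hw i)

include hC in
-- Functions of the variables in s commute with every coordinate function and with ∂ᵢ for i outside
-- s; induct along the tower adjoining the ∂ᵢ.
theorem IsWeyl.xRing_dRing_commute {s t : Finset (Fin n)} (hst : Disjoint s t) :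
    ∀ w ∈ C.xRing s, ∀ w' ∈ C.dRing t, Commute w w' := by
  intro w hw
  induction t using Finset.induction_on with
  | empty =>
    intro w' hw'
    exact hC.xRing_commute s Finset.univ w hw w' (by simpa [dRing] using hw')
  | insert i t hi ih =>
    rw [Finset.disjoint_insert_right] at hst
    rw [dRing_insert]
    exact C.commute_insert (inr_notMem hi) (ih hst.2) (hC.commute_d hw hst.1)

include hC in
theorem IsWeyl.isUnit_ring (w : C.ring ∅) (hw : w ≠ 0) : IsUnit w := by
  obtain ⟨u, hu⟩ := hC.isUnit w.1 w.2 fun h => hw (Subtype.ext h)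
  have hmem : (↑u⁻¹ : W) ∈ C.ring ∅ := by
    have h1 : ∀ k ∉ (∅ : Finset (Fin n ⊕ Fin n)), adR (C.b k) w.1 = 0 := C.mem_ring.mp w.2
    refine C.mem_ring.mpr fun k hk => ?_
    have h2 := h1 k hk
    rw [adR_apply, sub_eq_zero, ← hu] at h2
    rw [adR_apply, sub_eq_zero]
    exact (show Commute (u : W) (C.b k) from h2).units_inv_left.eq
  refine ⟨⟨w, ⟨_, hmem⟩, Subtype.ext ?_, Subtype.ext ?_⟩, rfl⟩
  · change w.1 * ↑u⁻¹ = 1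
    rw [← hu, Units.mul_inv]
  · change ↑u⁻¹ * w.1 = 1
    rw [← hu, Units.inv_mul]

include hC in
theorem IsWeyl.isNoetherianRing_ring (T : Finset (Fin n ⊕ Fin n)) : IsNoetherianRing (C.ring T) :=
  C.isNoetherianRing_ring (isNoetherianRing_of_isUnit hC.isUnit_ring) T

include hC in
theorem IsWeyl.noZeroDivisors_xRing (s : Finset (Fin n)) : NoZeroDivisors (C.xRing s) := by
  induction s using Finset.induction_on with
  | empty =>
    rw [xRing, Finset.map_empty]
    refine ⟨fun {a b} hab => ?_⟩
    by_contra! h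
    exact h.2 ((hC.isUnit_ring a h.1).mul_right_eq_zero.mp hab)
  | insert i s hi ih =>
    rw [xRing_insert]
    exact (C.isOre (inl_notMem hi)).noZeroDivisors fun r =>
      Subtype.ext (hC.commute_x r.2 i)

/-- The nonzero elements of `xRing s`, in a larger ring. -/
def nonzeros (C : CoordSystem (Fin n ⊕ Fin n) W) (s : Finset (Fin n)) (B : Subring W) : Set B :=
  {r | r.1 ≠ 0 ∧ r.1 ∈ C.xRing s}

include hC in
theorem IsWeyl.mul_mem_nonzeros {s : Finset (Fin n)} {B : Subring W} :
    ∀ c ∈ C.nonzeros s B, ∀ c' ∈ C.nonzeros s B, c * c' ∈ C.nonzeros s B := by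
  rintro c ⟨hc, hcs⟩ c' ⟨hc', hcs'⟩
  refine ⟨fun h => ?_, mul_mem hcs hcs'⟩
  have := hC.noZeroDivisors_xRing s
  rcases mul_eq_zero.mp (show (⟨c.1, hcs⟩ : C.xRing s) * ⟨c'.1, hcs'⟩ = 0 from
    Subtype.ext h) with h' | h'
  · exact hc (congrArg Subtype.val h')
  · exact hc' (congrArg Subtype.val h')

theorem image_nonzeros {s : Finset (Fin n)} {B B' : Subring W} (hB : C.xRing s ≤ B) (h : B ≤ B') :
    Subring.inclusion h '' C.nonzeros s B = C.nonzeros s B' := by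
  ext c
  constructor
  · rintro ⟨c, ⟨hc, hcs⟩, rfl⟩
    exact ⟨hc, hcs⟩
  · rintro ⟨hc, hcs⟩
    exact ⟨⟨c.1, hB hcs⟩, ⟨hc, hcs⟩, rfl⟩

theorem xRing_mono {s s' : Finset (Fin n)} (h : s ⊆ s') : C.xRing s ≤ C.xRing s' :=
  C.ring_mono (Finset.map_subset_map.mpr h)

theorem xRing_le_dRing (s t : Finset (Fin n)) : C.xRing s ≤ C.dRing t :=
  C.ring_mono ((Finset.map_subset_map.mpr (Finset.subset_univ s)).trans Finset.subset_union_left)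

variable [Nontrivial W]

include hC in
-- Over the domain k[x_s] the dimension up to torsion is zero, and each further variable adds at
-- most one.
theorem IsWeyl.genDim_xRing (s s' : Finset (Fin n)) (h : Disjoint s s') :
    GenDim (C.xRing (s' ∪ s)) (C.nonzeros s (C.xRing (s' ∪ s))) s'.card := by
  induction s' using Finset.induction_on with
  | empty =>
    rw [Finset.empty_union]
    exact genDim_zero_of_domain (fun r hr => ⟨fun h' => hr (Subtype.ext h'), r.2⟩) hC.mul_mem_nonzeros
      ⟨one_ne_zero, one_mem _⟩ fun r r' => Subtype.ext (hC.xRing_commute s s _ r.2 _ r'.2)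
  | insert i s' hi ih =>
    rw [Finset.disjoint_insert_right] at h
    have hi' : i ∉ s' ∪ s := by simp [hi, h.1]
    have := hC.isNoetherianRing_ring ((s' ∪ s).map ⟨Sum.inl, Sum.inl_injective⟩)
    have h1 := (ih h.2).ore (C.isOre (inl_notMem hi')) hC.mul_mem_nonzeros (by
      rintro c ⟨-, hc⟩ w
      refine Subtype.ext ?_
      exact hC.xRing_commute _ _ _ hc w.1 ((xRing_insert i (s' ∪ s)).ge w.2))
    rw [image_nonzeros (xRing_mono Finset.subset_union_right)] at h1
    rw [Finset.card_insert_of_notMem hi, Finset.insert_union, xRing_insert]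
    exact h1

include hC in
-- Induction on t for all s at once: adjoining ∂ᵢ uses the bound for s and the bound, smaller by
-- one, for s ∪ {i}. With s empty and t everything the value is n.
theorem IsWeyl.genDim_dRing (t s : Finset (Fin n)) (h : Disjoint s t) :
    GenDim (C.dRing t) (C.nonzeros s (C.dRing t)) (n - s.card) := by
  induction t using Finset.induction_on generalizing s with
  | empty =>
    have h1 := hC.genDim_xRing s sᶜ disjoint_compl_right
    have h2 : C.dRing ∅ = C.xRing (sᶜ ∪ s) := by
      rw [dRing, Finset.map_empty, Finset.union_empty, Finset.union_comm, Finset.union_compl]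
    rw [h2]
    rwa [Finset.card_compl, Fintype.card_fin] at h1
  | insert i t hi ih =>
    rw [Finset.disjoint_insert_right] at h
    have := hC.isNoetherianRing_ring (Finset.univ.map ⟨Sum.inl, Sum.inl_injective⟩
      ∪ t.map ⟨Sum.inr, Sum.inr_injective⟩)
    have hcard : n - s.card = n - (insert i s).card + 1 := by
      have h1 := Finset.card_le_univ (insert i s)
      rw [Fintype.card_fin, Finset.card_insert_of_notMem h.1] at h1
      rw [Finset.card_insert_of_notMem h.1]
      omega
    have hdis : Disjoint (insert i s) t := Finset.disjoint_insert_left.mpr ⟨hi, h.2⟩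
    have h0 := ih s h.2
    rw [hcard] at h0
    have h1 := GenDim.ore_of_derivation (C.isOre (inr_notMem hi)) (ih (insert i s) hdis) h0
      hC.mul_mem_nonzeros (by
        rintro c ⟨-, hc⟩ w
        refine Subtype.ext ?_
        exact hC.xRing_dRing_commute (Finset.disjoint_insert_right.mpr h) _ hc w.1
          ((dRing_insert i t).ge w.2)) (by
        rintro f ⟨hf0, hf⟩
        classical
        -- The iterated derivatives of f in xᵢ. The last nonzero one no longer involves xᵢ.
        let G : ℕ → W := fun k => (adR (C.b (Sum.inl i)))^[k] f.1
        have hG : ∀ k, G k ∈ C.xRing (insert i s) := fun k => C.adR_iterate_mem _ hf k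
        have hex : ∃ N, G N = 0 := C.nil (Sum.inl i) f.1
        have hN : Nat.find hex ≠ 0 := fun h0 =>
          hf0 (by simpa [h0, G] using Nat.find_spec hex)
        obtain ⟨m, hm⟩ := Nat.exists_eq_succ_of_ne_zero hN
        have hm0 : G m ≠ 0 := Nat.find_min hex (by omega)
        have hm1 : adR (C.b (Sum.inl i)) (G m) = 0 := by
          have := Nat.find_spec hex
          rwa [hm, Nat.succ_eq_add_one, show G (m + 1) = adR (C.b (Sum.inl i)) (G m) from
            Function.iterate_succ_apply' _ _ _] at this
        refine ⟨m, fun k => ⟨G k, xRing_le_dRing _ _ (hG k)⟩, rfl, fun k r =>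
          Subtype.ext (hC.xRing_dRing_commute hdis _ (hG k) _ r.2), fun k => Subtype.ext ?_,
          hm0, ?_⟩
        · change C.g (Sum.inr i) * G k = G k * C.g (Sum.inr i) + G (k + 1)
          rw [show G (k + 1) = adR (C.b (Sum.inl i)) (G k) from
            Function.iterate_succ_apply' _ _ _, adR_apply, hC.b_inl]
          noncomm_ring
        · refine C.mem_ring.mpr fun l hl => ?_
          by_cases hli : l = Sum.inl i
          · rw [hli]
            exact hm1
          · refine C.mem_ring.mp (hG m) l fun h' => hl ?_
            rw [Finset.map_insert, Finset.mem_insert] at h'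
            exact h'.resolve_left hli)
    rw [image_nonzeros (xRing_le_dRing _ _), ← hcard] at h1
    rw [dRing_insert]
    exact h1

end CoordSystem

end WeylTower

/-! ## Rings complete for the adic topology of a central element -/

section PiComplete

/-- `T` is separated and complete for the `π`-adic topology, `π` being central and regular, and `q`
is the reduction modulo `π`. -/
structure IsPiComplete {T W : Type*} [Ring T] [Ring W] (ϖ : T) (q : T →+* W) : Prop where
  central : ∀ t, Commute ϖ t
  regular : ∀ t, ϖ * t = 0 → t = 0
  surj : Function.Surjective q
  ker : ∀ t, q t = 0 ↔ ∃ t', t = ϖ * t'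
  separated : ∀ t, (∀ k, ∃ u, t = ϖ ^ k * u) → t = 0
  complete : ∀ t : ℕ → T, ∃ s, ∀ k, ∃ u, s - ∑ i ∈ Finset.range k, ϖ ^ i * t i = ϖ ^ k * u

namespace IsPiComplete

variable {T W : Type*} [Ring T] [Ring W] {ϖ : T} {q : T →+* W} (h : IsPiComplete ϖ q)

include h

theorem pow_central (k : ℕ) (t : T) : Commute (ϖ ^ k) t := (h.central t).pow_left k

/-- The geometric series converges to a left inverse of 1 + yϖ. -/
theorem mem_jacobson : ϖ ∈ Ring.jacobson T := by
  rw [← Ideal.jacobson_bot, Ideal.mem_jacobson_iff]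
  intro y
  obtain ⟨s, hs⟩ := h.complete fun i => (-y) ^ i
  refine ⟨s, ?_⟩
  rw [Ideal.mem_bot]
  refine h.separated _ fun k => ?_
  obtain ⟨u, hu⟩ := hs k
  have h1 : (∑ i ∈ Finset.range k, ϖ ^ i * (-y) ^ i) * (y * ϖ + 1) = 1 - ϖ ^ k * (-y) ^ k := by
    have h2 : ∀ i, ϖ ^ i * (-y) ^ i = (-y * ϖ) ^ i := fun i => by
      rw [(h.central (-y)).symm.mul_pow, (h.pow_central i _).eq]
    simp only [h2]
    rw [show y * ϖ + 1 = 1 - (-y * ϖ) by noncomm_ring]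
    exact geom_sum_mul_neg _ _
  have h3 : s * y * ϖ + s - 1 = ϖ ^ k * (u * (y * ϖ + 1) - (-y) ^ k) := by
    have h4 : s = ∑ i ∈ Finset.range k, ϖ ^ i * (-y) ^ i + ϖ ^ k * u := by
      rw [← hu]
      abel
    have h5 : s * y * ϖ + s - 1 = s * (y * ϖ + 1) - 1 := by noncomm_ring
    rw [h5, h4, add_mul, h1]
    noncomm_ring
  exact ⟨_, h3⟩

/-- The ideal of all `t` with `ϖ ^ k t ∈ I`. -/
def colon (I : Ideal T) (k : ℕ) : Ideal T where
  carrier := {t | ϖ ^ k * t ∈ I}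
  zero_mem' := by simp
  add_mem' {a b} ha hb := by
    change ϖ ^ k * (a + b) ∈ I
    rw [mul_add]
    exact add_mem ha hb
  smul_mem' c x hx := by
    change ϖ ^ k * (c * x) ∈ I
    rw [← mul_assoc, (h.pow_central k c).eq, mul_assoc]
    exact I.mul_mem_left c hx

theorem mem_colon {I : Ideal T} {k : ℕ} {t : T} : t ∈ h.colon I k ↔ ϖ ^ k * t ∈ I := Iff.rfl

theorem mul_mem_colon {I : Ideal T} {k : ℕ} {t : T} :
    ϖ * t ∈ h.colon I k ↔ t ∈ h.colon I (k + 1) := by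
  rw [h.mem_colon, h.mem_colon, pow_succ, mul_assoc]

theorem colon_mono (I : Ideal T) : Monotone (h.colon I) := by
  refine monotone_nat_of_le_succ fun k t ht => ?_
  rw [h.mem_colon] at ht ⊢
  rw [pow_succ', mul_assoc]
  exact I.mul_mem_left ϖ ht

/-- The image of an ideal under the reduction. -/
def image (I : Ideal T) : Ideal W where
  carrier := q '' I
  zero_mem' := ⟨0, I.zero_mem, map_zero q⟩
  add_mem' := by
    rintro _ _ ⟨a, ha, rfl⟩ ⟨b, hb, rfl⟩
    exact ⟨a + b, I.add_mem ha hb, map_add q a b⟩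
  smul_mem' := by
    rintro c _ ⟨a, ha, rfl⟩
    obtain ⟨c, rfl⟩ := h.surj c
    exact ⟨c * a, I.mul_mem_left c ha, map_mul q c a⟩

theorem mem_image {I : Ideal T} {w : W} : w ∈ h.image I ↔ ∃ t ∈ I, q t = w := Iff.rfl

theorem exists_generators [IsNoetherianRing W] (I : Ideal T) :
    ∃ (m : ℕ) (g : Fin m → T), (∀ j, g j ∈ I) ∧
      ∀ w ∈ h.image I, ∃ c : Fin m → T, w = q (∑ j, c j * g j) := by
  obtain ⟨m, v, hv⟩ := Submodule.fg_iff_exists_fin_generating_family.mp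
    (IsNoetherian.noetherian (h.image I))
  have hv' : ∀ j, ∃ t ∈ I, q t = v j := fun j =>
    h.mem_image.mp (hv ▸ Submodule.subset_span ⟨j, rfl⟩)
  choose g hg hgv using hv'
  refine ⟨m, g, hg, fun w hw => ?_⟩
  rw [← hv] at hw
  obtain ⟨c, hc⟩ := (Submodule.mem_span_range_iff_exists_fun W).mp hw
  choose c' hc' using fun j => h.surj (c j)
  refine ⟨c', ?_⟩
  rw [← hc, map_sum]
  exact Finset.sum_congr rfl fun j _ => by rw [map_mul, hc', hgv, smul_eq_mul]

theorem exists_sub_eq [IsNoetherianRing W] {I : Ideal T} {m : ℕ} {g : Fin m → T}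
    (hgen : ∀ w ∈ h.image I, ∃ c : Fin m → T, w = q (∑ j, c j * g j)) {I' : Ideal T}
    (hI' : h.image I' ≤ h.image I) {t : T} (ht : t ∈ I') :
    ∃ (c : Fin m → T) (t' : T), t = ∑ j, c j * g j + ϖ * t' := by
  obtain ⟨c, hc⟩ := hgen (q t) (hI' ⟨t, ht, rfl⟩)
  obtain ⟨t', ht'⟩ := (h.ker (t - ∑ j, c j * g j)).mp (by rw [map_sub, hc, sub_self])
  exact ⟨c, t', by rw [← ht']; abel⟩

/-- The reductions of the ideals (I : ϖ^k) increase and become stationary. At the stable stage lifts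
of generators generate by successive approximation; one then descends to k = 0. -/
theorem isNoetherianRing [IsNoetherianRing W] : IsNoetherianRing T := by
  refine (isNoetherianRing_iff_ideal_fg T).mpr fun I => ?_
  obtain ⟨k, hk⟩ := monotone_stabilizes_iff_noetherian.mpr (inferInstance : IsNoetherian W W)
    ⟨fun k => h.image (h.colon I k), fun k l hkl => Set.image_mono (h.colon_mono I hkl)⟩
  -- Lifts of generators of the reduction generate up to a multiple ϖt', and then t' lies in the
  -- next ideal of the chain.
  have hstep : ∀ l, (h.colon I (l + 1)).FG → (h.colon I l).FG := by
    intro l hl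
    obtain ⟨m, g, hg, hgen⟩ := h.exists_generators (h.colon I l)
    obtain ⟨s, hs⟩ := hl
    classical
    refine ⟨s.image (ϖ * ·) ∪ Finset.univ.image g, le_antisymm ?_ fun t ht => ?_⟩
    · rw [Submodule.span_le]
      intro x hx
      rcases Finset.mem_union.mp (Finset.mem_coe.mp hx) with hx | hx
      · obtain ⟨y, hy, rfl⟩ := Finset.mem_image.mp hx
        exact h.mul_mem_colon.mpr (hs ▸ Submodule.subset_span hy)
      · obtain ⟨j, _, rfl⟩ := Finset.mem_image.mp hx
        exact hg j
    · obtain ⟨c, t', rfl⟩ := h.exists_sub_eq hgen le_rfl ht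
      refine add_mem (sum_mem fun j _ => Submodule.smul_mem _ (c j) (Submodule.subset_span ?_)) ?_
      · exact Finset.mem_coe.mpr (Finset.mem_union_right _ (Finset.mem_image_of_mem g
          (Finset.mem_univ j)))
      · have ht' : t' ∈ h.colon I (l + 1) := by
          rw [← h.mul_mem_colon]
          have := sub_mem ht (sum_mem fun j (_ : j ∈ Finset.univ) =>
            (h.colon I l).mul_mem_left (c j) (hg j))
          rwa [add_sub_cancel_left] at this
        rw [← hs] at ht'
        refine Submodule.span_induction (p := fun y _ => ϖ * y ∈ _) (fun y hy => ?_) ?_ ?_ ?_ ht'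
        · exact Submodule.subset_span (Finset.mem_coe.mpr (Finset.mem_union_left _
            (Finset.mem_image_of_mem _ hy)))
        · rw [mul_zero]
          exact zero_mem _
        · intro y z _ _ hy hz
          rw [mul_add]
          exact add_mem hy hz
        · intro a y _ hy
          rw [smul_eq_mul, ← mul_assoc, (h.central a).eq, mul_assoc]
          exact Submodule.smul_mem _ a hy
  have hbase : (h.colon I k).FG := by
    obtain ⟨m, g, hg, hgen⟩ := h.exists_generators (h.colon I k)
    classical
    refine ⟨Finset.univ.image g, le_antisymm ?_ fun t ht => ?_⟩
    · rw [Submodule.span_le]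
      intro x hx
      obtain ⟨j, _, rfl⟩ := Finset.mem_image.mp (Finset.mem_coe.mp hx)
      exact hg j
    · have hnext : ∀ i (x : T), ∃ (c : Fin m → T) (x' : T), x ∈ h.colon I (k + i) →
          x = ∑ j, c j * g j + ϖ * x' ∧ x' ∈ h.colon I (k + (i + 1)) := by
        intro i x
        by_cases hx : x ∈ h.colon I (k + i)
        · obtain ⟨c, x', hx'⟩ := h.exists_sub_eq hgen (hk (k + i) (Nat.le_add_right k i)).ge hx
          refine ⟨c, x', fun _ => ⟨hx', ?_⟩⟩
          rw [← add_assoc, ← h.mul_mem_colon]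
          have := sub_mem hx (sum_mem fun j (_ : j ∈ Finset.univ) =>
            (h.colon I (k + i)).mul_mem_left (c j) (h.colon_mono I (Nat.le_add_right k i) (hg j)))
          rwa [hx', add_sub_cancel_left] at this
        · exact ⟨0, 0, fun hx' => absurd hx' hx⟩
      choose c nx hcn using hnext
      let x : ℕ → T := fun i => Nat.rec t (fun i x => nx i x) i
      have hx : ∀ i, x i ∈ h.colon I (k + i) := fun i => by
        induction i with
        | zero => exact ht
        | succ i ih => exact (hcn i (x i) ih).2
      choose s hs using fun j => h.complete fun i => c i (x i) j
      have hsum : ∀ l, t = ∑ j, (∑ i ∈ Finset.range l, ϖ ^ i * c i (x i) j) * g j +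
          ϖ ^ l * x l := by
        intro l
        induction l with
        | zero =>
          simp only [Finset.range_zero, Finset.sum_empty, zero_mul, Finset.sum_const_zero,
            pow_zero, one_mul, zero_add]
          rfl
        | succ l ih =>
          have h1 := (hcn l (x l) (hx l)).1
          have h2 : ϖ ^ l * x l = ∑ j, ϖ ^ l * c l (x l) j * g j + ϖ ^ (l + 1) * x (l + 1) := by
            conv_lhs => rw [h1]
            rw [mul_add, Finset.mul_sum, pow_succ, mul_assoc (ϖ ^ l)]
            simp only [mul_assoc]
            rfl
          rw [ih, h2, ← add_assoc, ← Finset.sum_add_distrib]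
          congr 1
          exact Finset.sum_congr rfl fun j _ => by rw [Finset.sum_range_succ, add_mul]
      have ht0 : t = ∑ j, s j * g j := by
        rw [← sub_eq_zero]
        refine h.separated _ fun l => ?_
        choose u hu using fun j => hs j l
        refine ⟨x l - ∑ j, u j * g j, ?_⟩
        have h1 : ∀ j, s j = ∑ i ∈ Finset.range l, ϖ ^ i * c i (x i) j + ϖ ^ l * u j := fun j => by
          rw [← hu]
          abel
        conv_lhs => rw [hsum l]
        simp only [h1, add_mul, Finset.sum_add_distrib]
        rw [mul_sub, Finset.mul_sum]
        simp only [mul_assoc]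
        abel
      rw [ht0]
      exact sum_mem fun j _ => Submodule.smul_mem _ (s j) (Submodule.subset_span
        (Finset.mem_coe.mpr (Finset.mem_image_of_mem g (Finset.mem_univ j))))
  have : ∀ l ≤ k, (h.colon I (k - l)).FG := by
    intro l
    induction l with
    | zero => exact fun _ => hbase
    | succ l ih =>
      intro hl
      refine hstep _ ?_
      rw [show k - (l + 1) + 1 = k - l by omega]
      exact ih (by omega)
  have h0 := this k le_rfl
  rw [Nat.sub_self] at h0
  have h1 : h.colon I 0 = I := by
    ext t
    rw [h.mem_colon, pow_zero, one_mul]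
  rwa [h1] at h0

end IsPiComplete

end PiComplete

/-! ### Projective dimension of torsion-free modules and of their reductions. -/

section ProjectiveDimensionLifting

/-- Nakayama's lemma for the cokernel of ρ. -/
theorem surjective_of_sub_mem_smul {T : Type*} [Ring T] {ϖ : T} (hϖ : ϖ ∈ Ring.jacobson T)
    {N : Type*} [AddCommGroup N] [Module T N] [Module.Finite T N] (ρ : N →ₗ[T] N)
    (h : ∀ n, ∃ n', ρ n - n = ϖ • n') : Function.Surjective ρ := by
  rw [← LinearMap.range_eq_top, ← Submodule.Quotient.subsingleton_iff]
  have h1 : (⊤ : Submodule T (N ⧸ LinearMap.range ρ)) ≤ Ring.jacobson T • ⊤ := by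
    intro x _
    obtain ⟨n, rfl⟩ := Submodule.mkQ_surjective _ x
    obtain ⟨n', hn'⟩ := h n
    have h2 : (LinearMap.range ρ).mkQ n = ϖ • (LinearMap.range ρ).mkQ (-n') := by
      rw [← map_smul, smul_neg, ← hn', neg_sub, map_sub, eq_comm, sub_eq_self]
      exact (Submodule.Quotient.mk_eq_zero _).mpr ⟨n, rfl⟩
    rw [h2]
    exact Submodule.smul_mem_smul hϖ trivial
  have h2 := Submodule.FG.eq_bot_of_le_jacobson_smul Module.Finite.fg_top h1
  exact (Submodule.subsingleton_iff T).mp (subsingleton_of_bot_eq_top h2.symm)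

theorem ext_eq_zero_of_projective {C : Type*} [Category C] [Abelian C] [HasExt.{u} C] {P : C}
    [Projective P] {N : C} {i : ℕ} (hi : 0 < i) (e : Abelian.Ext.{u} P N i) : e = 0 := by
  obtain ⟨j, rfl⟩ := Nat.exists_eq_succ_of_ne_zero hi.ne'
  exact Abelian.Ext.eq_zero_of_projective e

theorem KillsEnd.of_projective {C : Type*} [Category C] [Abelian C] [HasExt.{u} C] {P : C}
    [Projective P] (φ : P ⟶ P) (d : ℕ) : KillsEnd φ d := fun _ _ hi _ =>
  ext_eq_zero_of_projective (Nat.zero_lt_of_lt hi) _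

/-- Precomposition with the retraction extends every class from A to B, so the connecting map is
zero. -/
theorem KillsEnd.of_retraction {R : Type u} [Ring R] {A B C : ModuleCat.{u} R} {a : A ⟶ B}
    {b : B ⟶ C} {w : a ≫ b = 0} (hX : (ShortComplex.mk a b w).ShortExact) [Projective B]
    (r : B ⟶ A) (hr : a ≫ r = 𝟙 A) : KillsEnd.{u + 1, u} (𝟙 C) 0 := by
  intro N i hi e
  obtain ⟨j, rfl⟩ : ∃ j, i = 1 + j := ⟨i - 1, by omega⟩
  obtain ⟨δ, hδ, -, -, hδ'⟩ := exists_connecting hX N j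
  obtain ⟨y, rfl⟩ := hδ' e (ext_eq_zero_of_projective hi _)
  rw [extPre_id]
  have h1 := hδ (extPre r y)
  rwa [extPre_extPre, hr, extPre_id] at h1

/-- The short exact sequence defined by generators of a module. -/
def presentationShort {R : Type u} [Ring R] {k : ℕ} (M : ModuleCat.{u} R) (g : Fin k → M) :
    ShortComplex (ModuleCat.{u} R) :=
  ShortComplex.mk (X₁ := ModuleCat.of R (LinearMap.ker (Fintype.linearCombination R g)))
    (X₂ := ModuleCat.of R (Fin k → R)) (X₃ := M)
    (ModuleCat.ofHom (LinearMap.ker (Fintype.linearCombination R g)).subtype)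
    (ModuleCat.ofHom (Fintype.linearCombination R g))
    (ModuleCat.hom_ext (LinearMap.ext fun x => x.2))

theorem presentationShort_shortExact {R : Type u} [Ring R] {k : ℕ} (M : ModuleCat.{u} R)
    (g : Fin k → M) (hg : Submodule.span R (Set.range g) = ⊤) :
    (presentationShort M g).ShortExact :=
  shortExact_of_exact (X := presentationShort M g) (Submodule.injective_subtype _)
    (fun y => ⟨fun hy => ⟨⟨y, hy⟩, rfl⟩, fun ⟨x, hx⟩ => hx ▸ x.2⟩)
    (LinearMap.range_eq_top.mp ((Fintype.range_linearCombination R g).trans hg))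

instance {R : Type u} [Ring R] {k : ℕ} (M : ModuleCat.{u} R) (g : Fin k → M) :
    Projective (presentationShort M g).X₂ :=
  (IsProjective.iff_projective (R := R) (Fin k → R)).mp inferInstance

instance projective_of_pi {R : Type u} [Ring R] (k : ℕ) :
    Projective (ModuleCat.of R (Fin k → R)) :=
  (IsProjective.iff_projective _).mp inferInstance

/-- Torsion-freeness makes the kernel N of a free presentation reduce to the kernel N' of the
reduced presentation, and N is again torsion-free. Dimension shifting leaves d = 0, where a
splitting modulo ϖ is lifted. -/
theorem IsPiComplete.killsEnd_id {T W : Type u} [Ring T] [Ring W] {ϖ : T} {q : T →+* W}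
    (h : IsPiComplete ϖ q) [IsNoetherianRing W] (d : ℕ) (M : ModuleCat.{u} T) [Module.Finite T M]
    (M' : ModuleCat.{u} W) (p : M →+ M') (hp : ∀ (t : T) (m : M), p (t • m) = q t • p m)
    (hsurj : Function.Surjective p) (hker : ∀ m, p m = 0 → ∃ m' : M, m = ϖ • m')
    (htf : ∀ m : M, ϖ • m = 0 → m = 0) (hd : KillsEnd.{u + 1, u} (𝟙 M') d) :
    KillsEnd.{u + 1, u} (𝟙 M) d := by
  have hT := h.isNoetherianRing
  have hqϖ : q ϖ = 0 := (h.ker ϖ).mpr ⟨1, (mul_one ϖ).symm⟩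
  induction d using Nat.strongRecOn generalizing M M' with
  | _ d ih =>
    obtain ⟨k, g, hg⟩ := Submodule.fg_iff_exists_fin_generating_family.mp
      (Module.Finite.fg_top (R := T) (M := M))
    have hX := presentationShort_shortExact M g hg
    let g' : Fin k → M' := fun i => p (g i)
    have hg' : Submodule.span W (Set.range g') = ⊤ := by
      rw [eq_top_iff]
      intro y _
      obtain ⟨x, rfl⟩ := hsurj y
      have hx : x ∈ Submodule.span T (Set.range g) := hg ▸ Submodule.mem_top
      obtain ⟨c, rfl⟩ := (Submodule.mem_span_range_iff_exists_fun T).mp hx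
      rw [map_sum]
      refine sum_mem fun i _ => ?_
      rw [hp]
      exact Submodule.smul_mem _ _ (Submodule.subset_span ⟨i, rfl⟩)
    have hX' := presentationShort_shortExact M' g' hg'
    let Φ : (Fin k → T) →ₗ[T] M := Fintype.linearCombination T g
    let Φ' : (Fin k → W) →ₗ[W] M' := Fintype.linearCombination W g'
    have hΦ : ∀ v, Φ' (fun i => q (v i)) = p (Φ v) := by
      intro v
      simp only [Φ, Φ', Fintype.linearCombination_apply, map_sum, hp]
      rfl
    let N := LinearMap.ker Φ
    let N' := LinearMap.ker Φ'
    let pN : N →+ N' := AddMonoidHom.mk'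
      (fun v => ⟨fun i => q (v.1 i), by rw [LinearMap.mem_ker, hΦ, v.2, map_zero]⟩)
      (fun v w => Subtype.ext (funext fun i => map_add q _ _))
    have hpN : ∀ (t : T) (v : N), pN (t • v) = q t • pN v := fun t v =>
      Subtype.ext (funext fun i => map_mul q _ _)
    have hpker : ∀ v, pN v = 0 → ∃ w : N, v = ϖ • w := by
      intro v hv
      have h1 : ∀ i, q (v.1 i) = 0 := fun i => congrFun (congrArg Subtype.val hv) i
      choose w hw using fun i => (h.ker _).mp (h1 i)
      have h2 : v.1 = ϖ • w := funext hw
      have h3 : Φ w = 0 := htf _ (by rw [← map_smul, ← h2, v.2])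
      exact ⟨⟨w, h3⟩, Subtype.ext h2⟩
    have hpsurj : Function.Surjective pN := by
      rintro ⟨y, hy⟩
      choose v hv using fun i => h.surj (y i)
      have h1 : p (Φ v) = 0 := by
        rw [← hΦ, show (fun i => q (v i)) = y from funext hv]
        exact hy
      obtain ⟨m', hm'⟩ := hker _ h1
      obtain ⟨w, hw⟩ : ∃ w, Φ w = m' :=
        LinearMap.range_eq_top.mp ((Fintype.range_linearCombination T g).trans hg) m'
      refine ⟨⟨v - ϖ • w, ?_⟩, Subtype.ext (funext fun i => ?_)⟩
      · rw [LinearMap.mem_ker, map_sub, map_smul, hw, hm', sub_self]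
      · change q (v i - ϖ * w i) = y i
        rw [map_sub, map_mul, hqϖ, zero_mul, sub_zero, hv]
    have hNtf : ∀ v : N, ϖ • v = 0 → v = 0 := fun v hv => Subtype.ext (funext fun i =>
      h.regular _ (congrFun (congrArg Subtype.val hv) i))
    rcases d with - | d
    · obtain ⟨s, hs⟩ := hd.exists_lift hX'
      let σ : M' →ₗ[W] (Fin k → W) := s.hom
      have hs' : ∀ y, Φ' (σ y) = y := fun y =>
        LinearMap.congr_fun (congrArg ModuleCat.Hom.hom hs) y
      let r' : (Fin k → W) →ₗ[W] N' := LinearMap.codRestrict N' (LinearMap.id - σ ∘ₗ Φ')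
        (fun y => by
          rw [LinearMap.mem_ker, LinearMap.sub_apply, map_sub, LinearMap.comp_apply, hs']
          exact sub_self _)
      -- Lifting the values on the basis lifts the retraction r' to a map r, which is a retraction
      -- only modulo ϖ.
      choose v hv using fun i => hpsurj (r' (Pi.single i 1))
      let r : (Fin k → T) →ₗ[T] N := Fintype.linearCombination T v
      have hr : ∀ x, pN (r x) = r' (fun i => q (x i)) := by
        intro x
        have h1 : (fun i => q (x i)) = ∑ i, q (x i) • (Pi.single i 1 : Fin k → W) := by
          rw [← pi_eq_sum_univ' (fun i => q (x i))]
        rw [h1, map_sum]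
        simp only [r, Fintype.linearCombination_apply, map_sum, hpN, hv, map_smul]
      let ρ : N →ₗ[T] N := r ∘ₗ N.subtype
      have hρ : ∀ n, ∃ n', ρ n - n = ϖ • n' := by
        intro n
        refine hpker _ ?_
        rw [map_sub, sub_eq_zero]
        change pN (r n.1) = _
        rw [hr]
        refine Subtype.ext ?_
        change (fun i => q (n.1 i)) - σ (Φ' (fun i => q (n.1 i))) = fun i => q (n.1 i)
        rw [hΦ, n.2, map_zero, map_zero, sub_zero]
      -- Since ρ is the identity modulo ϖ it is surjective, and then bijective because N is
      -- Noetherian; its inverse corrects r to a true retraction.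
      have hρs := surjective_of_sub_mem_smul h.mem_jacobson ρ hρ
      let e : N ≃ₗ[T] N := LinearEquiv.ofBijective ρ
        ⟨IsNoetherian.injective_of_surjective_endomorphism ρ hρs, hρs⟩
      refine KillsEnd.of_retraction hX (ModuleCat.ofHom (e.symm.toLinearMap ∘ₗ r)) ?_
      exact ModuleCat.hom_ext (LinearMap.ext fun n => e.symm_apply_apply n)
    · have h1 := KillsEnd.left hX' (𝟙 _) hd
      have h2 := ih d (Nat.lt_succ_self d) (ModuleCat.of T N) (ModuleCat.of W N') pN hpN hpsurj hpker hNtf h1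
      have h3 := KillsEnd.right hX (𝟙 _) (𝟙 _) h2 (KillsEnd.of_projective _ _)
      rw [← Category.id_comp (𝟙 M)]
      exact h3

end ProjectiveDimensionLifting

/-! ### Inverting the uniformizer. -/

section Localization

variable {R S : Type u} [Ring R] [Ring S]

/-- `S` is the localization of `R` at a regular element `ϖ` in the sense that every element of `S`
becomes integral after multiplication with a power of `ϖ`. -/
structure IsLocalizationAt (f : R →+* S) (ϖ : R) : Prop where
  injective : Function.Injective f
  isUnit : IsUnit (f ϖ)
  surj : ∀ s, ∃ k r, f ϖ ^ k * s = f r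

namespace IsLocalizationAt

variable {f : R →+* S} {ϖ : R} (h : IsLocalizationAt f ϖ)

include h

theorem exists_common {m : ℕ} (s : Fin m → S) : ∃ k, ∃ r : Fin m → R, ∀ i, f ϖ ^ k * s i = f (r i) := by
  choose k r hr using fun i => h.surj (s i)
  refine ⟨Finset.univ.sup k, fun i => ϖ ^ (Finset.univ.sup k - k i) * r i, fun i => ?_⟩
  rw [map_mul, ← hr, map_pow, ← mul_assoc, ← pow_add,
    Nat.sub_add_cancel (Finset.le_sup (Finset.mem_univ i))]

/-- A solution becomes integral after multiplication by a power of ϖ, and that single integral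
vector already gives the required combination. -/
theorem vflat : VFlat f := by
  intro m p s r hs
  obtain ⟨k, t, ht⟩ := h.exists_common s
  obtain ⟨v, hv⟩ := h.isUnit.pow k
  refine ⟨1, fun _ => ↑v⁻¹, fun _ => t, fun i => ?_, fun _ x => h.injective ?_⟩
  · rw [Fin.sum_univ_one, ← ht, ← hv, Units.inv_mul_cancel_left]
  · rw [map_sum, map_zero]
    simp only [map_mul, ← ht, mul_assoc]
    rw [← Finset.mul_sum, hs, mul_zero]

theorem exists_smul_eq_bcTmul {M : ModuleCat.{u} R} (z : baseChange f M) :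
    ∃ k, ∃ m : M, f ϖ ^ k • z = bcTmul f M 1 m := by
  refine bc_induction f z ⟨0, 0, by simp⟩ (fun s m => ?_) ?_
  · obtain ⟨k, r, hr⟩ := h.surj s
    exact ⟨k, r • m, by rw [smul_bcTmul, hr, bcTmul_smul, one_mul]⟩
  · rintro x y ⟨k, m, hm⟩ ⟨l, m', hm'⟩
    refine ⟨k + l, ϖ ^ l • m + ϖ ^ k • m', ?_⟩
    rw [smul_add, map_add, bcTmul_smul, bcTmul_smul, one_mul, one_mul]
    congr 1
    · rw [add_comm k l, pow_add, mul_smul, hm, smul_bcTmul, mul_one, ← map_pow f]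
    · rw [pow_add, mul_smul, hm', smul_bcTmul, mul_one, ← map_pow f]

theorem bijective_bcLift {M : ModuleCat.{u} R} {N : ModuleCat.{u} S} (g : M →+ N)
    (hg : ∀ (r : R) (m : M), g (r • m) = f r • g m) (hinj : Function.Injective g)
    (hsurj : ∀ n : N, ∃ k, ∃ m : M, f ϖ ^ k • n = g m) :
    Function.Bijective (bcLift f g hg).hom := by
  constructor
  · rw [injective_iff_map_eq_zero]
    intro z hz
    obtain ⟨k, m, hm⟩ := h.exists_smul_eq_bcTmul z
    obtain ⟨v, hv⟩ := h.isUnit.pow k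
    have h1 : g m = 0 := by
      have := congrArg (bcLift f g hg).hom hm
      rw [map_smul, hz, smul_zero, bcLift_tmul, one_smul] at this
      exact this.symm
    have h2 : m = 0 := hinj (h1.trans (map_zero g).symm)
    rw [h2, map_zero, ← hv] at hm
    rw [← one_smul S z, ← Units.inv_mul v, mul_smul, hm, smul_zero]
  · intro n
    obtain ⟨k, m, hm⟩ := hsurj n
    obtain ⟨v, hv⟩ := h.isUnit.pow k
    refine ⟨bcTmul f M ↑v⁻¹ m, ?_⟩
    rw [bcLift_tmul, ← hm, ← hv, smul_smul, Units.inv_mul, one_smul]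

end IsLocalizationAt

theorem KillsEnd.id_of_iso {C : Type*} [Category C] [Abelian C] [HasExt.{u} C] {M N : C}
    (e : M ≅ N) {d : ℕ} (h : KillsEnd (𝟙 M) d) : KillsEnd (𝟙 N) d := by
  intro L i hi y
  have h1 := h L i hi (extPre e.hom y)
  rw [extPre_id] at h1
  rw [← e.inv_hom_id, ← extPre_extPre, h1, extPre_zero]

theorem IsLocalizationAt.killsEnd_id {f : R →+* S} {ϖ : R} (h : IsLocalizationAt f ϖ)
    {M : ModuleCat.{u} R} {N : ModuleCat.{u} S} (g : M →+ N)
    (hg : ∀ (r : R) (m : M), g (r • m) = f r • g m) (hinj : Function.Injective g)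
    (hsurj : ∀ n : N, ∃ k, ∃ m : M, f ϖ ^ k • n = g m) {d : ℕ}
    (hd : KillsEnd.{u + 1, u} (𝟙 M) d) : KillsEnd.{u + 1, u} (𝟙 N) d := by
  have h1 := hd.baseChange h.vflat.isFlat
  rw [bcMap_id] at h1
  exact h1.id_of_iso (LinearEquiv.ofBijective (bcLift f g hg).hom
    (h.bijective_bcLift g hg hinj hsurj)).toModuleIso

/-- In `IsWeyl.genDim_dRing` with all ∂ᵢ adjoined and s empty, the annihilator is a nonzero
constant, hence invertible, so the identity itself is killed. -/
theorem CoordSystem.IsWeyl.killsEnd_id {W : Type u} [Ring W] [Nontrivial W] {n : ℕ}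
    {C : CoordSystem (Fin n ⊕ Fin n) W} (hC : C.IsWeyl) (M : ModuleCat.{u} W)
    [hM : Module.Finite W M] : KillsEnd.{u + 1, u} (𝟙 M) n := by
  have htop : C.dRing Finset.univ = ⊤ := eq_top_iff.mpr fun _ _ =>
    C.mem_ring.mpr fun k hk => absurd (by rcases k with k | k <;> simp) hk
  let B := C.dRing Finset.univ
  have hB : ∀ w, w ∈ B := fun w => htop.ge trivial
  let M₀ : ModuleCat.{u} B := (ModuleCat.restrictScalars B.subtype).obj M
  -- The tower ends with the top subring, not with W itself; localization at 1 carries the statement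
  -- across this isomorphism.
  have hloc : IsLocalizationAt B.subtype 1 :=
    ⟨Subtype.val_injective, by simp, fun s => ⟨0, ⟨s, hB s⟩, by simp⟩⟩
  have hfin : Module.Finite B M₀ := by
    obtain ⟨s, hs⟩ := hM
    refine ⟨⟨s, ?_⟩⟩
    rw [eq_top_iff]
    intro m _
    have hm : (show M from m) ∈ Submodule.span W (s : Set M) := hs ▸ Submodule.mem_top
    refine Submodule.span_induction (p := fun (x : M) _ => (show M₀ from x) ∈ Submodule.span B (s : Set M))
      (fun x hx => Submodule.subset_span hx) (zero_mem _) (fun x y _ _ hx hy => add_mem hx hy)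
      (fun w x _ hx => Submodule.smul_mem _ (⟨w, hB w⟩ : B) hx) hm
  obtain ⟨c, ⟨hc0, hcs⟩, hcc, hk⟩ := hC.genDim_dRing Finset.univ ∅ (Finset.disjoint_empty_left _) M₀ hfin
  rw [Finset.card_empty, Nat.sub_zero] at hk
  obtain ⟨v, hv⟩ := hC.isUnit c.1 hcs hc0
  have hinv : KillsEnd.{u + 1, u} (𝟙 M₀) n := by
    let c' : B := ⟨↑v⁻¹, hB _⟩
    have hcc' : c * c' = 1 := Subtype.ext (by change c.1 * ↑v⁻¹ = 1; rw [← hv, Units.mul_inv])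
    have hc'c : ∀ r, Commute c' r := fun r => Subtype.ext
      (show Commute (v : W) r.1 from hv ▸ congrArg Subtype.val (hcc r).eq).units_inv_left.eq
    intro N i hi e
    have h1 : 𝟙 M₀ = cMul c' hc'c M₀ ≫ cMul c hcc M₀ :=
      ModuleCat.hom_ext (LinearMap.ext fun m => by
        change m = c • c' • m
        rw [smul_smul, hcc', one_smul])
    rw [h1, ← extPre_extPre, hk N i hi, extPre_zero]
  refine hloc.killsEnd_id (M := M₀) (N := M) (AddMonoidHom.mk' (fun m => m) fun _ _ => rfl)
    (fun _ _ => rfl) (fun _ _ h => h) (fun m => ⟨0, m, ?_⟩) hinv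
  rw [pow_zero, one_smul]
  rfl

end Localization

/-! ### Global dimension from cyclic modules. -/

section Baer

variable {S : Type u} [Ring S]

/-- A map from a left ideal extends to the ring because its obstruction lies in Ext¹ of the cyclic
quotient; this is Baer's criterion. -/
theorem injective_of_ext_one {N : ModuleCat.{u} S}
    (h : ∀ I : Ideal S, ∀ e : Abelian.Ext.{u} (ModuleCat.of S (S ⧸ I)) N 1, e = 0) :
    Injective N := by
  have hb : Module.Baer S N := by
    intro I g
    let X : ShortComplex (ModuleCat.{u} S) := ShortComplex.mk (ModuleCat.ofHom I.subtype)
      (ModuleCat.ofHom (Submodule.mkQ I)) (ModuleCat.hom_ext (LinearMap.ext fun x =>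
        (Submodule.Quotient.mk_eq_zero I).mpr x.2))
    have hX : X.ShortExact := shortExact_of_exact (X := X) (Submodule.injective_subtype _)
      (LinearMap.exact_subtype_mkQ I) (Submodule.mkQ_surjective I)
    obtain ⟨e, he⟩ := exists_extPre_of_extDelta hX
      (Abelian.Ext.mk₀ (ModuleCat.ofHom g : X.X₁ ⟶ N)) (h I _)
    obtain ⟨g', rfl⟩ := (Abelian.Ext.addEquiv₀ (X := X.X₂) (Y := N)).symm.surjective e
    have h1 : X.f ≫ g' = ModuleCat.ofHom g := by
      refine (Abelian.Ext.addEquiv₀ (X := X.X₁) (Y := N)).symm.injective ?_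
      rw [← (show _ = Abelian.Ext.addEquiv₀.symm (ModuleCat.ofHom g : X.X₁ ⟶ N) from he)]
      simp [extPre]
    exact ⟨g'.hom, fun x hx => LinearMap.congr_fun (congrArg ModuleCat.Hom.hom h1) ⟨x, hx⟩⟩
  have := hb.injective
  exact Module.injective_object_of_injective_module S N

/-- Embedding N into an injective and passing to the cokernel lowers the degree until Baer's
criterion applies. -/
theorem ext_eq_zero_of_cyclic (d : ℕ) (N : ModuleCat.{u} S)
    (h : ∀ I : Ideal S, ∀ e : Abelian.Ext.{u} (ModuleCat.of S (S ⧸ I)) N (d + 1), e = 0)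
    (M : ModuleCat.{u} S) (e : Abelian.Ext.{u} M N (d + 1)) : e = 0 := by
  induction d generalizing N with
  | zero =>
    have := injective_of_ext_one h
    exact Abelian.Ext.eq_zero_of_injective e
  | succ d ih =>
    obtain ⟨p⟩ := EnoughInjectives.presentation N
    have hX : (ShortComplex.mk _ _ (Limits.cokernel.condition p.f)).ShortExact :=
      { exact := ShortComplex.exact_cokernel p.f }
    have h1 := ih (Limits.cokernel p.f) (fun I y => by
      obtain ⟨z, hz⟩ := Abelian.Ext.covariant_sequence_exact₃ _ hX y (rfl : d + 1 + 1 = _) (h I _)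
      rw [← hz, Abelian.Ext.eq_zero_of_injective z, Abelian.Ext.zero_comp])
    obtain ⟨x, rfl⟩ := Abelian.Ext.covariant_sequence_exact₁ M hX e
      (Abelian.Ext.eq_zero_of_injective _) (rfl : d + 1 + 1 = _)
    rw [h1 x, Abelian.Ext.zero_comp]

theorem globalDim_le_of_cyclic {d : ℕ}
    (h : ∀ I : Ideal S, KillsEnd.{u + 1, u} (𝟙 (ModuleCat.of S (S ⧸ I))) d) :
    globalDim S ≤ d := by
  refine iSup_le fun M => (projectiveDimension_le_iff M d).mpr ?_
  refine hasProjectiveDimensionLT_of_enoughInjectives.{u} M (d + 1) fun N =>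
    ⟨fun a b => ?_⟩
  have key := ext_eq_zero_of_cyclic d N (fun I e => by
    rw [← extPre_id e]
    exact h I N (d + 1) (Nat.lt_succ_self d) e) M
  rw [key a, key b]

/-- S/I is the localization of the lattice T/(I ∩ T), which is ϖ-torsion-free since ϖ is a unit in
S; its reduction is W modulo the image of I ∩ T. -/
theorem IsPiComplete.globalDim_le {T W : Type u} [Ring T] [Ring W] {ϖ : T} {q : T →+* W}
    (h : IsPiComplete ϖ q) [IsNoetherianRing W] {f : T →+* S} (hf : IsLocalizationAt f ϖ)
    {d : ℕ}
    (hd : ∀ M : ModuleCat.{u} W, Module.Finite W M → KillsEnd.{u + 1, u} (𝟙 M) d) :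
    globalDim S ≤ d := by
  refine globalDim_le_of_cyclic fun I => ?_
  let I₀ : Ideal T := I.comap f
  let I' : Ideal W := h.image I₀
  let qₗ : T →ₛₗ[q] W := q.toSemilinearMap
  let p : (T ⧸ I₀) →ₛₗ[q] (W ⧸ I') := Submodule.mapQ I₀ I' qₗ fun x hx => ⟨x, hx, rfl⟩
  have h1 := h.killsEnd_id d (ModuleCat.of T (T ⧸ I₀)) (ModuleCat.of W (W ⧸ I')) p.toAddMonoidHom
    (fun t m => p.map_smulₛₗ t m) (fun y => by
      obtain ⟨w, rfl⟩ := Submodule.mkQ_surjective I' y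
      obtain ⟨t, rfl⟩ := h.surj w
      exact ⟨Submodule.mkQ I₀ t, rfl⟩) (fun m hm => by
      obtain ⟨t, rfl⟩ := Submodule.mkQ_surjective I₀ m
      obtain ⟨t₀, ht₀, ht⟩ := (Submodule.Quotient.mk_eq_zero I').mp (show Submodule.mkQ I' (q t) = 0 from hm)
      obtain ⟨t', ht'⟩ := (h.ker (t - t₀)).mp (by rw [map_sub, ht, sub_self])
      refine ⟨Submodule.mkQ I₀ t', ?_⟩
      have h2 : Submodule.mkQ I₀ t = ϖ • Submodule.mkQ I₀ t' := by
        rw [← map_smul, smul_eq_mul, ← ht', map_sub, eq_comm, sub_eq_self]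
        exact (Submodule.Quotient.mk_eq_zero I₀).mpr ht₀
      exact h2) (fun m hm => by
      obtain ⟨t, rfl⟩ := Submodule.mkQ_surjective I₀ m
      have h2 : ϖ * t ∈ I₀ := (Submodule.Quotient.mk_eq_zero I₀).mp hm
      refine (Submodule.Quotient.mk_eq_zero I₀).mpr ?_
      obtain ⟨v, hv⟩ := hf.isUnit
      change f t ∈ I
      have h3 : f t = ↑v⁻¹ * f (ϖ * t) := by rw [map_mul, ← hv, Units.inv_mul_cancel_left]
      rw [h3]
      exact I.mul_mem_left _ h2) (hd _ (inferInstanceAs (Module.Finite W (W ⧸ I'))))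
  let g : (T ⧸ I₀) →ₛₗ[f] (S ⧸ I) := Submodule.mapQ I₀ I f.toSemilinearMap fun x hx => hx
  refine hf.killsEnd_id (M := ModuleCat.of T (T ⧸ I₀)) (N := ModuleCat.of S (S ⧸ I))
    g.toAddMonoidHom (fun r m => g.map_smulₛₗ r m) ?_ ?_ h1
  · change Function.Injective g
    rw [injective_iff_map_eq_zero]
    intro m hm
    obtain ⟨t, rfl⟩ := Submodule.mkQ_surjective I₀ m
    exact (Submodule.Quotient.mk_eq_zero I₀).mpr ((Submodule.Quotient.mk_eq_zero I).mp hm)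
  · intro y
    obtain ⟨s, rfl⟩ := Submodule.mkQ_surjective I y
    obtain ⟨k, t, ht⟩ := hf.surj s
    refine ⟨k, Submodule.mkQ I₀ t, ?_⟩
    change f ϖ ^ k • Submodule.mkQ I s = Submodule.mkQ I (f t)
    rw [← map_smul, smul_eq_mul, ht]

end Baer

/-! ## Flatness of completions -/

section CompletionFlat

theorem IsPiComplete.op {T W : Type*} [Ring T] [Ring W] {ϖ : T} {q : T →+* W}
    (h : IsPiComplete ϖ q) : IsPiComplete (MulOpposite.op ϖ) q.op where
  central t := MulOpposite.unop_injective (h.central t.unop).eq.symm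
  regular t ht := MulOpposite.unop_injective (h.regular _
    ((h.central _).eq.trans (congrArg MulOpposite.unop ht)))
  surj w := by
    obtain ⟨t, ht⟩ := h.surj w.unop
    exact ⟨MulOpposite.op t, MulOpposite.unop_injective ht⟩
  ker t := by
    constructor
    · intro ht
      obtain ⟨t', ht'⟩ := (h.ker t.unop).mp (congrArg MulOpposite.unop ht)
      exact ⟨MulOpposite.op t', MulOpposite.unop_injective (ht'.trans (h.central t').eq)⟩
    · rintro ⟨t', rfl⟩
      exact MulOpposite.unop_injective ((h.ker _).mpr ⟨t'.unop, (h.central t'.unop).eq.symm⟩)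
  separated t ht := MulOpposite.unop_injective (h.separated _ fun k => by
    obtain ⟨u, hu⟩ := ht k
    exact ⟨u.unop, by rw [hu, (h.pow_central k _).eq]; rfl⟩)
  complete t := by
    obtain ⟨s, hs⟩ := h.complete fun i => (t i).unop
    refine ⟨MulOpposite.op s, fun k => ?_⟩
    obtain ⟨u, hu⟩ := hs k
    refine ⟨MulOpposite.op u, MulOpposite.unop_injective ?_⟩
    rw [MulOpposite.unop_sub, MulOpposite.unop_mul, Finset.unop_sum]
    simp only [MulOpposite.unop_mul, MulOpposite.unop_pow, MulOpposite.unop_op] at hu ⊢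
    rw [← (h.pow_central k u).eq, ← hu]
    congr 1
    exact Finset.sum_congr rfl fun i _ => (h.pow_central i _).eq.symm

/-- `j : A → T` has dense image, and the `ϖ`-adic topology of `A` is induced from `T`. -/
structure IsPiDense {A T : Type*} [Ring A] [Ring T] (j : A →+* T) (ϖ : A) : Prop where
  central : ∀ a, Commute ϖ a
  dense : ∀ t, ∃ a t', t = j a + j ϖ * t'
  strict : ∀ a t, j a = j ϖ * t → ∃ a', a = ϖ * a'

theorem IsPiDense.op {A T : Type*} [Ring A] [Ring T] {j : A →+* T} {ϖ : A} (h : IsPiDense j ϖ)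
    (hT : ∀ t, Commute (j ϖ) t) : IsPiDense j.op (MulOpposite.op ϖ) where
  central a := MulOpposite.unop_injective (h.central a.unop).eq.symm
  dense t := by
    obtain ⟨a, t', h'⟩ := h.dense t.unop
    refine ⟨MulOpposite.op a, MulOpposite.op t', MulOpposite.unop_injective ?_⟩
    rw [h', (hT t').eq]
    rfl
  strict a t hat := by
    obtain ⟨a', ha'⟩ := h.strict a.unop t.unop ((congrArg MulOpposite.unop hat).trans (hT _).eq.symm)
    exact ⟨MulOpposite.op a', MulOpposite.unop_injective (ha'.trans (h.central a').eq)⟩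

variable {A T W : Type*} [Ring A] [Ring T] [Ring W] {j : A →+* T} {ϖ : A} {q : T →+* W}

theorem IsPiDense.dense_pow (h : IsPiDense j ϖ) (t : T) (k : ℕ) :
    ∃ a t', t = j a + j ϖ ^ k * t' := by
  induction k with
  | zero => exact ⟨0, t, by simp⟩
  | succ k ih =>
    obtain ⟨a, t', rfl⟩ := ih
    obtain ⟨a', t'', rfl⟩ := h.dense t'
    refine ⟨a + ϖ ^ k * a', t'', ?_⟩
    rw [map_add, map_mul, map_pow, pow_succ, mul_add, mul_assoc, add_assoc]

/-- Strictness is applied once per factor of ϖ; regularity in T identifies the quotients. -/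
theorem IsPiDense.strict_pow (h : IsPiDense j ϖ) (hT : IsPiComplete (j ϖ) q) (k : ℕ) {a : A} {t : T}
    (hat : j a = j ϖ ^ k * t) : ∃ a', a = ϖ ^ k * a' ∧ j a' = t := by
  induction k generalizing t with
  | zero => exact ⟨a, by simp, by simpa using hat⟩
  | succ k ih =>
    rw [pow_succ, mul_assoc] at hat
    obtain ⟨a', rfl, ha'⟩ := ih hat
    obtain ⟨a'', rfl⟩ := h.strict a' t ha'
    refine ⟨a'', by rw [pow_succ, mul_assoc], ?_⟩
    rw [← sub_eq_zero]
    refine hT.regular _ ?_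
    rw [mul_sub, ← ha', map_mul, sub_self]

/-- A bounded version of the Artin–Rees lemma. -/
theorem exists_pow_smul_mem [IsNoetherianRing A] (hϖ : ∀ a, Commute ϖ a) {p : ℕ}
    (L : Submodule A (Fin p → A)) :
    ∃ c, ∀ k, ∀ v : Fin p → A, ϖ ^ k • v ∈ L → ϖ ^ c • v ∈ L := by
  have hpow : ∀ k (a : A), ϖ ^ k * a = a * ϖ ^ k := fun k a => ((hϖ a).pow_left k).eq
  let S : ℕ → Submodule A (Fin p → A) := fun k =>
    { carrier := {v | ϖ ^ k • v ∈ L}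
      zero_mem' := by simp
      add_mem' := fun {a b} ha hb => by
        change ϖ ^ k • (a + b) ∈ L
        rw [smul_add]
        exact add_mem ha hb
      smul_mem' := fun a v hv => by
        change ϖ ^ k • a • v ∈ L
        rw [smul_smul, hpow, mul_smul]
        exact L.smul_mem a hv }
  -- The ϖ-power torsion of the quotient by L is the union of an increasing chain, so one exponent
  -- bounds it.
  obtain ⟨c, hc⟩ := monotone_stabilizes_iff_noetherian.mpr
    (inferInstance : IsNoetherian A (Fin p → A))
    ⟨S, monotone_nat_of_le_succ fun k v hv => by
      change ϖ ^ (k + 1) • v ∈ L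
      rw [pow_succ', mul_smul]
      exact L.smul_mem ϖ hv⟩
  refine ⟨c, fun k v hv => ?_⟩
  have h1 : v ∈ S (max c k) := by
    change ϖ ^ max c k • v ∈ L
    rw [show max c k = (max c k - k) + k by omega, pow_add, mul_smul]
    exact L.smul_mem _ hv
  exact (hc (max c k) (le_max_left c k)).ge h1

/-- Flatness of adic completion. A solution over T is, modulo ϖ, a combination of the finitely many
generators of the solutions over A, and ϖ times a new solution remains; iterating, the coefficients
converge. -/
theorem IsPiDense.vflat [IsNoetherianRing A] (h : IsPiDense j ϖ) (hT : IsPiComplete (j ϖ) q) :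
    VFlat j := by
  intro m p s r hs
  let φ : (Fin m → A) →ₗ[A] (Fin p → A) := Fintype.linearCombination A r
  have hφ : ∀ a x, φ a x = ∑ i, a i * r i x := fun a x => by
    simp [φ, Fintype.linearCombination_apply]
  obtain ⟨c, hc⟩ := exists_pow_smul_mem h.central (LinearMap.range φ)
  obtain ⟨n, u, hu⟩ := Submodule.fg_iff_exists_fin_generating_family.mp
    (IsNoetherian.noetherian (LinearMap.ker φ))
  have huK : ∀ l, φ (u l) = 0 := fun l => by
    have : u l ∈ LinearMap.ker φ := hu ▸ Submodule.subset_span ⟨l, rfl⟩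
    exact this
  have hpow : ∀ k (a : T), j ϖ ^ k * a = a * j ϖ ^ k := fun k a => (hT.pow_central k a).eq
  have step : ∀ s : Fin m → T, ∃ (b : Fin n → A) (s' : Fin m → T),
      (∀ x, ∑ i, s i * j (r i x) = 0) →
      (∀ i, s i = ∑ l, j (b l * u l i) + j ϖ * s' i) ∧ ∀ x, ∑ i, s' i * j (r i x) = 0 := by
    intro s
    by_cases hs : ∀ x, ∑ i, s i * j (r i x) = 0
    swap
    · exact ⟨0, 0, fun h => absurd h hs⟩
    -- One power more than the Artin–Rees constant: after ϖ^c is absorbed, a factor ϖ is left for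
    -- the next stage.
    choose a t hat using fun i => h.dense_pow (s i) (c + 1)
    have h1 : ∀ x, j (φ a x) = j ϖ ^ (c + 1) * -∑ i, t i * j (r i x) := by
      intro x
      have h2 := hs x
      simp only [hat, add_mul, Finset.sum_add_distrib, mul_assoc] at h2
      rw [← Finset.mul_sum] at h2
      rw [hφ, map_sum]
      simp only [map_mul]
      rw [mul_neg]
      exact eq_neg_of_add_eq_zero_left h2
    choose v hv _ using fun x => h.strict_pow hT (c + 1) (h1 x)
    have h2 : φ a = ϖ ^ (c + 1) • v := funext hv
    -- Here φ a' = ϖ^c v, so a - ϖa' is an exact solution over A congruent to s modulo ϖ.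
    obtain ⟨a', ha'⟩ := hc (c + 1) v (h2 ▸ ⟨a, rfl⟩)
    have h3 : a - ϖ • a' ∈ LinearMap.ker φ := by
      rw [LinearMap.mem_ker, map_sub, map_smul, ha', h2, pow_succ', mul_smul, sub_self]
    rw [← hu] at h3
    obtain ⟨b, hb⟩ := (Submodule.mem_span_range_iff_exists_fun A).mp h3
    have h4 : ∀ i, s i = ∑ l, j (b l * u l i) + j ϖ * (j (a' i) + j ϖ ^ c * t i) := by
      intro i
      have h5 : ∑ l, b l * u l i = a i - ϖ * a' i := by
        have := congrFun hb i
        simpa using this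
      rw [← map_sum, h5, map_sub, map_mul, hat i, pow_succ', mul_add, mul_assoc]
      abel
    refine ⟨b, fun i => j (a' i) + j ϖ ^ c * t i, fun _ => ⟨h4, fun x => hT.regular _ ?_⟩⟩
    have h6 := hs x
    rw [Finset.sum_congr rfl fun i _ => by rw [h4 i]] at h6
    simp only [add_mul, Finset.sum_add_distrib, mul_assoc] at h6
    have h7 : ∑ i, (∑ l, j (b l * u l i)) * j (r i x) = 0 := by
      have h8 : φ (∑ l, b l • u l) = 0 := by
        rw [map_sum]
        exact Finset.sum_eq_zero fun l _ => by rw [map_smul, huK, smul_zero]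
      have h9 := congrArg j (congrFun h8 x)
      rw [hφ, map_sum, Pi.zero_apply, map_zero] at h9
      rw [← h9]
      exact Finset.sum_congr rfl fun i _ => by simp [map_sum]
    rw [h7, zero_add] at h6
    rw [Finset.mul_sum]
    simpa only [add_mul, Finset.sum_add_distrib, mul_add, mul_assoc, Finset.mul_sum] using h6
  choose b nx hb using step
  let σ : ℕ → Fin m → T := fun k => Nat.rec s (fun _ x => nx x) k
  have hσ : ∀ k x, ∑ i, σ k i * j (r i x) = 0 := fun k => by
    induction k with
    | zero => exact hs
    | succ k ih => exact (hb (σ k) ih).2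
  choose t ht using fun l => hT.complete fun k => j (b (σ k) l)
  refine ⟨n, t, u, fun i => ?_, fun l x => ?_⟩
  · have key : ∀ k, s i = ∑ l, (∑ e ∈ Finset.range k, j ϖ ^ e * j (b (σ e) l)) * j (u l i) +
        j ϖ ^ k * σ k i := by
      intro k
      induction k with
      | zero => simp [σ]
      | succ k ih =>
        have h1 := (hb (σ k) (hσ k)).1 i
        have h2 : j ϖ ^ k * σ k i = ∑ l, j ϖ ^ k * j (b (σ k) l) * j (u l i) +
            j ϖ ^ (k + 1) * σ (k + 1) i := by
          conv_lhs => rw [h1]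
          rw [mul_add, Finset.mul_sum, pow_succ, mul_assoc (j ϖ ^ k)]
          simp only [mul_assoc, map_mul]
          rfl
        rw [ih, h2, ← add_assoc, ← Finset.sum_add_distrib]
        congr 1
        exact Finset.sum_congr rfl fun l _ => by rw [Finset.sum_range_succ, add_mul]
    rw [← sub_eq_zero]
    refine hT.separated _ fun k => ?_
    choose w hw using fun l => ht l k
    refine ⟨σ k i - ∑ l, w l * j (u l i), ?_⟩
    have h1 : ∀ l, t l = ∑ e ∈ Finset.range k, j ϖ ^ e * j (b (σ e) l) + j ϖ ^ k * w l := fun l => by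
      rw [← hw]
      abel
    conv_lhs => rw [key k]
    simp only [h1, add_mul, Finset.sum_add_distrib]
    rw [mul_sub, Finset.mul_sum]
    simp only [mul_assoc]
    abel
  · rw [← hφ, huK, Pi.zero_apply]

/-- Powers of ϖ clear the denominators of both the system and its solution; they are central and
invertible, hence can be divided out again. -/
theorem IsLocalizationAt.vflat_of_square {A D T E : Type u} [Ring A] [Ring D] [Ring T] [Ring E]
    {i : A →+* D} {ϖ : A} (hi : IsLocalizationAt i ϖ) {f : D →+* E} {j : A →+* T} {k : T →+* E}
    (hk : IsLocalizationAt k (j ϖ)) (hcomm : ∀ a, f (i a) = k (j a))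
    (hcD : ∀ d, Commute (i ϖ) d) (hcE : ∀ e, Commute (k (j ϖ)) e) (hj : VFlat j) : VFlat f := by
  intro m p s r hs
  obtain ⟨c, t, ht⟩ := hk.exists_common s
  obtain ⟨d, a, ha⟩ := hi.exists_common (fun l : Fin (m * p) =>
    r (finProdFinEquiv.symm l).1 (finProdFinEquiv.symm l).2)
  let b : Fin m → Fin p → A := fun i x => a (finProdFinEquiv (i, x))
  have hb : ∀ l x, i ϖ ^ d * r l x = i (b l x) := fun l x => by
    have := ha (finProdFinEquiv (l, x))
    rwa [Equiv.symm_apply_apply] at this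
  have hcE' : ∀ n e, k (j ϖ) ^ n * e = e * k (j ϖ) ^ n := fun n e => ((hcE e).pow_left n).eq
  have hcD' : ∀ n e, i ϖ ^ n * e = e * i ϖ ^ n := fun n e => ((hcD e).pow_left n).eq
  obtain ⟨q, t', u, h1, h2⟩ := hj m p t b (fun x => hk.injective (by
    rw [map_sum, map_zero]
    have h3 : ∀ l, k (t l * j (b l x)) = k (j ϖ) ^ c * k (j ϖ) ^ d * (s l * f (r l x)) := by
      intro l
      rw [map_mul, ← ht, ← hcomm (b l x), ← hb, map_mul, map_pow, hcomm, mul_assoc, mul_assoc,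
        ← mul_assoc (s l), ← hcE' d (s l), mul_assoc]
    rw [Finset.sum_congr rfl fun l _ => h3 l, ← Finset.mul_sum, hs, mul_zero]))
  obtain ⟨v, hv⟩ := hk.isUnit.pow c
  obtain ⟨w, hw⟩ := hi.isUnit.pow d
  refine ⟨q, fun l => ↑v⁻¹ * k (t' l), fun l x => i (u l x), fun l => ?_, fun l x => ?_⟩
  · rw [← Units.inv_mul_cancel_left v (s l), hv, ht, h1, map_sum, Finset.mul_sum]
    exact Finset.sum_congr rfl fun e _ => by rw [map_mul, ← hcomm, mul_assoc]
  · have h3 : i ϖ ^ d * ∑ y, i (u l y) * r y x = 0 := by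
      rw [Finset.mul_sum]
      have h4 : ∀ y, i ϖ ^ d * (i (u l y) * r y x) = i (u l y * b y x) := fun y => by
        rw [← mul_assoc, hcD', mul_assoc, hb, map_mul]
      rw [Finset.sum_congr rfl fun y _ => h4 y, ← map_sum, h2, map_zero]
    rw [← hw] at h3
    exact (Units.mul_right_eq_zero w).mp h3

end CompletionFlat

/-! ## Unit balls of discretely normed algebras -/

section UnitBall

/-- The unit ball of an ultrametric normed ring. -/
def unitBall (E : Type u) [NormedRing E] [NormOneClass E] [IsUltrametricDist E] : Subring E where
  carrier := {e | ‖e‖ ≤ 1}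
  one_mem' := norm_one.le
  zero_mem' := by simp
  mul_mem' ha hb := (norm_mul_le _ _).trans (mul_le_one₀ ha (norm_nonneg _) hb)
  add_mem' ha hb := (IsUltrametricDist.norm_add_le_max _ _).trans (max_le ha hb)
  neg_mem' ha := by
    change ‖-_‖ ≤ 1
    rwa [norm_neg]

/-- The ideal of elements of norm `< 1` of the unit ball. -/
def openIdeal (E : Type u) [NormedRing E] [NormOneClass E] [IsUltrametricDist E] :
    Ideal (unitBall E) where
  carrier := {e | ‖e.1‖ < 1}
  zero_mem' := by simp
  add_mem' ha hb := (IsUltrametricDist.norm_add_le_max _ _).trans_lt (max_lt ha hb)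
  smul_mem' a b hb := (norm_mul_le _ _).trans_lt
    ((mul_le_of_le_one_left (norm_nonneg _) a.2).trans_lt hb)

instance (E : Type u) [NormedRing E] [NormOneClass E] [IsUltrametricDist E] :
    (openIdeal E).IsTwoSided where
  mul_mem_of_left b ha := (norm_mul_le _ _).trans_lt
    ((mul_le_of_le_one_right (norm_nonneg _) b.2).trans_lt ha)

/-- The residue ring of an ultrametric normed ring. -/
abbrev residueRing (E : Type u) [NormedRing E] [NormOneClass E] [IsUltrametricDist E] : Type u :=
  unitBall E ⧸ openIdeal E

instance (E : Type u) [NormedRing E] [NormOneClass E] [IsUltrametricDist E] :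
    Nontrivial (residueRing E) :=
  Ideal.Quotient.nontrivial_iff.mpr fun h => by
    have h1 : (1 : unitBall E) ∈ openIdeal E := h ▸ Submodule.mem_top
    exact absurd (show ‖(1 : E)‖ < 1 from h1) (by simp)

variable {K : Type u} [NontriviallyNormedField K] {ϖ : K} (h0 : ϖ ≠ 0) (h1 : ‖ϖ‖ < 1)
variable {D E : Type u} [NormedRing D] [NormOneClass D] [IsUltrametricDist D] [NormedAlgebra K D]
  [NormedRing E] [NormOneClass E] [IsUltrametricDist E] [NormedAlgebra K E]

/-- A scalar of norm at most one as an element of the unit ball. -/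
def scalarBall (E : Type u) [NormedRing E] [NormOneClass E] [IsUltrametricDist E] [NormedAlgebra K E]
    (h1 : ‖ϖ‖ < 1) : unitBall E :=
  ⟨algebraMap K E ϖ, by
    change ‖algebraMap K E ϖ‖ ≤ 1
    rw [norm_algebraMap']
    exact h1.le⟩

theorem scalarBall_pow_mul (k : ℕ) (t : unitBall E) :
    ((scalarBall E h1 ^ k * t : unitBall E) : E) = ϖ ^ k • (t : E) := by
  rw [Algebra.smul_def, map_pow]
  rfl

theorem norm_scalarBall_pow_mul (k : ℕ) (t : unitBall E) :
    ‖((scalarBall E h1 ^ k * t : unitBall E) : E)‖ = ‖ϖ‖ ^ k * ‖(t : E)‖ := by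
  rw [scalarBall_pow_mul, norm_smul, norm_pow]

include h0 in
theorem exists_eq_scalarBall_pow_mul (k : ℕ) (t : unitBall E) (ht : ‖(t : E)‖ ≤ ‖ϖ‖ ^ k) :
    ∃ t', t = scalarBall E h1 ^ k * t' := by
  have hk : 0 < ‖ϖ‖ ^ k := pow_pos (norm_pos_iff.mpr h0) k
  refine ⟨⟨(ϖ ^ k)⁻¹ • (t : E), ?_⟩, Subtype.ext ?_⟩
  · change ‖(ϖ ^ k)⁻¹ • (t : E)‖ ≤ 1
    rw [norm_smul, norm_inv, norm_pow]
    exact (inv_mul_le_one₀ hk).mpr ht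
  · rw [scalarBall_pow_mul]
    exact (smul_inv_smul₀ (pow_ne_zero k h0) _).symm

theorem scalarBall_central (t : unitBall E) : Commute (scalarBall E h1) t :=
  Subtype.ext (Algebra.commutes ϖ (t : E))

include h0 in
theorem isLocalizationAt_unitBall : IsLocalizationAt (unitBall E).subtype (scalarBall E h1) where
  injective := Subtype.val_injective
  isUnit := (IsUnit.mk0 ϖ h0).map (algebraMap K E)
  surj e := by
    obtain ⟨k, hk⟩ : ∃ k, ‖ϖ‖ ^ k * ‖e‖ < 1 := by
      have := (tendsto_pow_atTop_nhds_zero_of_lt_one (norm_nonneg ϖ) h1).mul_const ‖e‖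
      rw [zero_mul] at this
      exact (this.eventually_lt_const zero_lt_one).exists
    have h2 : algebraMap K E ϖ ^ k * e = ϖ ^ k • e := by rw [Algebra.smul_def, map_pow]
    refine ⟨k, ⟨algebraMap K E ϖ ^ k * e, ?_⟩, rfl⟩
    change ‖algebraMap K E ϖ ^ k * e‖ ≤ 1
    rw [h2, norm_smul, norm_pow]
    exact hk.le

include h0 in
-- By discreteness, norm below 1 means divisible by ϖ, so the reduction is the quotient modulo ϖ;
-- completeness of E makes ϖ-adic series converge.
theorem isPiComplete_unitBall [CompleteSpace E] (hdisc : ∀ e : E, ‖e‖ < 1 → ‖e‖ ≤ ‖ϖ‖) :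
    IsPiComplete (scalarBall E h1) (Ideal.Quotient.mk (openIdeal E)) where
  central := scalarBall_central h1
  regular t ht := by
    have h2 := norm_scalarBall_pow_mul h1 1 t
    rw [pow_one, ht] at h2
    have h3 : ‖ϖ‖ ^ 1 * ‖(t : E)‖ = 0 := by rw [← h2]; simp
    refine Subtype.ext (norm_eq_zero.mp ?_)
    exact (mul_eq_zero.mp h3).resolve_left (by simpa using h0)
  surj := Ideal.Quotient.mk_surjective
  ker t := by
    rw [Ideal.Quotient.eq_zero_iff_mem]
    constructor
    · intro ht
      have := exists_eq_scalarBall_pow_mul h0 h1 1 t (by rw [pow_one]; exact hdisc _ ht)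
      simpa using this
    · rintro ⟨t', rfl⟩
      have h2 := norm_scalarBall_pow_mul h1 1 t'
      rw [pow_one, pow_one] at h2
      exact h2.trans_lt ((mul_le_of_le_one_right (norm_nonneg _) t'.2).trans_lt h1)
  separated t ht := by
    have h2 : ∀ k, ‖(t : E)‖ ≤ ‖ϖ‖ ^ k := fun k => by
      obtain ⟨u, rfl⟩ := ht k
      rw [norm_scalarBall_pow_mul]
      exact mul_le_of_le_one_right (pow_nonneg (norm_nonneg _) _) u.2
    exact Subtype.ext (norm_le_zero_iff.mp (ge_of_tendsto'
      (tendsto_pow_atTop_nhds_zero_of_lt_one (norm_nonneg ϖ) h1) h2))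
  complete t := by
    have hsum : ∀ l, Summable fun i => ϖ ^ i • (t (i + l) : E) := fun l =>
      Summable.of_norm_bounded (summable_geometric_of_lt_one (norm_nonneg ϖ) h1) fun i => by
        rw [norm_smul, norm_pow]
        exact mul_le_of_le_one_right (pow_nonneg (norm_nonneg _) _) (t (i + l)).2
    have hmem : ∀ l, ∑' i, ϖ ^ i • (t (i + l) : E) ∈ unitBall E := fun l => by
      have hcl : IsClosed ((unitBall E : Subring E) : Set E) :=
        isClosed_le continuous_norm continuous_const
      refine hcl.mem_of_tendsto (hsum l).hasSum (Eventually.of_forall fun s => ?_)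
      refine sum_mem fun i _ => ?_
      change ‖_‖ ≤ 1
      rw [norm_smul, norm_pow]
      exact mul_le_one₀ (pow_le_one₀ (norm_nonneg _) h1.le) (norm_nonneg _) (t (i + l)).2
    refine ⟨⟨_, hmem 0⟩, fun k => ⟨⟨_, hmem k⟩, Subtype.ext ?_⟩⟩
    rw [scalarBall_pow_mul]
    change ∑' i, ϖ ^ i • (t (i + 0) : E) - ((∑ i ∈ Finset.range k, scalarBall E h1 ^ i * t i :
      unitBall E) : E) = ϖ ^ k • ∑' i, ϖ ^ i • (t (i + k) : E)
    rw [AddSubmonoidClass.coe_finsetSum, ← (hsum 0).sum_add_tsum_nat_add k]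
    simp only [scalarBall_pow_mul, add_zero, add_sub_cancel_left]
    rw [← (hsum k).tsum_const_smul]
    exact tsum_congr fun i => by rw [smul_smul, ← pow_add, add_comm k i]

/-- The map on unit balls induced by a norm-preserving ring homomorphism. -/
def unitBallMap (f : D →+* E) (hf : ∀ d, ‖f d‖ = ‖d‖) : unitBall D →+* unitBall E :=
  (f.comp (unitBall D).subtype).codRestrict (unitBall E) fun d => (hf d.1).trans_le d.2

variable {f : D →+* E} (hf : ∀ d, ‖f d‖ = ‖d‖) (hfϖ : f (algebraMap K D ϖ) = algebraMap K E ϖ)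

include hfϖ in
theorem unitBallMap_scalarBall : unitBallMap f hf (scalarBall D h1) = scalarBall E h1 :=
  Subtype.ext hfϖ

include h0 hfϖ in
-- An approximation closer than |ϖ| has norm at most 1 itself, and the error is divisible by ϖ in
-- the unit ball. Strictness holds because f preserves norms.
theorem isPiDense_unitBallMap (hd : DenseRange f) : IsPiDense (unitBallMap f hf) (scalarBall D h1) where
  central := scalarBall_central h1
  dense t := by
    obtain ⟨d, hd⟩ := hd.exists_dist_lt (t : E) (norm_pos_iff.mpr h0)
    rw [dist_eq_norm] at hd
    have hd1 : ‖d‖ ≤ 1 := by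
      rw [← hf, show f d = (t : E) + -((t : E) - f d) by abel]
      refine (IsUltrametricDist.norm_add_le_max _ _).trans (max_le t.2 ?_)
      rw [norm_neg]
      exact hd.le.trans h1.le
    obtain ⟨t', ht'⟩ := exists_eq_scalarBall_pow_mul h0 h1 1
      (t - unitBallMap f hf ⟨d, hd1⟩) (by rw [pow_one]; exact hd.le)
    refine ⟨⟨d, hd1⟩, t', ?_⟩
    rw [unitBallMap_scalarBall h1 hf hfϖ, ← pow_one (scalarBall E h1), ← ht']
    abel
  strict a t hat := by
    rw [unitBallMap_scalarBall h1 hf hfϖ] at hat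
    have h2 := norm_scalarBall_pow_mul h1 1 t
    rw [pow_one, ← hat] at h2
    have h3 : ‖(a : D)‖ = ‖ϖ‖ ^ 1 * ‖(t : E)‖ := (hf a.1).symm.trans h2
    have := exists_eq_scalarBall_pow_mul h0 h1 1 a
      (h3.trans_le (mul_le_of_le_one_right (pow_nonneg (norm_nonneg _) _) t.2))
    simpa using this

theorem IsLocalizationAt.op {R S : Type u} [Ring R] [Ring S] {f : R →+* S} {ϖ : R}
    (h : IsLocalizationAt f ϖ) (hc : ∀ s, Commute (f ϖ) s) :
    IsLocalizationAt f.op (MulOpposite.op ϖ) where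
  injective a b hab := MulOpposite.unop_injective (h.injective (MulOpposite.op_injective hab))
  isUnit := h.isUnit.op
  surj s := by
    obtain ⟨k, r, hr⟩ := h.surj s.unop
    refine ⟨k, MulOpposite.op r, MulOpposite.unop_injective ?_⟩
    refine Eq.trans ?_ hr
    exact ((hc s.unop).pow_left k).eq.symm

include h0 h1 hf hfϖ in
theorem vflat_of_dense [CompleteSpace E] (hdisc : ∀ e : E, ‖e‖ < 1 → ‖e‖ ≤ ‖ϖ‖) (hd : DenseRange f)
    [IsNoetherianRing (unitBall D)] : VFlat f := by
  have hT := isPiComplete_unitBall h0 h1 hdisc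
  have hE := isLocalizationAt_unitBall (E := E) h0 h1
  rw [← unitBallMap_scalarBall h1 hf hfϖ] at hT hE
  refine (isLocalizationAt_unitBall (E := D) h0 h1).vflat_of_square hE (fun _ => rfl)
    (fun d => Algebra.commutes ϖ d) (fun e => ?_) ((isPiDense_unitBallMap h0 h1 hf hfϖ hd).vflat hT)
  rw [unitBallMap_scalarBall h1 hf hfϖ]
  exact Algebra.commutes ϖ e

include h0 h1 hf hfϖ in
theorem vflat_op_of_dense [CompleteSpace E] (hdisc : ∀ e : E, ‖e‖ < 1 → ‖e‖ ≤ ‖ϖ‖)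
    (hd : DenseRange f) [IsNoetherianRing (unitBall D)ᵐᵒᵖ] : VFlat f.op := by
  have hT := isPiComplete_unitBall h0 h1 hdisc
  have hE := isLocalizationAt_unitBall (E := E) h0 h1
  rw [← unitBallMap_scalarBall h1 hf hfϖ] at hT hE
  have hcE : ∀ e : E, Commute ((unitBall E).subtype (unitBallMap f hf (scalarBall D h1))) e :=
    fun e => by
      rw [unitBallMap_scalarBall h1 hf hfϖ]
      exact Algebra.commutes ϖ e
  refine ((isLocalizationAt_unitBall (E := D) h0 h1).op fun d =>
    Algebra.commutes ϖ d).vflat_of_square (j := (unitBallMap f hf).op) (hE.op hcE) (fun _ => rfl)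
    (fun d => MulOpposite.unop_injective (Algebra.commutes ϖ d.unop).symm)
    (fun e => MulOpposite.unop_injective (hcE e.unop).eq.symm)
    (((isPiDense_unitBallMap h0 h1 hf hfϖ hd).op hT.central).vflat hT.op)

end UnitBall

/-! ## The Tate algebra -/

noncomputable section TateNorm

variable {K : Type u} [NontriviallyNormedField K] [IsUltrametricDist K]

/-- An irreducible element of the valuation ring generates the maximal ideal, which consists of the
elements of norm below 1. -/
theorem exists_uniformizer
    [IsDiscreteValuationRing (NormedField.valuation (K := K)).valuationSubring] :
    ∃ ϖ : K, ϖ ≠ 0 ∧ ‖ϖ‖ < 1 ∧ ∀ a : K, ‖a‖ < 1 → ‖a‖ ≤ ‖ϖ‖ := by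
  obtain ⟨p, hp⟩ := IsDiscreteValuationRing.exists_irreducible
    (NormedField.valuation (K := K)).valuationSubring
  have hmem : ∀ a : K, a ∈ (NormedField.valuation (K := K)).valuationSubring ↔ ‖a‖ ≤ 1 := fun a => by
    rw [Valuation.mem_valuationSubring_iff]
    exact Iff.rfl
  have hunit : ∀ a : (NormedField.valuation (K := K)).valuationSubring, ‖(a : K)‖ < 1 → ¬ IsUnit a := by
    rintro a ha ⟨v, rfl⟩
    have h1 : (v : (NormedField.valuation (K := K)).valuationSubring).1 * (↑v⁻¹ : _).1 = 1 :=
      congrArg Subtype.val (Units.mul_inv v)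
    have h2 := congrArg norm h1
    rw [norm_mul, norm_one] at h2
    have h3 := (hmem _).mp (↑v⁻¹ : (NormedField.valuation (K := K)).valuationSubring).2
    have h4 := mul_lt_one_of_nonneg_of_lt_one_left (norm_nonneg _) ha h3
    exact absurd h2 h4.ne
  refine ⟨p.1, fun h => hp.ne_zero (Subtype.ext h), ?_, fun a ha => ?_⟩
  · refine lt_of_le_of_ne ((hmem _).mp p.2) fun h => hp.not_isUnit ?_
    have hinv : (p.1)⁻¹ ∈ (NormedField.valuation (K := K)).valuationSubring := by
      rw [hmem, norm_inv, h, inv_one]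
    have h0 : p.1 ≠ 0 := fun h => hp.ne_zero (Subtype.ext h)
    exact .of_mul_eq_one ⟨_, hinv⟩ (Subtype.ext (mul_inv_cancel₀ h0))
  · have h1 : (⟨a, (hmem a).mpr ha.le⟩ : (NormedField.valuation (K := K)).valuationSubring) ∈
        IsLocalRing.maximalIdeal _ := hunit _ ha
    rw [hp.maximalIdeal_eq, Ideal.mem_span_singleton'] at h1
    obtain ⟨b, hb⟩ := h1
    have h2 : a = b.1 * p.1 := (congrArg Subtype.val hb).symm
    rw [h2, norm_mul]
    exact mul_le_of_le_one_left (norm_nonneg _) ((hmem _).mp b.2)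

/-- A nonzero natural number survives in the residue field, hence is a unit of the valuation ring.
-/
theorem norm_natCast_eq_one
    [CharZero (IsLocalRing.ResidueField (NormedField.valuation (K := K)).valuationSubring)]
    {m : ℕ} (hm : m ≠ 0) : ‖(m : K)‖ = 1 := by
  have h1 : (m : IsLocalRing.ResidueField (NormedField.valuation (K := K)).valuationSubring) ≠ 0 :=
    Nat.cast_ne_zero.mpr hm
  rw [← map_natCast (IsLocalRing.residue _), Ne, IsLocalRing.residue_eq_zero_iff,
    IsLocalRing.mem_maximalIdeal, mem_nonunits_iff, not_not] at h1
  obtain ⟨v, hv⟩ := h1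
  have hmem : ∀ a : K, a ∈ (NormedField.valuation (K := K)).valuationSubring → ‖a‖ ≤ 1 := fun a ha =>
    (Valuation.mem_valuationSubring_iff _ _).mp ha
  have h2 : (v : (NormedField.valuation (K := K)).valuationSubring).1 * (↑v⁻¹ : _).1 = 1 :=
    congrArg Subtype.val (Units.mul_inv v)
  have h3 : (v : (NormedField.valuation (K := K)).valuationSubring).1 = (m : K) :=
    congrArg Subtype.val hv
  refine le_antisymm (IsUltrametricDist.norm_natCast_le_one K m) ?_
  have h4 := congrArg norm h2
  rw [h3, norm_mul, norm_one] at h4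
  rw [← h4]
  exact mul_le_of_le_one_right (norm_nonneg _) (hmem _ (Subtype.mem _))

variable {n : ℕ}

theorem norm_tate_le {f : TateAlgebra K n} {c : ℝ} (hc : 0 ≤ c)
    (h : ∀ t, ‖MvPowerSeries.coeff t f.1‖ ≤ c) : ‖f‖ ≤ c := by
  rw [norm_tate_def]
  exact Real.iSup_le h hc

instance : IsUltrametricDist (TateAlgebra K n) :=
  IsUltrametricDist.isUltrametricDist_of_forall_norm_add_le_max_norm fun f g => by
    refine norm_tate_le (le_max_of_le_left (norm_nonneg _)) fun t => ?_
    change ‖MvPowerSeries.coeff t (f.1 + g.1)‖ ≤ _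
    rw [map_add]
    exact (IsUltrametricDist.norm_add_le_max _ _).trans
      (max_le_max (norm_coeff_le f t) (norm_coeff_le g t))

theorem norm_coeff_lt_of_notMem {f : TateAlgebra K n} {ε : ℝ} (hε : 0 < ε) :
    ∃ s : Finset (Fin n →₀ ℕ), ∀ t ∉ s, ‖MvPowerSeries.coeff t f.1‖ < ε := by
  have h := (mem_tateSubalgebra_iff.mp f.2).eventually_lt_const hε
  rw [Filter.eventually_cofinite] at h
  exact ⟨h.toFinset, fun t ht => not_not.mp fun h' => ht (h.mem_toFinset.mpr h')⟩

/-- Only finitely many coefficients have norm at least ‖f‖/2, so the supremum is a maximum. In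
particular the Gauss norm takes values in the norms of K. -/
theorem exists_norm_coeff_eq (f : TateAlgebra K n) : ∃ t, ‖MvPowerSeries.coeff t f.1‖ = ‖f‖ := by
  by_cases hf : f = 0
  · exact ⟨0, by simp [hf]⟩
  obtain ⟨s, hs⟩ := norm_coeff_lt_of_notMem (f := f) (half_pos (norm_pos_iff.mpr hf))
  have hne : s.Nonempty := by
    by_contra hs0
    rw [Finset.not_nonempty_iff_eq_empty] at hs0
    have := norm_tate_le (f := f) (half_pos (norm_pos_iff.mpr hf)).le fun t => (hs t (by simp [hs0])).le
    linarith [half_lt_self (norm_pos_iff.mpr hf)]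
  obtain ⟨t, _, ht'⟩ := s.exists_max_image (fun t => ‖MvPowerSeries.coeff t f.1‖) hne
  refine ⟨t, le_antisymm (norm_coeff_le f t) ?_⟩
  have h1 : ‖f‖ ≤ max (‖MvPowerSeries.coeff t f.1‖) (‖f‖ / 2) := by
    refine norm_tate_le (le_max_of_le_left (norm_nonneg _)) fun t' => ?_
    by_cases h : t' ∈ s
    · exact le_max_of_le_left (ht' t' h)
    · exact le_max_of_le_right (hs t' h).le
  rcases le_max_iff.mp h1 with h | h
  · exact h
  · linarith [half_lt_self (norm_pos_iff.mpr hf)]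

theorem norm_tate_discrete {ϖ : K} (hdisc : ∀ a : K, ‖a‖ < 1 → ‖a‖ ≤ ‖ϖ‖) (f : TateAlgebra K n)
    (hf : ‖f‖ < 1) : ‖f‖ ≤ ‖ϖ‖ := by
  obtain ⟨t, ht⟩ := exists_norm_coeff_eq f
  rw [← ht] at hf ⊢
  exact hdisc _ hf

/-- The monomial `x^t` in the Tate algebra. -/
def tateMonomial (t : Fin n →₀ ℕ) : TateAlgebra K n :=
  ⟨MvPowerSeries.monomial t 1, by
    classical
    rw [mem_tateSubalgebra_iff]
    refine tendsto_const_nhds.congr' ?_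
    rw [EventuallyEq, Filter.eventually_cofinite]
    refine (Set.finite_singleton t).subset fun t' ht' => ?_
    by_contra h
    refine ht' ?_
    rw [MvPowerSeries.coeff_monomial, if_neg (show ¬ t' = t from h), norm_zero]⟩

theorem coeff_tateMonomial (t t' : Fin n →₀ ℕ) [Decidable (t' = t)] :
    MvPowerSeries.coeff t' (tateMonomial (K := K) t).1 = if t' = t then 1 else 0 := by
  classical
  refine (MvPowerSeries.coeff_monomial t' t (1 : K)).trans ?_
  congr

theorem tateMonomial_zero : tateMonomial (K := K) (n := n) 0 = 1 :=
  Subtype.ext MvPowerSeries.monomial_zero_one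

theorem tateMonomial_add (t t' : Fin n →₀ ℕ) :
    tateMonomial (K := K) (t + t') = tateMonomial t * tateMonomial t' :=
  Subtype.ext ((MvPowerSeries.monomial_mul_monomial t t' (1 : K) 1).trans (by rw [one_mul]; rfl)).symm

theorem norm_tateMonomial (t : Fin n →₀ ℕ) : ‖tateMonomial (K := K) t‖ = 1 := by
  classical
  refine le_antisymm (norm_tate_le zero_le_one fun t' => ?_) ?_
  · rw [coeff_tateMonomial]
    split_ifs <;> simp
  · have := norm_coeff_le (tateMonomial (K := K) t) t
    rwa [coeff_tateMonomial, if_pos rfl, norm_one] at this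

instance : NormOneClass (TateAlgebra K n) := ⟨by rw [← tateMonomial_zero, norm_tateMonomial]⟩

/-- Polynomials are dense in the Tate algebra. -/
theorem exists_norm_sub_sum_le (f : TateAlgebra K n) {ε : ℝ} (hε : 0 < ε) :
    ∃ s : Finset (Fin n →₀ ℕ),
      ‖f - ∑ t ∈ s, MvPowerSeries.coeff t f.1 • tateMonomial t‖ ≤ ε := by
  classical
  obtain ⟨s, hs⟩ := norm_coeff_lt_of_notMem (f := f) hε
  refine ⟨s, norm_tate_le hε.le fun t => ?_⟩
  have h1 : MvPowerSeries.coeff t (f - ∑ t ∈ s, MvPowerSeries.coeff t f.1 • tateMonomial t).1 =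
      if t ∈ s then 0 else MvPowerSeries.coeff t f.1 := by
    have h2 : (f - ∑ t ∈ s, MvPowerSeries.coeff t f.1 • tateMonomial t).1 =
        f.1 - ∑ t ∈ s, MvPowerSeries.coeff t f.1 • (tateMonomial (K := K) t).1 := by
      simp
    rw [h2, map_sub, map_sum]
    simp only [map_smul, coeff_tateMonomial, smul_eq_mul, mul_ite, mul_one, mul_zero,
      Finset.sum_ite_eq]
    split_ifs <;> simp
  rw [h1]
  split_ifs with h
  · rw [norm_zero]
    exact hε.le
  · exact (hs t h).le

instance [CompleteSpace K] : CompleteSpace (TateAlgebra K n) := by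
  refine Metric.complete_of_cauchySeq_tendsto fun v hv => ?_
  have hle : ∀ t k l, dist (MvPowerSeries.coeff t (v k).1) (MvPowerSeries.coeff t (v l).1) ≤
      dist (v k) (v l) := fun t k l => by
    rw [dist_eq_norm, dist_eq_norm, ← map_sub]
    exact norm_coeff_le (v k - v l) t
  have hc : ∀ t, ∃ c, Tendsto (fun k => MvPowerSeries.coeff t (v k).1) atTop (𝓝 c) := fun t =>
    cauchySeq_tendsto_of_complete (Metric.cauchySeq_iff'.mpr fun ε hε => by
      obtain ⟨N, hN⟩ := Metric.cauchySeq_iff'.mp hv ε hε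
      exact ⟨N, fun k hk => (hle t k N).trans_lt (hN k hk)⟩)
  choose c hc using hc
  have hunif : ∀ ε > 0, ∃ N, ∀ k ≥ N, ∀ t, ‖MvPowerSeries.coeff t (v k).1 - c t‖ ≤ ε := by
    intro ε hε
    obtain ⟨N, hN⟩ := Metric.cauchySeq_iff.mp hv ε hε
    refine ⟨N, fun k hk t => ?_⟩
    refine le_of_tendsto ((hc t).const_sub _).norm ?_
    filter_upwards [eventually_ge_atTop N] with l hl
    rw [← dist_eq_norm]
    exact (hle t k l).trans (hN k hk l hl).le
  let F : MvPowerSeries (Fin n) K := fun t => c t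
  have hmem : F ∈ tateSubalgebra K n := by
    rw [mem_tateSubalgebra_iff, Metric.tendsto_nhds]
    intro ε hε
    obtain ⟨N, hN⟩ := hunif (ε / 2) (half_pos hε)
    obtain ⟨s, hs⟩ := norm_coeff_lt_of_notMem (f := v N) (half_pos hε)
    rw [Filter.eventually_cofinite]
    refine s.finite_toSet.subset fun t ht => ?_
    by_contra h
    refine ht ?_
    change dist ‖c t‖ 0 < ε
    rw [dist_zero_right, norm_norm]
    have h1 := hN N le_rfl t
    have h2 := hs t h
    calc ‖c t‖ = ‖MvPowerSeries.coeff t (v N).1 - (MvPowerSeries.coeff t (v N).1 - c t)‖ := by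
          rw [sub_sub_cancel]
      _ ≤ ‖MvPowerSeries.coeff t (v N).1‖ + ‖MvPowerSeries.coeff t (v N).1 - c t‖ := norm_sub_le _ _
      _ < ε := by linarith
  refine ⟨⟨_, hmem⟩, Metric.tendsto_atTop.mpr fun ε hε => ?_⟩
  obtain ⟨N, hN⟩ := hunif (ε / 2) (half_pos hε)
  refine ⟨N, fun k hk => ?_⟩
  rw [dist_eq_norm]
  refine (norm_tate_le (half_pos hε).le fun t => ?_).trans_lt (half_lt_self hε)
  exact hN k hk t

end TateNorm

/-! ## Differential operators -/

noncomputable section Operators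

variable {K : Type u} [NontriviallyNormedField K] [IsUltrametricDist K] {n : ℕ}

instance {E F : Type*} [NormedAddCommGroup E] [NormedSpace K E] [NormedAddCommGroup F]
    [NormedSpace K F] [IsUltrametricDist F] : IsUltrametricDist (E →L[K] F) :=
  IsUltrametricDist.isUltrametricDist_of_forall_norm_add_le_max_norm fun S T => by
    refine ContinuousLinearMap.opNorm_le_bound _ (le_max_of_le_left (norm_nonneg _)) fun v => ?_
    rw [add_apply, max_mul_of_nonneg _ _ (norm_nonneg v)]
    exact (IsUltrametricDist.norm_add_le_max _ _).trans
      (max_le_max (S.le_opNorm v) (T.le_opNorm v))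

/-- Gauss norms are norms of scalars, so every nonzero function can be rescaled to norm 1. -/
theorem opNorm_le_of_norm_eq_one {T : TateAlgebra K n →L[K] TateAlgebra K n} {c : ℝ} (hc : 0 ≤ c)
    (h : ∀ f, ‖f‖ = 1 → ‖T f‖ ≤ c) : ‖T‖ ≤ c := by
  refine T.opNorm_le_bound hc fun f => ?_
  by_cases hf : f = 0
  · simp [hf]
  obtain ⟨t, ht⟩ := exists_norm_coeff_eq f
  have ha : ‖f‖ ≠ 0 := norm_ne_zero_iff.mpr hf
  have ha' : MvPowerSeries.coeff t f.1 ≠ 0 := fun h0 => ha (by rw [← ht, h0, norm_zero])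
  have h1 : ‖(MvPowerSeries.coeff t f.1)⁻¹ • f‖ = 1 := by
    rw [norm_smul, norm_inv, ht, inv_mul_cancel₀ ha]
  have h2 := h _ h1
  rw [map_smul, norm_smul, norm_inv, ht] at h2
  rwa [← inv_mul_le_iff₀' (lt_of_le_of_ne (norm_nonneg f) (Ne.symm ha))]

/-- Values on functions of norm 1 have norm below 1, hence at most |ϖ|, and this bound passes to the
supremum. -/
theorem opNorm_discrete {ϖ : K} (hdisc : ∀ a : K, ‖a‖ < 1 → ‖a‖ ≤ ‖ϖ‖)
    {T : TateAlgebra K n →L[K] TateAlgebra K n} (hT : ‖T‖ < 1) : ‖T‖ ≤ ‖ϖ‖ := by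
  refine opNorm_le_of_norm_eq_one (norm_nonneg _) fun f hf => norm_tate_discrete hdisc _ ?_
  have := T.le_opNorm f
  rw [hf, mul_one] at this
  exact this.trans_lt hT

instance : NormOneClass (TateAlgebra K n →L[K] TateAlgebra K n) := ⟨by
  have : Nontrivial (TateAlgebra K n) := NormOneClass.nontrivial
  exact ContinuousLinearMap.norm_id⟩

/-- The inclusion of `𝒟ₙ` into the continuous operators. -/
def opHom (K : Type u) [NontriviallyNormedField K] [IsUltrametricDist K] (n : ℕ) :
    DiffOp K n →ₐ[K] (TateAlgebra K n →L[K] TateAlgebra K n) := (diffOpSubalgebra K n).val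

theorem norm_opHom (d : DiffOp K n) : ‖opHom K n d‖ = ‖d‖ := rfl

theorem opHom_injective : Function.Injective (opHom K n) := Subtype.val_injective

theorem opHom_ext {d d' : DiffOp K n} (h : ∀ f, opHom K n d f = opHom K n d' f) : d = d' :=
  opHom_injective (ContinuousLinearMap.ext h)

instance : IsUltrametricDist (DiffOp K n) :=
  inferInstanceAs (IsUltrametricDist (Subtype _))

instance : NormOneClass (DiffOp K n) := ⟨by rw [← norm_opHom, map_one, norm_one]⟩

/-- Multiplication operators. -/
def mulOp (K : Type u) [NontriviallyNormedField K] [IsUltrametricDist K] (n : ℕ) :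
    TateAlgebra K n →+* DiffOp K n where
  toFun f := ⟨ContinuousLinearMap.mul K (TateAlgebra K n) f,
    Algebra.subset_adjoin (Or.inl ⟨f, rfl⟩)⟩
  map_one' := opHom_ext fun f => one_mul f
  map_zero' := opHom_ext fun f => zero_mul f
  map_mul' f g := opHom_ext fun h => mul_assoc f g h
  map_add' f g := opHom_ext fun h => add_mul f g h

theorem opHom_mulOp (f g : TateAlgebra K n) : opHom K n (mulOp K n f) g = f * g := rfl

theorem mulOp_algebraMap (a : K) :
    mulOp K n (algebraMap K (TateAlgebra K n) a) = algebraMap K (DiffOp K n) a :=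
  opHom_ext fun f => by
    rw [opHom_mulOp, AlgHom.commutes, ← Algebra.smul_def]
    rfl

theorem mulOp_smul (a : K) (f : TateAlgebra K n) : mulOp K n (a • f) = a • mulOp K n f := by
  rw [Algebra.smul_def, map_mul, mulOp_algebraMap, ← Algebra.smul_def]

theorem norm_mulOp (f : TateAlgebra K n) : ‖mulOp K n f‖ = ‖f‖ := by
  refine le_antisymm (ContinuousLinearMap.opNorm_mul_apply_le K (TateAlgebra K n) f) ?_
  have := (opHom K n (mulOp K n f)).le_opNorm 1
  rwa [opHom_mulOp, mul_one, norm_one, mul_one, norm_opHom] at this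

theorem norm_del_le (i : Fin n) : ‖del K i‖ ≤ 1 :=
  ContinuousLinearMap.opNorm_le_bound _ zero_le_one fun f => by
    rw [one_mul]
    exact norm_tate_le (norm_nonneg _) fun t =>
      (norm_coeff_pderiv_le i f.1 t).trans (norm_coeff_le f _)

theorem partialOp_coe (i : Fin n) (f : TateAlgebra K n) :
    (partialOp K i f).1 = MvPowerSeries.pderiv K i f.1 := rfl

theorem del_mul_mulOp (i : Fin n) (f : TateAlgebra K n) :
    del K i * mulOp K n f = mulOp K n f * del K i + mulOp K n (partialOp K i f) :=
  opHom_ext fun g => by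
    rw [map_add, map_mul, map_mul]
    change partialOp K i (f * g) = f * partialOp K i g + partialOp K i f * g
    refine Subtype.ext ?_
    change MvPowerSeries.pderiv K i (f.1 * g.1) = f.1 * MvPowerSeries.pderiv K i g.1 +
      MvPowerSeries.pderiv K i f.1 * g.1
    rw [Derivation.leibniz, smul_eq_mul, smul_eq_mul, mul_comm g.1]

theorem diffOp_induction {p : DiffOp K n → Prop} (hm : ∀ f, p (mulOp K n f)) (hd : ∀ i, p (del K i))
    (ha : ∀ d d', p d → p d' → p (d + d')) (hmul : ∀ d d', p d → p d' → p (d * d'))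
    (d : DiffOp K n) : p d := by
  refine Algebra.adjoin_induction (p := fun (x : TateAlgebra K n →L[K] TateAlgebra K n)
    (hx : x ∈ diffOpSubalgebra K n) => p (⟨x, hx⟩ : diffOpSubalgebra K n)) ?_ ?_ ?_ ?_ d.2
  · rintro x (⟨f, rfl⟩ | ⟨i, rfl⟩)
    · exact hm f
    · exact hd i
  · intro a
    have := hm (algebraMap K _ a)
    rwa [mulOp_algebraMap] at this
  · exact fun x y hx hy => ha ⟨x, hx⟩ ⟨y, hy⟩
  · exact fun x y hx hy => hmul ⟨x, hx⟩ ⟨y, hy⟩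

/-- The coordinate functions of the Tate algebra. -/
def tateX (K : Type u) [NontriviallyNormedField K] [IsUltrametricDist K] {n : ℕ} (i : Fin n) :
    TateAlgebra K n := tateMonomial (Finsupp.single i 1)

/-- The element `x_i` of `𝒟ₙ`. -/
def coordX (K : Type u) [NontriviallyNormedField K] [IsUltrametricDist K] {n : ℕ} (i : Fin n) :
    DiffOp K n := mulOp K n (tateX K i)

theorem norm_coordX (i : Fin n) : ‖coordX K i‖ = 1 := (norm_mulOp _).trans (norm_tateMonomial _)

theorem coordX_commute (i j : Fin n) : Commute (coordX K i) (coordX K j) := by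
  rw [Commute, SemiconjBy, coordX, coordX, ← map_mul, mul_comm, map_mul]

theorem partialOp_tateX (i j : Fin n) : partialOp K i (tateX K j) = if i = j then 1 else 0 := by
  refine Subtype.ext ?_
  have h1 : (partialOp K i (tateX K j)).1 = MvPowerSeries.pderiv K i (MvPowerSeries.X j) := rfl
  rw [h1]
  split_ifs with h
  · rw [h, MvPowerSeries.pderiv_X_self]
    rfl
  · rw [MvPowerSeries.pderiv_X_of_ne (Ne.symm h)]
    rfl

theorem del_mul_coordX (i j : Fin n) :
    del K i * coordX K j = coordX K j * del K i + if i = j then 1 else 0 := by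
  rw [coordX, del_mul_mulOp, partialOp_tateX]
  split_ifs <;> simp

/-- Polynomial differential operators. -/
def polyOps (K : Type u) [NontriviallyNormedField K] [IsUltrametricDist K] (n : ℕ) :
    Subalgebra K (DiffOp K n) :=
  Algebra.adjoin K (Set.range (coordX K) ∪ Set.range (del K))

theorem mulOp_tateMonomial_mem (t : Fin n →₀ ℕ) : mulOp K n (tateMonomial t) ∈ polyOps K n := by
  induction t using Finsupp.induction_linear with
  | zero =>
    rw [tateMonomial_zero, map_one]
    exact one_mem _
  | add t t' h h' =>
    rw [tateMonomial_add, map_mul]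
    exact mul_mem h h'
  | single i k =>
    induction k with
    | zero =>
      rw [Finsupp.single_zero, tateMonomial_zero, map_one]
      exact one_mem _
    | succ k ih =>
      rw [Finsupp.single_add, tateMonomial_add, map_mul]
      exact mul_mem ih (Algebra.subset_adjoin (Or.inl ⟨i, rfl⟩))

/-- Bracketing with ∂ᵢ is nilpotent on polynomial operators but not on general elements of A;
density makes the polynomial ones sufficient modulo ϖ. -/
theorem dense_polyOps (d : DiffOp K n) : d ∈ (polyOps K n).topologicalClosure := by
  refine diffOp_induction (p := fun d => d ∈ (polyOps K n).topologicalClosure) (fun f => ?_)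
    (fun i => ?_) (fun _ _ => add_mem) (fun _ _ => mul_mem) d
  · change mulOp K n f ∈ closure ((polyOps K n : Subalgebra K (DiffOp K n)) : Set (DiffOp K n))
    rw [Metric.mem_closure_iff]
    intro ε hε
    obtain ⟨s, hs⟩ := exists_norm_sub_sum_le f (half_pos hε)
    refine ⟨mulOp K n (∑ t ∈ s, MvPowerSeries.coeff t f.1 • tateMonomial t), ?_, ?_⟩
    · rw [map_sum]
      refine sum_mem fun t _ => ?_
      rw [mulOp_smul]
      exact Subalgebra.smul_mem _ (mulOp_tateMonomial_mem t) _
    · rw [dist_eq_norm, ← map_sub, norm_mulOp]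
      exact hs.trans_lt (half_lt_self hε)
  · exact Subalgebra.le_topologicalClosure _ (Algebra.subset_adjoin (Or.inr ⟨i, rfl⟩))

theorem exists_polyOps_sub_lt (d : DiffOp K n) {ε : ℝ} (hε : 0 < ε) :
    ∃ p ∈ polyOps K n, ‖d - p‖ < ε := by
  have h : d ∈ closure ((polyOps K n : Subalgebra K (DiffOp K n)) : Set (DiffOp K n)) :=
    dense_polyOps d
  obtain ⟨p, hp, hdp⟩ := Metric.mem_closure_iff.mp h ε hε
  exact ⟨p, hp, by rwa [dist_eq_norm] at hdp⟩

/-! ### Local nilpotency -/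

/-- The elements killed by a power of `[·, b]`. -/
def nilSubring {S : Type*} [Ring S] (b : S) : Subring S where
  carrier := {s | ∃ N, (adR b)^[N] s = 0}
  one_mem' := ⟨1, by simp [adR_apply]⟩
  zero_mem' := ⟨0, rfl⟩
  neg_mem' := by
    rintro s ⟨N, hN⟩
    exact ⟨N, by rw [iterate_map_neg, hN, neg_zero]⟩
  add_mem' := by
    rintro s t ⟨N, hN⟩ ⟨M, hM⟩
    refine ⟨N + M, ?_⟩
    rw [iterate_map_add, Function.iterate_add_apply _ N M t, hM, add_comm N M,
      Function.iterate_add_apply _ M N s, hN, iterate_map_zero, iterate_map_zero, add_zero]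
  mul_mem' := by
    -- The Leibniz rule, by induction on the sum of the two nilpotency orders.
    have key : ∀ L N M : ℕ, N + M = L → ∀ s t : S, (adR b)^[N] s = 0 → (adR b)^[M] t = 0 →
        (adR b)^[N + M] (s * t) = 0 := by
      intro L
      induction L with
      | zero =>
        intro N M h s t hs _
        obtain ⟨rfl, rfl⟩ : N = 0 ∧ M = 0 := by omega
        rw [show s = 0 from hs, zero_mul]
        rfl
      | succ L ih =>
        intro N M h s t hs ht
        rcases N with - | N
        · rw [show s = 0 from hs, zero_mul, iterate_map_zero]
        rcases M with - | M
        · rw [show t = 0 from ht, mul_zero, iterate_map_zero]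
        rw [show N + 1 + (M + 1) = N + M + 1 + 1 by omega, Function.iterate_succ_apply, adR_mul,
          iterate_map_add]
        have h1 := ih N (M + 1) (by omega) (adR b s) t hs ht
        have h2 := ih (N + 1) M (by omega) s (adR b t) hs ht
        rw [show N + (M + 1) = N + M + 1 by omega] at h1
        rw [show N + 1 + M = N + M + 1 by omega] at h2
        rw [h1, h2, add_zero]
    rintro s t ⟨N, hN⟩ ⟨M, hM⟩
    exact ⟨N + M, key _ N M rfl s t hN hM⟩

theorem mem_nilSubring_of_commute {S : Type*} [Ring S] {b s : S} (h : Commute s b) :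
    s ∈ nilSubring b := ⟨1, by rw [Function.iterate_one, adR_apply, h.eq, sub_self]⟩

theorem mem_nilSubring_of_adR {S : Type*} [Ring S] {b s : S} (h : adR b s ∈ nilSubring b) :
    s ∈ nilSubring b := by
  obtain ⟨N, hN⟩ := h
  exact ⟨N + 1, hN⟩

theorem adR_coordX_del (i j : Fin n) : adR (coordX K i) (del K j) = if i = j then 1 else 0 := by
  rw [adR_apply, del_mul_coordX, add_sub_cancel_left]
  simp only [eq_comm]

theorem adR_del_coordX (i j : Fin n) :
    adR (del K i) (coordX K j) = -if i = j then 1 else 0 := by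
  rw [adR_apply, del_mul_coordX]
  abel

theorem mem_nilSubring_coordX (i : Fin n) (d : DiffOp K n) : d ∈ nilSubring (coordX K i) := by
  refine diffOp_induction (p := fun d => d ∈ nilSubring (coordX K i)) (fun f => ?_)
    (fun j => ?_) (fun _ _ => add_mem) (fun _ _ => mul_mem) d
  · refine mem_nilSubring_of_commute ?_
    rw [Commute, SemiconjBy, coordX, ← map_mul, mul_comm, map_mul]
  · refine mem_nilSubring_of_adR ?_
    rw [adR_coordX_del]
    split_ifs
    · exact one_mem _
    · exact zero_mem _

theorem mem_nilSubring_del (i : Fin n) {d : DiffOp K n} (hd : d ∈ polyOps K n) :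
    d ∈ nilSubring (del K i) := by
  refine Algebra.adjoin_induction (p := fun d _ => d ∈ nilSubring (del K i)) ?_ (fun a => ?_)
    (fun _ _ _ _ => add_mem) (fun _ _ _ _ => mul_mem) hd
  · rintro _ (⟨j, rfl⟩ | ⟨j, rfl⟩)
    · refine mem_nilSubring_of_adR ?_
      rw [adR_del_coordX]
      refine neg_mem ?_
      split_ifs
      · exact one_mem _
      · exact zero_mem _
    · exact mem_nilSubring_of_commute (del_commute K j i)
  · exact mem_nilSubring_of_commute (Algebra.commutes a _)

end Operators

/-! ## The completed Weyl algebra and its residue ring -/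

noncomputable section Completed

variable {K : Type u} [NontriviallyNormedField K] [IsUltrametricDist K] {n : ℕ}

instance : CompleteSpace (CompletedWeylAlgebra K n) :=
  inferInstanceAs (CompleteSpace (UniformSpace.Completion (DiffOp K n)))

theorem norm_toCompleted (d : DiffOp K n) : ‖toCompleted K n d‖ = ‖d‖ :=
  UniformSpace.Completion.norm_coe d

theorem denseRange_toCompleted : DenseRange (toCompleted K n) :=
  UniformSpace.Completion.denseRange_coe

theorem completed_induction {p : CompletedWeylAlgebra K n → Prop} (hp : IsClosed {x | p x})
    (h : ∀ d, p (toCompleted K n d)) (x : CompletedWeylAlgebra K n) : p x :=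
  UniformSpace.Completion.induction_on x hp h

theorem exists_toCompleted_sub_lt (x : CompletedWeylAlgebra K n) {ε : ℝ} (hε : 0 < ε) :
    ∃ d ∈ polyOps K n, ‖x - toCompleted K n d‖ < ε := by
  obtain ⟨d, hd⟩ := denseRange_toCompleted.exists_dist_lt x (half_pos hε)
  obtain ⟨p, hp, hdp⟩ := exists_polyOps_sub_lt d (half_pos hε)
  refine ⟨p, hp, ?_⟩
  rw [dist_eq_norm] at hd
  rw [← norm_toCompleted, map_sub] at hdp
  calc ‖x - toCompleted K n p‖ = ‖(x - toCompleted K n d) + (toCompleted K n d - toCompleted K n p)‖ := by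
        rw [sub_add_sub_cancel]
    _ ≤ _ := norm_add_le _ _
    _ < ε := by linarith

instance : Algebra K (CompletedWeylAlgebra K n) :=
  ((toCompleted K n).comp (algebraMap K (DiffOp K n))).toAlgebra' fun a x => by
    refine completed_induction (isClosed_eq (continuous_const.mul continuous_id)
      (continuous_id.mul continuous_const)) (fun d => ?_) x
    change toCompleted K n _ * toCompleted K n d = toCompleted K n d * toCompleted K n _
    rw [← map_mul, ← map_mul, Algebra.commutes]

theorem algebraMap_completed (a : K) :
    algebraMap K (CompletedWeylAlgebra K n) a = toCompleted K n (algebraMap K (DiffOp K n) a) := rfl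

instance : NormedAlgebra K (CompletedWeylAlgebra K n) where
  norm_smul_le a x := by
    rw [Algebra.smul_def]
    refine (norm_mul_le _ _).trans (mul_le_mul_of_nonneg_right ?_ (norm_nonneg _))
    rw [algebraMap_completed, norm_toCompleted, norm_algebraMap']

instance : NormOneClass (CompletedWeylAlgebra K n) := ⟨by
  rw [← map_one (toCompleted K n), norm_toCompleted, norm_one]⟩

instance : IsUltrametricDist (CompletedWeylAlgebra K n) :=
  IsUltrametricDist.isUltrametricDist_of_forall_norm_add_le_max_norm fun x y => by
    refine completed_induction (p := fun x => ‖x + y‖ ≤ max ‖x‖ ‖y‖) (isClosed_le (by fun_prop)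
      (by fun_prop)) (fun d => ?_) x
    refine completed_induction (p := fun y => ‖toCompleted K n d + y‖ ≤ max ‖toCompleted K n d‖ ‖y‖)
      (isClosed_le (by fun_prop) (by fun_prop)) (fun d' => ?_) y
    rw [← map_add, norm_toCompleted, norm_toCompleted, norm_toCompleted]
    exact IsUltrametricDist.norm_add_le_max d d'

variable {ϖ : K} (h0 : ϖ ≠ 0) (h1 : ‖ϖ‖ < 1) (hdisc : ∀ a : K, ‖a‖ < 1 → ‖a‖ ≤ ‖ϖ‖)

include hdisc in
theorem norm_diffOp_discrete (d : DiffOp K n) (hd : ‖d‖ < 1) : ‖d‖ ≤ ‖ϖ‖ := opNorm_discrete hdisc hd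

include h0 h1 hdisc in
theorem norm_completed_discrete (x : CompletedWeylAlgebra K n) (hx : ‖x‖ < 1) : ‖x‖ ≤ ‖ϖ‖ := by
  obtain ⟨d, -, hd⟩ := exists_toCompleted_sub_lt x (norm_pos_iff.mpr h0)
  have hd1 : ‖d‖ < 1 := by
    rw [← norm_toCompleted, show toCompleted K n d = x + -(x - toCompleted K n d) by abel]
    refine (IsUltrametricDist.norm_add_le_max _ _).trans_lt (max_lt hx ?_)
    rw [norm_neg]
    exact hd.trans h1
  rw [show x = (x - toCompleted K n d) + toCompleted K n d by abel]
  refine (IsUltrametricDist.norm_add_le_max _ _).trans (max_le hd.le ?_)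
  rw [norm_toCompleted]
  exact norm_diffOp_discrete hdisc d hd1

/-- Reduction of differential operators of norm at most one. -/
def red (K : Type u) [NontriviallyNormedField K] [IsUltrametricDist K] (n : ℕ) :
    unitBall (DiffOp K n) →+* residueRing (CompletedWeylAlgebra K n) :=
  (Ideal.Quotient.mk _).comp (unitBallMap (toCompleted K n) norm_toCompleted)

theorem red_eq_zero {d : unitBall (DiffOp K n)} : red K n d = 0 ↔ ‖(d : DiffOp K n)‖ < 1 := by
  rw [red, RingHom.comp_apply, Ideal.Quotient.eq_zero_iff_mem, ← norm_toCompleted]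
  exact Iff.rfl

/-- An approximation at distance below 1 already has the same residue, so polynomial operators
represent the whole residue ring. -/
theorem exists_red_eq (w : residueRing (CompletedWeylAlgebra K n)) :
    ∃ d : unitBall (DiffOp K n), (d : DiffOp K n) ∈ polyOps K n ∧ red K n d = w := by
  obtain ⟨x, rfl⟩ := Ideal.Quotient.mk_surjective w
  obtain ⟨d, hd, hxd⟩ := exists_toCompleted_sub_lt x.1 zero_lt_one
  have hd1 : ‖d‖ ≤ 1 := by
    rw [← norm_toCompleted, show toCompleted K n d = x.1 + -(x.1 - toCompleted K n d) by abel]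
    refine (IsUltrametricDist.norm_add_le_max _ _).trans (max_le x.2 ?_)
    rw [norm_neg]
    exact hxd.le
  refine ⟨⟨d, hd1⟩, hd, ?_⟩
  rw [red, RingHom.comp_apply, eq_comm, ← sub_eq_zero, ← map_sub, Ideal.Quotient.eq_zero_iff_mem]
  exact hxd

theorem adR_map {R S : Type*} [Ring R] [Ring S] (f : R →+* S) (b r : R) :
    f (adR b r) = adR (f b) (f r) := by
  rw [adR_apply, adR_apply, map_sub, map_mul, map_mul]

theorem iterate_adR_map {R S : Type*} [Ring R] [Ring S] (f : R →+* S) (b r : R) (N : ℕ) :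
    f ((adR b)^[N] r) = (adR (f b))^[N] (f r) := by
  induction N with
  | zero => rfl
  | succ N ih => rw [Function.iterate_succ_apply', Function.iterate_succ_apply', adR_map, ih]

omit [IsUltrametricDist K] in
theorem isUnit_natCast_unitBall {E : Type u} [NormedRing E] [NormOneClass E] [IsUltrametricDist E]
    [NormedAlgebra K E] {m : ℕ} (hm : ‖(m : K)‖ = 1) : IsUnit (m : unitBall E) := by
  have hm0 : (m : K) ≠ 0 := fun h => by simp [h] at hm
  have hinv : ‖algebraMap K E (m : K)⁻¹‖ ≤ 1 := by rw [norm_algebraMap', norm_inv, hm, inv_one]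
  refine ⟨⟨m, ⟨_, hinv⟩, Subtype.ext ?_, Subtype.ext ?_⟩, rfl⟩
  · change (m : E) * algebraMap K E (m : K)⁻¹ = 1
    rw [← map_natCast (algebraMap K E), ← map_mul, mul_inv_cancel₀ hm0, map_one]
  · change algebraMap K E (m : K)⁻¹ * (m : E) = 1
    rw [← map_natCast (algebraMap K E), ← map_mul, inv_mul_cancel₀ hm0, map_one]

/-- The coordinates `x_i, ∂_i` in the unit ball of `𝒟ₙ`. -/
def coordG (K : Type u) [NontriviallyNormedField K] [IsUltrametricDist K] {n : ℕ} :
    Fin n ⊕ Fin n → unitBall (DiffOp K n) :=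
  Sum.elim (fun i => ⟨coordX K i, (norm_coordX i).le⟩) (fun i => ⟨del K i, norm_del_le i⟩)

/-- The dual coordinates `-∂_i, x_i` in the unit ball of `𝒟ₙ`. -/
def coordB (K : Type u) [NontriviallyNormedField K] [IsUltrametricDist K] {n : ℕ} :
    Fin n ⊕ Fin n → unitBall (DiffOp K n) :=
  Sum.elim (fun i => -⟨del K i, norm_del_le i⟩) (fun i => ⟨coordX K i, (norm_coordX i).le⟩)

theorem adR_neg {S : Type*} [Ring S] (b s : S) : adR (-b) s = -adR b s := by
  rw [adR_apply, adR_apply]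
  noncomm_ring

theorem coord_dual (k l : Fin n ⊕ Fin n) :
    adR (coordB K k) (coordG K l) = if k = l then 1 else 0 := by
  refine Subtype.ext ?_
  have h := adR_map (unitBall (DiffOp K n)).subtype (coordB K k) (coordG K l)
  refine h.trans ?_
  rcases k with i | i <;> rcases l with j | j
  · change adR (-del K i) (coordX K j) = _
    rw [adR_neg, adR_del_coordX, neg_neg]
    by_cases h : i = j
    · rw [if_pos h, if_pos (congrArg _ h)]
      rfl
    · rw [if_neg h, if_neg fun h' => h (Sum.inl_injective h')]
      rfl
  · change adR (-del K i) (del K j) = _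
    rw [adR_neg, adR_apply, (del_commute K j i).eq, sub_self, neg_zero, if_neg Sum.inl_ne_inr]
    rfl
  · change adR (coordX K i) (coordX K j) = _
    rw [adR_apply, (coordX_commute j i).eq, sub_self, if_neg Sum.inr_ne_inl]
    rfl
  · change adR (coordX K i) (del K j) = _
    rw [adR_coordX_del]
    by_cases h : i = j
    · rw [if_pos h, if_pos (congrArg _ h)]
      rfl
    · rw [if_neg h, if_neg fun h' => h (Sum.inr_injective h')]
      rfl

theorem coord_comm (k l : Fin n ⊕ Fin n) :
    ∃ z : ℤ, coordB K k * coordB K l - coordB K l * coordB K k = (z : unitBall (DiffOp K n)) := by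
  have key : ∀ i l, ∃ z : ℤ, coordG K i * coordB K l - coordB K l * coordG K i =
      (z : unitBall (DiffOp K n)) :=
    fun i l => ⟨if l = i then 1 else 0, (coord_dual l i).trans (by split_ifs <;> simp)⟩
  rcases k with i | i
  · obtain ⟨z, hz⟩ := key (Sum.inr i) l
    refine ⟨-z, ?_⟩
    have h : coordB K (Sum.inl i) = -coordG K (Sum.inr i) := rfl
    rw [h, Int.cast_neg, ← hz]
    noncomm_ring
  · exact key (Sum.inl i) l

theorem coord_nil (k : Fin n ⊕ Fin n) (d : unitBall (DiffOp K n)) (hd : (d : DiffOp K n) ∈ polyOps K n) :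
    ∃ N, (adR (coordB K k))^[N] d = 0 := by
  have h : (d : DiffOp K n) ∈ nilSubring (coordB K k : DiffOp K n) := by
    rcases k with i | i
    · obtain ⟨N, hN⟩ := mem_nilSubring_del i hd
      refine ⟨N, ?_⟩
      have h2 : ∀ N, ∃ z : ℤ, (adR (-del K i))^[N] (d : DiffOp K n) =
          z * (adR (del K i))^[N] (d : DiffOp K n) := by
        intro N
        induction N with
        | zero => exact ⟨1, by simp⟩
        | succ N ih =>
          obtain ⟨z, hz⟩ := ih
          refine ⟨-z, ?_⟩
          rw [Function.iterate_succ_apply', Function.iterate_succ_apply', hz, adR_neg, ← zsmul_eq_mul,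
            map_zsmul, zsmul_eq_mul, Int.cast_neg, neg_mul]
      obtain ⟨z, hz⟩ := h2 N
      change (adR (-del K i))^[N] (d : DiffOp K n) = 0
      rw [hz, hN, mul_zero]
    · exact mem_nilSubring_coordX i _
  obtain ⟨N, hN⟩ := h
  refine ⟨N, Subtype.ext ?_⟩
  exact (iterate_adR_map (unitBall (DiffOp K n)).subtype _ _ N).trans hN

/-- The Weyl system in the residue ring of the completed Weyl algebra. -/
def residueSystem (hK : ∀ m : ℕ, m ≠ 0 → ‖(m : K)‖ = 1) :
    CoordSystem (Fin n ⊕ Fin n) (residueRing (CompletedWeylAlgebra K n)) where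
  g k := red K n (coordG K k)
  b k := red K n (coordB K k)
  isUnit_natCast m hm := by
    have := (isUnit_natCast_unitBall (E := CompletedWeylAlgebra K n) (hK m hm)).map
      (Ideal.Quotient.mk (openIdeal (CompletedWeylAlgebra K n)))
    rwa [map_natCast] at this
  dual k l := by
    rw [← adR_map, coord_dual]
    split_ifs <;> simp
  comm k l w := by
    obtain ⟨z, hz⟩ := coord_comm (K := K) k l
    rw [← map_mul, ← map_mul, ← map_sub, hz, map_intCast]
    exact (Int.cast_commute z w)
  nil k w := by
    obtain ⟨d, hd, rfl⟩ := exists_red_eq w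
    obtain ⟨N, hN⟩ := coord_nil k d hd
    exact ⟨N, by rw [← iterate_adR_map, hN, map_zero]⟩

/-- The elements of norm `< 1`. -/
def openBall (E : Type*) [NormedAddCommGroup E] [IsUltrametricDist E] : AddSubgroup E where
  carrier := {e | ‖e‖ < 1}
  zero_mem' := by simp
  add_mem' ha hb := (IsUltrametricDist.norm_add_le_max _ _).trans_lt (max_lt ha hb)
  neg_mem' ha := by
    change ‖-_‖ < 1
    rwa [norm_neg]

theorem mem_openBall {E : Type*} [NormedAddCommGroup E] [IsUltrametricDist E] {e : E} :
    e ∈ openBall E ↔ ‖e‖ < 1 := Iff.rfl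

include h0 h1 hdisc in
-- The difference d - d(1) sends the monomial x^t to the value of [d, x^t] at 1, which has norm
-- below 1 since the bracket is a derivation. Approximation by polynomials extends this to all
-- functions of norm 1.
theorem norm_sub_mulOp_lt {d : DiffOp K n} (hd : ‖d‖ ≤ 1)
    (hx : ∀ i, ‖adR (coordX K i) d‖ < 1) : ‖d - mulOp K n (opHom K n d 1)‖ < 1 := by
  have hmono : ∀ t, ‖adR (mulOp K n (tateMonomial t)) d‖ < 1 := by
    have hnorm : ∀ t, ‖mulOp K n (tateMonomial t)‖ ≤ 1 := fun t =>
      ((norm_mulOp _).trans (norm_tateMonomial t)).le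
    have hadd : ∀ t t', ‖adR (mulOp K n (tateMonomial t)) d‖ < 1 →
        ‖adR (mulOp K n (tateMonomial t')) d‖ < 1 →
        ‖adR (mulOp K n (tateMonomial (t + t'))) d‖ < 1 := by
      intro t t' ht ht'
      have h2 : adR (mulOp K n (tateMonomial (t + t'))) d =
          adR (mulOp K n (tateMonomial t)) d * mulOp K n (tateMonomial t') +
            mulOp K n (tateMonomial t) * adR (mulOp K n (tateMonomial t')) d := by
        rw [tateMonomial_add, map_mul]
        simp only [adR_apply]
        noncomm_ring
      rw [h2]
      refine (IsUltrametricDist.norm_add_le_max _ _).trans_lt (max_lt ?_ ?_)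
      · exact (norm_mul_le _ _).trans_lt
          ((mul_le_of_le_one_right (norm_nonneg _) (hnorm t')).trans_lt ht)
      · exact (norm_mul_le _ _).trans_lt
          ((mul_le_of_le_one_left (norm_nonneg _) (hnorm t)).trans_lt ht')
    have hzero : ‖adR (mulOp K n (tateMonomial 0)) d‖ < 1 := by
      rw [tateMonomial_zero, map_one, adR_apply]
      simp
    intro t
    induction t using Finsupp.induction_linear with
    | zero => exact hzero
    | add t t' h h' => exact hadd t t' h h'
    | single i k =>
      induction k with
      | zero =>
        rw [Finsupp.single_zero]
        exact hzero
      | succ k ih =>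
        rw [Finsupp.single_add]
        exact hadd _ _ ih (hx i)
  set f := opHom K n d 1 with hf
  have hf1 : ‖f‖ ≤ 1 := by
    have := (opHom K n d).le_opNorm 1
    rw [norm_one, mul_one, norm_opHom] at this
    exact this.trans hd
  have hdf : ‖d - mulOp K n f‖ ≤ 1 := by
    rw [sub_eq_add_neg]
    refine (IsUltrametricDist.norm_add_le_max _ _).trans (max_le hd ?_)
    rw [norm_neg, norm_mulOp]
    exact hf1
  have hmono' : ∀ t, opHom K n (d - mulOp K n f) (tateMonomial t) ∈ openBall _ := by
    intro t
    have h2 : opHom K n (d - mulOp K n f) (tateMonomial t) =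
        opHom K n (adR (mulOp K n (tateMonomial t)) d) 1 := by
      rw [adR_apply, map_sub, map_sub, map_mul, map_mul]
      change opHom K n d _ - f * tateMonomial t = opHom K n d (tateMonomial t * 1) -
        tateMonomial t * opHom K n d 1
      rw [mul_one, ← hf, mul_comm f]
    rw [h2, mem_openBall]
    refine ((opHom K n _).le_opNorm 1).trans_lt ?_
    rw [norm_one, mul_one, norm_opHom]
    exact hmono t
  -- Pointwise strict bounds do not bound a supremum strictly; discreteness first improves them to
  -- |ϖ|.
  refine lt_of_le_of_lt (opNorm_le_of_norm_eq_one (T := opHom K n (d - mulOp K n f))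
    (norm_nonneg ϖ) fun g hg => norm_tate_discrete hdisc _ ?_) h1
  obtain ⟨s, hs⟩ := exists_norm_sub_sum_le g (norm_pos_iff.mpr h0)
  rw [← sub_add_cancel g (∑ t ∈ s, MvPowerSeries.coeff t g.1 • tateMonomial t), map_add, map_sum]
  refine add_mem (S := AddSubgroup (TateAlgebra K n)) (s := openBall _) ?_
    (sum_mem fun t _ => ?_)
  · rw [mem_openBall]
    refine ((opHom K n _).le_opNorm _).trans_lt ?_
    exact (mul_le_mul hdf hs (norm_nonneg _) zero_le_one).trans_lt (by rwa [one_mul])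
  · rw [map_smul, mem_openBall, norm_smul]
    exact (mul_le_of_le_one_left (norm_nonneg _) ((norm_coeff_le g t).trans hg.le)).trans_lt
      (hmono' t)

/-- The reduction of multiplication operators. -/
def mulBall (K : Type u) [NontriviallyNormedField K] [IsUltrametricDist K] (n : ℕ) :
    unitBall (TateAlgebra K n) →+* unitBall (DiffOp K n) := unitBallMap (mulOp K n) norm_mulOp

variable (hK : ∀ m : ℕ, m ≠ 0 → ‖(m : K)‖ = 1)

include h0 h1 hdisc in
-- Modulo ϖ, commuting with all xᵢ means being multiplication by a function: `norm_sub_mulOp_lt`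
-- applies to any representative.
theorem exists_red_mulBall {w : residueRing (CompletedWeylAlgebra K n)}
    (hw : ∀ i, adR (red K n (coordB K (Sum.inr i))) w = 0) :
    ∃ f, w = red K n (mulBall K n f) := by
  obtain ⟨d, -, rfl⟩ := exists_red_eq w
  have hx : ∀ i, ‖adR (coordX K i) (d : DiffOp K n)‖ < 1 := by
    intro i
    have h2 := hw i
    rw [← adR_map, red_eq_zero] at h2
    exact h2
  have h3 := norm_sub_mulOp_lt h0 h1 hdisc d.2 hx
  have hf1 : ‖opHom K n d 1‖ ≤ 1 := by
    have := (opHom K n d).le_opNorm 1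
    rw [norm_one, mul_one, norm_opHom] at this
    exact this.trans d.2
  refine ⟨⟨_, hf1⟩, ?_⟩
  rw [← sub_eq_zero, ← map_sub, red_eq_zero]
  exact h3

include h0 h1 hdisc hK in
-- Commuting also with the ∂ᵢ makes the partial derivatives of the function small. They multiply
-- coefficients by nonzero integers, which have norm 1, so every nonconstant coefficient is small.
theorem exists_red_scalar {w : residueRing (CompletedWeylAlgebra K n)}
    (hw : ∀ k, adR (red K n (coordB K k)) w = 0) :
    ∃ (a : K) (ha : ‖a‖ ≤ 1), w = red K n ⟨algebraMap K _ a, by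
      change ‖algebraMap K _ a‖ ≤ 1; rwa [norm_algebraMap']⟩ := by
  obtain ⟨f, rfl⟩ := exists_red_mulBall h0 h1 hdisc fun i => hw (Sum.inr i)
  have hd : ∀ i, ‖partialOp K i f.1‖ < 1 := by
    intro i
    have h2 := hw (Sum.inl i)
    rw [← adR_map, red_eq_zero] at h2
    have h3 : ((adR (coordB K (Sum.inl i)) (mulBall K n f) : unitBall (DiffOp K n)) : DiffOp K n) =
        mulOp K n (partialOp K i f.1) := by
      change mulOp K n f.1 * -del K i - -del K i * mulOp K n f.1 = _
      rw [neg_mul, del_mul_mulOp]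
      noncomm_ring
    rwa [h3, norm_mulOp] at h2
  have hcoeff : ∀ t, t ≠ 0 → ‖MvPowerSeries.coeff t f.1.1‖ ≤ ‖ϖ‖ := by
    intro t ht
    obtain ⟨i, hi⟩ := Finsupp.ne_iff.mp ht
    refine hdisc _ ?_
    have h2 := (norm_coeff_le (partialOp K i f.1) (t - Finsupp.single i 1)).trans_lt (hd i)
    have hle : Finsupp.single i 1 ≤ t := by
      rw [Finsupp.single_le_iff]
      exact Nat.one_le_iff_ne_zero.mpr hi
    rw [partialOp_coe, MvPowerSeries.coeff_pderiv, norm_mul, tsub_add_cancel_of_le hle] at h2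
    have h3 : ‖(((t - Finsupp.single i (1 : ℕ) : Fin n →₀ ℕ) i : K) + 1)‖ = 1 := by
      exact_mod_cast hK ((t - Finsupp.single i (1 : ℕ) : Fin n →₀ ℕ) i + 1) (Nat.succ_ne_zero _)
    rwa [h3, mul_one] at h2
  refine ⟨MvPowerSeries.coeff 0 f.1.1, (norm_coeff_le f.1 0).trans f.2, ?_⟩
  rw [← sub_eq_zero, ← map_sub, red_eq_zero]
  change ‖mulOp K n f.1 - algebraMap K _ (MvPowerSeries.coeff 0 f.1.1)‖ < 1
  rw [← mulOp_algebraMap, ← map_sub, norm_mulOp]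
  refine (norm_tate_le (norm_nonneg ϖ) fun t => ?_).trans_lt h1
  classical
  change ‖MvPowerSeries.coeff t (f.1.1 - MvPowerSeries.C (MvPowerSeries.coeff 0 f.1.1))‖ ≤ _
  rw [map_sub, MvPowerSeries.coeff_C]
  split_ifs with h
  · rw [h, sub_self, norm_zero]
    exact norm_nonneg _
  · rw [sub_zero]
    exact hcoeff t h

include h0 h1 hdisc in
-- The elements commuting with all coordinates are reductions of scalars; a nonzero one comes from a
-- scalar of norm 1, which has an inverse in the unit ball.
theorem isWeyl_residueSystem : (residueSystem (n := n) hK).IsWeyl where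
  b_inr _ := rfl
  b_inl i := map_neg (red K n) _
  commute w hw w' _ := by
    obtain ⟨a, ha, rfl⟩ := exists_red_scalar h0 h1 hdisc hK
      fun k => (residueSystem hK).mem_ring.mp hw k (by simp)
    obtain ⟨d, -, rfl⟩ := exists_red_eq w'
    rw [Commute, SemiconjBy, ← map_mul, ← map_mul]
    congr 1
    exact Subtype.ext (Algebra.commutes a (d : DiffOp K n))
  isUnit w hw hw0 := by
    obtain ⟨a, ha, rfl⟩ := exists_red_scalar h0 h1 hdisc hK
      fun k => (residueSystem hK).mem_ring.mp hw k (by simp)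
    have ha1 : ‖a‖ = 1 := by
      refine le_antisymm ha (not_lt.mp fun h => hw0 (red_eq_zero.mpr ?_))
      change ‖algebraMap K _ a‖ < 1
      rwa [norm_algebraMap']
    have ha0 : a ≠ 0 := fun h => by simp [h] at ha1
    refine IsUnit.map (red K n) ?_
    have hinv : ‖algebraMap K (DiffOp K n) a⁻¹‖ ≤ 1 := by
      rw [norm_algebraMap', norm_inv, ha1, inv_one]
    refine ⟨⟨_, ⟨_, hinv⟩, Subtype.ext ?_, Subtype.ext ?_⟩, rfl⟩
    · change algebraMap K _ a * algebraMap K _ a⁻¹ = 1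
      rw [← map_mul, mul_inv_cancel₀ ha0, map_one]
    · change algebraMap K _ a⁻¹ * algebraMap K _ a = 1
      rw [← map_mul, inv_mul_cancel₀ ha0, map_one]

end Completed

/-! ## Noetherianity, flatness and global dimension -/

section General

theorem IsPiComplete.of_ker {T W W' : Type*} [Ring T] [Ring W] [Ring W'] {ϖ : T} {q : T →+* W}
    (h : IsPiComplete ϖ q) {q' : T →+* W'} (hq : Function.Surjective q')
    (hker : ∀ t, q' t = 0 ↔ q t = 0) : IsPiComplete ϖ q' where
  central := h.central
  regular := h.regular
  surj := hq
  ker t := (hker t).trans (h.ker t)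
  separated := h.separated
  complete := h.complete

theorem IsLocalizationAt.isNoetherianRing {R S : Type u} [Ring R] [Ring S] {f : R →+* S} {ϖ : R}
    (h : IsLocalizationAt f ϖ) [IsNoetherianRing R] : IsNoetherianRing S := by
  refine (isNoetherianRing_iff_ideal_fg S).mpr fun I => ?_
  have hI : I = (I.comap f).map f := by
    refine le_antisymm (fun s hs => ?_) Ideal.map_comap_le
    obtain ⟨k, r, hr⟩ := h.surj s
    obtain ⟨v, hv⟩ := h.isUnit.pow k
    have h2 : s = (↑v⁻¹ : S) * f r := by rw [← hr, ← hv, Units.inv_mul_cancel_left]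
    rw [h2]
    refine Ideal.mul_mem_left _ _ (Ideal.mem_map_of_mem f ?_)
    rw [Ideal.mem_comap, ← hr]
    exact I.mul_mem_left _ hs
  rw [hI]
  exact Ideal.FG.map (IsNoetherian.noetherian _) f

end General

noncomputable section Conclusions

variable {K : Type u} [NontriviallyNormedField K] [IsUltrametricDist K] {n : ℕ}
variable {ϖ : K} (h0 : ϖ ≠ 0) (h1 : ‖ϖ‖ < 1) (hdisc : ∀ a : K, ‖a‖ < 1 → ‖a‖ ≤ ‖ϖ‖)
variable (hK : ∀ m : ℕ, m ≠ 0 → ‖(m : K)‖ = 1)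

variable (K n) in
/-- The reduction of the unit ball of the Tate algebra. -/
def redTate : unitBall (TateAlgebra K n) →+* residueRing (CompletedWeylAlgebra K n) :=
  (red K n).comp (mulBall K n)

theorem redTate_eq_zero {f : unitBall (TateAlgebra K n)} :
    redTate K n f = 0 ↔ ‖(f : TateAlgebra K n)‖ < 1 := by
  rw [redTate, RingHom.comp_apply, red_eq_zero, ← norm_mulOp]
  exact Iff.rfl

include h0 h1 hdisc hK in
-- The reduction of A° is the polynomial stage of the Weyl tower, which is Noetherian, and A° is
-- ϖ-adically complete.
theorem isNoetherianRing_unitBall_tate [CompleteSpace K] :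
    IsNoetherianRing (unitBall (TateAlgebra K n)) := by
  set C := residueSystem (n := n) hK
  let T : Finset (Fin n ⊕ Fin n) := Finset.univ.map Function.Embedding.inl
  have hmem : ∀ f, redTate K n f ∈ C.ring T := by
    intro f
    refine C.mem_ring.mpr fun k hk => ?_
    rcases k with i | i
    · exact absurd (Finset.mem_map_of_mem _ (Finset.mem_univ i)) hk
    · change adR (red K n (coordB K (Sum.inr i))) (red K n (mulBall K n f)) = 0
      rw [← adR_map]
      have : adR (coordB K (Sum.inr i)) (mulBall K n f) = 0 := by
        rw [adR_apply, sub_eq_zero]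
        refine Subtype.ext ?_
        change mulOp K n f.1 * mulOp K n (tateX K i) = mulOp K n (tateX K i) * mulOp K n f.1
        rw [← map_mul, ← map_mul, mul_comm]
      rw [this, map_zero]
  have hcomp := (isPiComplete_unitBall (E := TateAlgebra K n) h0 h1
    (norm_tate_discrete hdisc)).of_ker (q' := (redTate K n).codRestrict (C.ring T) hmem) ?_ ?_
  · have := (isWeyl_residueSystem (n := n) h0 h1 hdisc hK).isNoetherianRing_ring T
    exact hcomp.isNoetherianRing
  · rintro ⟨w, hw⟩
    obtain ⟨f, hf⟩ := exists_red_mulBall h0 h1 hdisc fun i => C.mem_ring.mp hw (Sum.inr i)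
      (by simp [T])
    exact ⟨f, Subtype.ext hf.symm⟩
  · intro f
    rw [Ideal.Quotient.eq_zero_iff_mem]
    refine Iff.trans ?_ redTate_eq_zero
    exact Subtype.ext_iff

include h0 h1 hdisc in
-- An operator that commutes with the xᵢ and kills 1 has norm below 1 by `norm_sub_mulOp_lt`, hence
-- is divisible by ϖ with a quotient of the same kind. Infinite divisibility forces it to vanish.
theorem eq_mulOp_of_commute {d : DiffOp K n} (hd : ‖d‖ ≤ 1) (hx : ∀ i, adR (coordX K i) d = 0) :
    d = mulOp K n (opHom K n d 1) := by
  have key : ∀ k : ℕ, ∀ e : DiffOp K n, ‖e‖ ≤ 1 → (∀ i, adR (coordX K i) e = 0) →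
      opHom K n e 1 = 0 → ‖e‖ ≤ ‖ϖ‖ ^ k := by
    intro k
    induction k with
    | zero => exact fun e he _ _ => by rwa [pow_zero]
    | succ k ih =>
      intro e he hx he1
      have h2 := norm_sub_mulOp_lt h0 h1 hdisc he fun i => by rw [hx i, norm_zero]; exact one_pos
      rw [he1, map_zero, sub_zero] at h2
      have h3 : ‖ϖ⁻¹ • e‖ ≤ ‖ϖ‖ ^ k := by
        refine ih _ ?_ (fun i => ?_) ?_
        · rw [norm_smul, norm_inv]
          exact (inv_mul_le_one₀ (norm_pos_iff.mpr h0)).mpr (norm_diffOp_discrete hdisc e h2)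
        · rw [adR_apply, smul_mul_assoc, mul_smul_comm, ← smul_sub, ← adR_apply, hx i, smul_zero]
        · change ϖ⁻¹ • opHom K n e 1 = 0
          rw [he1, smul_zero]
      rw [norm_smul, norm_inv] at h3
      rw [pow_succ', mul_comm]
      exact (inv_mul_le_iff₀' (norm_pos_iff.mpr h0)).mp h3
  have hf1 : ‖opHom K n d 1‖ ≤ 1 := by
    have := (opHom K n d).le_opNorm 1
    rw [norm_one, mul_one, norm_opHom] at this
    exact this.trans hd
  have hle : ∀ k : ℕ, ‖d - mulOp K n (opHom K n d 1)‖ ≤ ‖ϖ‖ ^ k := fun k => by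
    refine key k _ ?_ (fun i => ?_) ?_
    · rw [sub_eq_add_neg]
      refine (IsUltrametricDist.norm_add_le_max _ _).trans (max_le hd ?_)
      rw [norm_neg, norm_mulOp]
      exact hf1
    · rw [map_sub, hx, zero_sub, neg_eq_zero, adR_apply, sub_eq_zero]
      change mulOp K n _ * mulOp K n (tateX K i) = mulOp K n (tateX K i) * mulOp K n _
      rw [← map_mul, ← map_mul, mul_comm]
    · change opHom K n d 1 - opHom K n d 1 * 1 = 0
      rw [mul_one, sub_self]
  exact sub_eq_zero.mp (norm_le_zero_iff.mp (ge_of_tendsto'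
    (tendsto_pow_atTop_nhds_zero_of_lt_one (norm_nonneg ϖ) h1) hle))

theorem coord_nil_x (i : Fin n) (d : unitBall (DiffOp K n)) :
    ∃ N, (adR (coordB K (Sum.inr i)))^[N] d = 0 := by
  obtain ⟨N, hN⟩ := mem_nilSubring_coordX i (d : DiffOp K n)
  exact ⟨N, Subtype.ext ((iterate_adR_map (unitBall (DiffOp K n)).subtype _ _ N).trans hN)⟩

/-- The system `∂_i, x_i` in the unit ball of `𝒟ₙ`. -/
def ballSystem (hK : ∀ m : ℕ, m ≠ 0 → ‖(m : K)‖ = 1) :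
    CoordSystem (Fin n) (unitBall (DiffOp K n)) where
  g i := coordG K (Sum.inr i)
  b i := coordB K (Sum.inr i)
  isUnit_natCast m hm := isUnit_natCast_unitBall (hK m hm)
  dual i j := by
    rw [coord_dual]
    by_cases h : i = j
    · rw [if_pos h, if_pos (congrArg _ h)]
    · rw [if_neg h, if_neg fun h' => h (Sum.inr_injective h')]
  comm i j w := by
    obtain ⟨z, hz⟩ := coord_comm (K := K) (Sum.inr i) (Sum.inr j)
    rw [hz]
    exact Int.cast_commute z w
  nil i w := coord_nil_x i w

theorem adR_op {S : Type*} [Ring S] (b s : S) :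
    adR (MulOpposite.op (-b)) (MulOpposite.op s) = MulOpposite.op (adR b s) := by
  refine MulOpposite.unop_injective ?_
  rw [adR_apply, adR_apply]
  change -b * s - s * -b = s * b - b * s
  noncomm_ring

theorem iterate_adR_op {S : Type*} [Ring S] (b s : S) (N : ℕ) :
    (adR (MulOpposite.op (-b)))^[N] (MulOpposite.op s) = MulOpposite.op ((adR b)^[N] s) := by
  induction N with
  | zero => rfl
  | succ N ih => rw [Function.iterate_succ_apply', Function.iterate_succ_apply', ih, adR_op]

/-- The system opposite to a given one. -/
def CoordSystem.op {I W : Type*} [DecidableEq I] [Ring W] (C : CoordSystem I W) :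
    CoordSystem I Wᵐᵒᵖ where
  g k := MulOpposite.op (C.g k)
  b k := MulOpposite.op (-C.b k)
  isUnit_natCast m hm := (C.isUnit_natCast m hm).op
  dual k l := by
    rw [adR_op, C.dual]
    split_ifs <;> rfl
  comm k l w := by
    refine MulOpposite.unop_injective ?_
    have h := (C.comm l k w.unop).eq
    change w.unop * (-C.b l * -C.b k - -C.b k * -C.b l) =
      (-C.b l * -C.b k - -C.b k * -C.b l) * w.unop
    rw [neg_mul_neg, neg_mul_neg, h]
  nil k w := by
    obtain ⟨N, hN⟩ := C.nil k w.unop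
    refine ⟨N, ?_⟩
    rw [← MulOpposite.op_unop w, iterate_adR_op, hN, MulOpposite.op_zero]

include h0 h1 hdisc in
theorem exists_eq_mulBall {w : unitBall (DiffOp K n)}
    (hw : ∀ i, adR (coordB K (Sum.inr i)) w = 0) : ∃ f, mulBall K n f = w := by
  have h2 := eq_mulOp_of_commute h0 h1 hdisc w.2 fun i =>
    (adR_map (unitBall (DiffOp K n)).subtype (coordB K (Sum.inr i)) w).symm.trans
      (congrArg Subtype.val (hw i))
  refine ⟨⟨opHom K n w 1, ?_⟩, Subtype.ext h2.symm⟩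
  change ‖_‖ ≤ 1
  rw [← norm_mulOp, ← h2]
  exact w.2

include h0 h1 hdisc hK in
-- D° is a tower of Ore extensions by the ∂ᵢ: bracketing with xᵢ is nilpotent on all of D°, and the
-- common centralizer of the xᵢ is A°.
theorem isNoetherianRing_unitBall_diffOp [CompleteSpace K] :
    IsNoetherianRing (unitBall (DiffOp K n)) := by
  have := isNoetherianRing_unitBall_tate (n := n) h0 h1 hdisc hK
  refine (ballSystem hK).isNoetherianRing ?_
  have hmem : ∀ f, mulBall K n f ∈ (ballSystem hK).ring ∅ := fun f =>
    (ballSystem hK).mem_ring.mpr fun i _ => by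
      rw [adR_apply, sub_eq_zero]
      refine Subtype.ext ?_
      change mulOp K n f.1 * mulOp K n (tateX K i) = mulOp K n (tateX K i) * mulOp K n f.1
      rw [← map_mul, ← map_mul, mul_comm]
  refine isNoetherianRing_of_surjective _ _ ((mulBall K n).codRestrict _ hmem) ?_
  rintro ⟨w, hw⟩
  obtain ⟨f, hf⟩ := exists_eq_mulBall h0 h1 hdisc fun i =>
    (ballSystem hK).mem_ring.mp hw i (Finset.notMem_empty i)
  exact ⟨f, Subtype.ext hf⟩

include h0 h1 hdisc hK in
-- The opposite ring is needed for flatness of D̂ on the other side; the same tower works with the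
-- dual coordinates negated.
theorem isNoetherianRing_unitBall_diffOp_op [CompleteSpace K] :
    IsNoetherianRing (unitBall (DiffOp K n))ᵐᵒᵖ := by
  have := isNoetherianRing_unitBall_tate (n := n) h0 h1 hdisc hK
  set C := (ballSystem (n := n) hK).op
  refine C.isNoetherianRing ?_
  let φ : unitBall (TateAlgebra K n) →+* (unitBall (DiffOp K n))ᵐᵒᵖ :=
    (mulBall K n).op.comp (RingEquiv.toOpposite _).toRingHom
  have hadR : ∀ i w, adR (C.b i) (MulOpposite.op w) =
    MulOpposite.op (adR (coordB K (Sum.inr i)) w) := fun i w => adR_op _ w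
  have hmem : ∀ f, φ f ∈ C.ring ∅ := fun f =>
    C.mem_ring.mpr fun i _ => by
      refine (hadR i (mulBall K n f)).trans ?_
      refine MulOpposite.unop_injective ?_
      change adR _ _ = 0
      rw [adR_apply, sub_eq_zero]
      refine Subtype.ext ?_
      change mulOp K n f.1 * mulOp K n (tateX K i) = mulOp K n (tateX K i) * mulOp K n f.1
      rw [← map_mul, ← map_mul, mul_comm]
  refine isNoetherianRing_of_surjective _ _ (φ.codRestrict _ hmem) ?_
  rintro ⟨w, hw⟩
  obtain ⟨f, hf⟩ := exists_eq_mulBall h0 h1 hdisc (w := w.unop) fun i =>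
    MulOpposite.op_injective ((hadR i w.unop).symm.trans (C.mem_ring.mp hw i (Finset.notMem_empty i)))
  exact ⟨f, Subtype.ext (MulOpposite.unop_injective hf)⟩

include h0 h1 hdisc hK in
theorem vflat_toCompleted [CompleteSpace K] : VFlat (toCompleted K n) := by
  have := isNoetherianRing_unitBall_diffOp (n := n) h0 h1 hdisc hK
  exact vflat_of_dense h0 h1 norm_toCompleted (algebraMap_completed ϖ).symm
    (norm_completed_discrete h0 h1 hdisc) denseRange_toCompleted

include h0 h1 hdisc hK in
theorem vflat_op_toCompleted [CompleteSpace K] : VFlat (toCompleted K n).op := by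
  have := isNoetherianRing_unitBall_diffOp_op (n := n) h0 h1 hdisc hK
  exact vflat_op_of_dense h0 h1 norm_toCompleted (algebraMap_completed ϖ).symm
    (norm_completed_discrete h0 h1 hdisc) denseRange_toCompleted

include h0 h1 hdisc hK in
theorem isNoetherianRing_diffOp [CompleteSpace K] : IsNoetherianRing (DiffOp K n) := by
  have := isNoetherianRing_unitBall_diffOp (n := n) h0 h1 hdisc hK
  exact (isLocalizationAt_unitBall (E := DiffOp K n) h0 h1).isNoetherianRing

include h0 h1 hdisc hK in
theorem isNoetherianRing_residueRing : IsNoetherianRing (residueRing (CompletedWeylAlgebra K n)) :=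
  (residueSystem hK).isNoetherianRing
    ((isWeyl_residueSystem (n := n) h0 h1 hdisc hK).isNoetherianRing_ring ∅)

include h0 h1 hdisc hK in
theorem isNoetherianRing_completed : IsNoetherianRing (CompletedWeylAlgebra K n) := by
  have := isNoetherianRing_residueRing (n := n) h0 h1 hdisc hK
  have := (isPiComplete_unitBall (E := CompletedWeylAlgebra K n) h0 h1
    (norm_completed_discrete h0 h1 hdisc)).isNoetherianRing
  exact (isLocalizationAt_unitBall (E := CompletedWeylAlgebra K n) h0 h1).isNoetherianRing

include h0 h1 hdisc hK in
-- The reduction of D̂° is the Weyl algebra, where the bound n holds for finitely generated modules;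
-- it lifts to lattices and then passes to D̂.
theorem globalDim_completed_le : globalDim (CompletedWeylAlgebra K n) ≤ n := by
  have := isNoetherianRing_residueRing (n := n) h0 h1 hdisc hK
  exact (isPiComplete_unitBall (E := CompletedWeylAlgebra K n) h0 h1
    (norm_completed_discrete h0 h1 hdisc)).globalDim_le
    (isLocalizationAt_unitBall (E := CompletedWeylAlgebra K n) h0 h1)
    fun M _ => (isWeyl_residueSystem (n := n) h0 h1 hdisc hK).killsEnd_id M

end Conclusions

/-! ## Exactness of Koszul complexes with one-sided inverses -/

section Koszul

variable {K : Type u} [CommRing K] {n : ℕ} {V : Type u} [AddCommGroup V] [Module K V]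
  {δ : Fin n → Module.End K V} {σ : Fin n → V →+ V}

theorem formSign_mul_self (J : Finset (Fin n)) (j : Fin n) : formSign J j * formSign J j = 1 := by
  rw [formSign, ← pow_add, ← two_mul, pow_mul]
  simp

theorem formDifferential_eq_sum (δ : Fin n → Module.End K V) {k : ℕ} {ω : FormIndex n k → V}
    {F : Finset (Fin n) → V} (hF : ∀ I : FormIndex n k, F I.1 = ω I) (J : FormIndex n (k + 1)) :
    formDifferential δ k ω J = ∑ j ∈ J.1, formSign J.1 j • δ j (F (J.1.erase j)) := by
  rw [formDifferential_apply, ← Finset.sum_coe_sort J.1]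
  exact Finset.sum_congr rfl fun j _ => by rw [← hF]; rfl

/-- Contraction with xᵢ, corrected by σ i, is a homotopy in the i-th direction. Subtracting its
coboundary kills the components without dxᵢ and replaces the others by their remainder under 1 - δ i
σ i. -/
theorem exists_formDifferential_homotopy (i : Fin n) (hσδ : ∀ v, σ i (δ i v) = v)
    (hσ : ∀ j, j ≠ i → ∀ v, σ i (δ j v) = δ j (σ i v)) {k : ℕ} (ω : FormIndex n (k + 1) → V)
    (hω : formDifferential δ (k + 1) ω = 0) :
    ∃ η : FormIndex n k → V, ∀ J, ω J - formDifferential δ k η J =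
      if i ∈ J.1 then ω J - δ i (σ i (ω J)) else 0 := by
  classical
  let F : Finset (Fin n) → V := fun I => if h : I.card = k + 1 then ω ⟨I, h⟩ else 0
  have hF : ∀ I : FormIndex n (k + 1), F I.1 = ω I := fun I => by simp [F, I.2]
  -- The primitive is supported on forms without dxᵢ.
  let G : Finset (Fin n) → V := fun I =>
    if i ∈ I then 0 else formSign (insert i I) i • σ i (F (insert i I))
  refine ⟨fun I => G I.1, fun J => ?_⟩
  rw [formDifferential_eq_sum δ (F := G) (fun _ => rfl) J]
  split_ifs with hi
  · congr 1
    rw [Finset.sum_eq_single_of_mem i hi]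
    · simp only [G, Finset.mem_erase, ne_eq, not_true_eq_false, false_and, if_false,
        Finset.insert_erase hi]
      rw [map_zsmul, smul_smul, formSign_mul_self, one_smul, hF]
    · intro j _ hj
      simp only [G]
      rw [if_pos (Finset.mem_erase.mpr ⟨hj.symm, hi⟩), map_zero, smul_zero]
  · have hJ' : (insert i J.1).card = k + 1 + 1 := by rw [Finset.card_insert_of_notMem hi, J.2]
    have h1 := congrFun hω ⟨insert i J.1, hJ'⟩
    rw [formDifferential_eq_sum δ hF, Finset.sum_insert hi, Finset.erase_insert hi, hF] at h1
    have h2 := congrArg (σ i) h1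
    rw [map_add, map_zsmul, hσδ, map_sum, Pi.zero_apply, map_zero] at h2
    have h3 : ∑ j ∈ J.1, formSign J.1 j • δ j (G (J.1.erase j)) =
        -(formSign (insert i J.1) i • ∑ j ∈ J.1,
          σ i (formSign (insert i J.1) j • δ j (F ((insert i J.1).erase j)))) := by
      rw [Finset.smul_sum, ← Finset.sum_neg_distrib]
      refine Finset.sum_congr rfl fun j hj => ?_
      have hij : j ≠ i := fun h => hi (h ▸ hj)
      have h4 : insert i (J.1.erase j) = (insert i J.1).erase j :=
        (Finset.erase_insert_of_ne hij.symm).symm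
      have h5 := formSign_anticomm (insert i J.1) (Finset.mem_insert_self i _)
        (Finset.mem_insert_of_mem hj) hij.symm
      rw [Finset.erase_insert hi] at h5
      -- This is `formSign_anticomm` after cancelling signs, each of which squares to 1.
      have h6 : formSign J.1 j * formSign ((insert i J.1).erase j) i =
          -(formSign (insert i J.1) i * formSign (insert i J.1) j) := by
        have h8 := formSign_mul_self (insert i J.1) j
        have h9 := formSign_mul_self J.1 j
        generalize formSign (insert i J.1) i = a at *
        generalize formSign (insert i J.1) j = b at *
        generalize formSign J.1 j = c at *
        linear_combination b * c * h5 - c * formSign ((insert i J.1).erase j) i * h8 - a * b * h9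
      simp only [G]
      rw [if_neg fun h => hi (Finset.mem_of_mem_erase h), h4, map_zsmul, map_zsmul, smul_smul,
        smul_smul, hσ j hij, h6, neg_smul]
    rw [h3, sub_neg_eq_add]
    have h4 := congrArg (fun v => formSign (insert i J.1) i • v) h2
    dsimp only at h4
    rwa [smul_add, smul_smul, formSign_mul_self, one_smul, smul_zero] at h4

/-- Directions are treated one after another; subtracting a coboundary keeps the form closed, and
the remainders compose. -/
theorem exists_formDifferential_list (hδ : ∀ i j, Commute (δ i) (δ j))
    (hσδ : ∀ i v, σ i (δ i v) = v)
    (hσ : ∀ i j, j ≠ i → ∀ v, σ i (δ j v) = δ j (σ i v)) {k : ℕ} (ω : FormIndex n (k + 1) → V)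
    (hω : formDifferential δ (k + 1) ω = 0) (L : List (Fin n)) :
    ∃ η : FormIndex n k → V, ∀ J, ω J - formDifferential δ k η J =
      if ∀ i ∈ L, i ∈ J.1 then L.foldr (fun i v => v - δ i (σ i v)) (ω J) else 0 := by
  induction L with
  | nil => exact ⟨0, fun J => by simp⟩
  | cons i L ih =>
    obtain ⟨η, hη⟩ := ih
    obtain ⟨η', hη'⟩ := exists_formDifferential_homotopy i (hσδ i) (hσ i)
      (ω - formDifferential δ k η) (by
        rw [map_sub, hω, zero_sub, neg_eq_zero]
        exact LinearMap.congr_fun (formDifferential_comp δ hδ k) η)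
    refine ⟨η + η', fun J => ?_⟩
    have h1 := hη' J
    rw [Pi.sub_apply, hη J] at h1
    rw [map_add, Pi.add_apply, ← sub_sub, hη J, h1]
    by_cases h2 : ∀ j ∈ L, j ∈ J.1
    · rw [if_pos h2]
      by_cases h3 : i ∈ J.1
      · rw [if_pos h3, if_pos (List.forall_mem_cons.mpr ⟨h3, h2⟩)]
        rfl
      · rw [if_neg h3, if_neg fun h => h3 (List.forall_mem_cons.mp h).1]
    · rw [if_neg h2, if_neg fun h => h2 (List.forall_mem_cons.mp h).2]
      simp

theorem formComplex_d_apply (hδ : ∀ i j, Commute (δ i) (δ j)) (k : ℕ) (ω : FormIndex n k → V) :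
    ((formComplex δ hδ).d k (k + 1)).hom ω = formDifferential δ k ω := by
  rw [formComplex_d]
  rfl

theorem formComplex_exactAt_succ (hδ : ∀ i j, Commute (δ i) (δ j)) {k : ℕ}
    (h : ∀ ω : FormIndex n (k + 1) → V, formDifferential δ (k + 1) ω = 0 →
      ∃ η, formDifferential δ k η = ω) : (formComplex δ hδ).ExactAt (k + 1) := by
  rw [HomologicalComplex.exactAt_iff' _ k (k + 1) (k + 1 + 1) (by simp) (by simp),
    ShortComplex.moduleCat_exact_iff]
  intro x hx
  have hx' : formDifferential δ (k + 1) x = 0 := (formComplex_d_apply hδ (k + 1) x).symm.trans hx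
  obtain ⟨η, hη⟩ := h x hx'
  exact ⟨η, (formComplex_d_apply hδ k η).trans hη⟩

theorem formComplex_exactAt_zero (hδ : ∀ i j, Commute (δ i) (δ j))
    (h : ∀ ω : FormIndex n 0 → V, formDifferential δ 0 ω = 0 → ω = 0) :
    (formComplex δ hδ).ExactAt 0 := by
  rw [HomologicalComplex.exactAt_iff' _ 0 0 1 (by simp) (by simp),
    ShortComplex.moduleCat_exact_iff]
  intro x hx
  have hx' : formDifferential δ 0 x = 0 := (formComplex_d_apply hδ 0 x).symm.trans hx
  have h0 := h x hx'
  exact ⟨0, (map_zero _).trans h0.symm⟩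

/-- After all directions only the component of dx₁ ∧ ⋯ ∧ dxₙ can survive, and its coefficient is the
total remainder assumed to vanish. -/
theorem formComplex_exactAt (hδ : ∀ i j, Commute (δ i) (δ j)) (hσδ : ∀ i v, σ i (δ i v) = v)
    (hσ : ∀ i j, j ≠ i → ∀ v, σ i (δ j v) = δ j (σ i v)) {k : ℕ}
    (hk : k = n → ∀ v, (List.finRange n).foldr (fun i v => v - δ i (σ i v)) v = 0) : (formComplex δ hδ).ExactAt k := by
  cases k with
  | zero =>
    refine formComplex_exactAt_zero hδ fun ω hω => funext fun I => ?_
    -- Degree zero has no primitives: for n = 0 it is the top degree, and otherwise the first δ is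
    -- injective.
    rcases Nat.eq_zero_or_pos n with rfl | hn
    · exact hk rfl (ω I)
    · have hc : ({⟨0, hn⟩} : Finset (Fin n)).card = 0 + 1 := rfl
      have h1 := congrFun hω ⟨{⟨0, hn⟩}, hc⟩
      rw [formDifferential_eq_sum δ (F := fun _ => ω I) (fun J => congrArg ω (Subtype.ext
        ((Finset.card_eq_zero.mp I.2).trans (Finset.card_eq_zero.mp J.2).symm))),
        Finset.sum_singleton] at h1
      have h2 := congrArg (fun v => σ ⟨0, hn⟩ (formSign {⟨0, hn⟩} ⟨0, hn⟩ • v)) h1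
      dsimp only at h2
      rw [smul_smul, formSign_mul_self, one_smul, hσδ, Pi.zero_apply, smul_zero, map_zero] at h2
      exact h2
  | succ k =>
    refine formComplex_exactAt_succ hδ fun ω hω => ?_
    obtain ⟨η, hη⟩ := exists_formDifferential_list hδ hσδ hσ ω hω (List.finRange n)
    refine ⟨η, funext fun J => (sub_eq_zero.mp ((hη J).trans ?_)).symm⟩
    split_ifs with h
    · refine hk ?_ _
      have h2 : J.1 = Finset.univ := Finset.eq_univ_iff_forall.mpr fun i => h i (List.mem_finRange i)
      rw [← J.2, h2, Finset.card_univ, Fintype.card_fin]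
    · rfl

theorem formComplex_exactAt_of_lt (hδ : ∀ i j, Commute (δ i) (δ j)) {k : ℕ} (hk : n < k) :
    (formComplex δ hδ).ExactAt k := by
  obtain ⟨k, rfl⟩ := Nat.exists_eq_succ_of_ne_zero (Nat.ne_zero_of_lt hk)
  refine formComplex_exactAt_succ hδ fun ω _ => ⟨0, funext fun J => absurd (J.1.card_le_univ) ?_⟩
  rw [J.2, Fintype.card_fin]
  omega

end Koszul

/-! ## Division by the partial derivatives -/

noncomputable section Division

variable {K : Type u} [NontriviallyNormedField K] [IsUltrametricDist K] {n : ℕ}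

theorem adR_coordX_del_pow (i : Fin n) (j : ℕ) :
    adR (coordX K i) (del K i ^ (j + 1)) = (j + 1 : ℕ) • del K i ^ j := by
  induction j with
  | zero => simp [adR_coordX_del]
  | succ j ih =>
    rw [pow_succ _ (j + 1), adR_mul, ih, adR_coordX_del, if_pos rfl, mul_one, smul_mul_assoc,
      ← pow_succ, ← succ_nsmul]

theorem norm_adR_coordX_le (i : Fin n) (d : DiffOp K n) : ‖adR (coordX K i) d‖ ≤ ‖d‖ := by
  rw [adR_apply, sub_eq_add_neg]
  refine (IsUltrametricDist.norm_add_le_max _ _).trans (max_le ?_ ?_)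
  · refine (norm_mul_le _ _).trans_eq ?_
    rw [norm_coordX, mul_one]
  · rw [norm_neg]
    refine (norm_mul_le _ _).trans_eq ?_
    rw [norm_coordX, one_mul]

theorem norm_iterate_adR_coordX_le (i : Fin n) (d : DiffOp K n) (j : ℕ) :
    ‖(adR (coordX K i))^[j] d‖ ≤ ‖d‖ := by
  induction j with
  | zero => exact le_rfl
  | succ j ih =>
    rw [Function.iterate_succ_apply']
    exact (norm_adR_coordX_le i _).trans ih

theorem adR_smul (a : K) (b d : DiffOp K n) : adR b (a • d) = a • adR b d := by
  rw [adR_apply, adR_apply, smul_mul_assoc, mul_smul_comm, smul_sub]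

/-- The coefficients `(-1)^j / j!`. -/
def expCoeff (K : Type u) [NontriviallyNormedField K] (j : ℕ) : K := (-1) ^ j * ((j.factorial : K))⁻¹

variable (hK : ∀ m : ℕ, m ≠ 0 → ‖(m : K)‖ = 1)

section

include hK

omit [IsUltrametricDist K] in
theorem norm_expCoeff (j : ℕ) : ‖expCoeff K j‖ = 1 := by
  rw [expCoeff, norm_mul, norm_pow, norm_neg, norm_one, one_pow, one_mul, norm_inv,
    hK _ j.factorial_ne_zero, inv_one]

omit [IsUltrametricDist K] in
theorem expCoeff_succ (j : ℕ) : expCoeff K (j + 1) * ((j + 1 : ℕ) : K) = -expCoeff K j := by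
  have h1 : ((j + 1 : ℕ) : K) ≠ 0 := fun h => by
    have := hK (j + 1) j.succ_ne_zero
    rw [h, norm_zero] at this
    exact zero_ne_one this
  rw [expCoeff, expCoeff, Nat.factorial_succ, Nat.cast_mul, mul_inv_rev, pow_succ, mul_assoc,
    inv_mul_cancel_right₀ h1]
  ring

/-- The remainder is the alternating Taylor sum ∑ (-1)^j/j! ∂ᵢ^j [·, xᵢ]^j(d), whose bracket with xᵢ
telescopes to zero. The quotient is bounded by d because factorials have norm 1. -/
theorem exists_adR_sub_del_mul (i : Fin n) (d : DiffOp K n) :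
    ∃ s, adR (coordX K i) (d - del K i * s) = 0 ∧ ‖s‖ ≤ ‖d‖ := by
  obtain ⟨N, hN⟩ := mem_nilSubring_coordX i d
  let A : ℕ → DiffOp K n := fun j => (adR (coordX K i))^[j] d
  have hA : ∀ j, adR (coordX K i) (A j) = A (j + 1) := fun j =>
    (Function.iterate_succ_apply' _ _ _).symm
  have hAN : A (N + 1) = 0 := by rw [← hA, show A N = 0 from hN, map_zero]
  let T : ℕ → DiffOp K n := fun j => expCoeff K j • (del K i ^ j * A j)
  -- The terms of positive degree in the Taylor sum, with one ∂ᵢ removed on the left.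
  let s := -∑ j ∈ Finset.range N, expCoeff K (j + 1) • (del K i ^ j * A (j + 1))
  have hs : d - del K i * s = ∑ j ∈ Finset.range (N + 1), T j := by
    rw [Finset.sum_range_succ', mul_neg, sub_neg_eq_add, Finset.mul_sum, add_comm]
    congr 1
    · refine Finset.sum_congr rfl fun j _ => ?_
      rw [mul_smul_comm, ← mul_assoc, ← pow_succ']
    · simp [T, A, expCoeff]
  have hT : ∀ m, adR (coordX K i) (∑ j ∈ Finset.range (m + 1), T j) =
      expCoeff K m • (del K i ^ m * A (m + 1)) := by
    intro m
    induction m with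
    | zero => simp [T, A, adR_smul]
    | succ m ih =>
      rw [Finset.sum_range_succ, map_add, ih]
      have h1 : adR (coordX K i) (T (m + 1)) = -(expCoeff K m • (del K i ^ m * A (m + 1))) +
          expCoeff K (m + 1) • (del K i ^ (m + 1) * A (m + 1 + 1)) := by
        rw [adR_smul, adR_mul, hA, adR_coordX_del_pow, smul_add, smul_mul_assoc,
          ← Nat.cast_smul_eq_nsmul K, smul_smul, expCoeff_succ hK, neg_smul]
      rw [h1, add_neg_cancel_left]
  refine ⟨s, ?_, ?_⟩
  · rw [hs, hT, hAN, mul_zero, smul_zero]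
  · rw [norm_neg]
    refine IsUltrametricDist.norm_sum_le_of_forall_le_of_nonneg (norm_nonneg d) fun j _ => ?_
    rw [norm_smul, norm_expCoeff hK, one_mul]
    refine (norm_mul_le _ _).trans ((mul_le_of_le_one_left (norm_nonneg _) ?_).trans
      (norm_iterate_adR_coordX_le i d (j + 1)))
    exact (norm_pow_le _ _).trans (pow_le_one₀ (norm_nonneg _) (norm_del_le i))

/-- Uniqueness of the quotient. Bracketing s = -∂ᵢ[s, xᵢ] repeatedly shows that each iterated
bracket of s vanishes if the next one does, and bracketing is nilpotent. -/
theorem eq_zero_of_adR_del_mul (i : Fin n) {s : DiffOp K n}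
    (hs : adR (coordX K i) (del K i * s) = 0) : s = 0 := by
  have h1 : s = -(del K i * adR (coordX K i) s) := by
    rw [adR_mul, adR_coordX_del, if_pos rfl, one_mul] at hs
    exact eq_neg_of_add_eq_zero_left hs
  have h2 : ∀ N, (N + 1 : ℕ) • (adR (coordX K i))^[N] s =
      -(del K i * (adR (coordX K i))^[N + 1] s) := by
    intro N
    induction N with
    | zero => simpa using h1
    | succ N ih =>
      have h3 := congrArg (adR (coordX K i)) ih
      rw [map_nsmul, map_neg, adR_mul, adR_coordX_del, if_pos rfl, one_mul,
        ← Function.iterate_succ_apply' (adR (coordX K i)),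
        ← Function.iterate_succ_apply' (adR (coordX K i)), neg_add] at h3
      rw [succ_nsmul, h3]
      abel
  obtain ⟨N, hN⟩ := mem_nilSubring_coordX i s
  by_contra hne
  have hex : ∃ N, (adR (coordX K i))^[N] s = 0 := ⟨N, hN⟩
  classical
  obtain ⟨m, hm⟩ := Nat.exists_eq_succ_of_ne_zero (n := Nat.find hex) fun h => hne (by
    have := Nat.find_spec hex
    rwa [h] at this)
  have h3 := Nat.find_spec hex
  rw [hm] at h3
  have h4 := h2 m
  rw [h3, mul_zero, neg_zero, ← Nat.cast_smul_eq_nsmul K] at h4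
  refine Nat.find_min hex (m := m) (by omega) ((smul_eq_zero.mp h4).resolve_left fun h => ?_)
  have := hK (m + 1) m.succ_ne_zero
  rw [h, norm_zero] at this
  exact zero_ne_one this

theorem eq_of_adR_sub_del_mul (i : Fin n) {d s s' : DiffOp K n}
    (hs : adR (coordX K i) (d - del K i * s) = 0) (hs' : adR (coordX K i) (d - del K i * s') = 0) :
    s = s' := by
  refine sub_eq_zero.mp (eq_zero_of_adR_del_mul hK i ?_)
  rw [show del K i * (s - s') = (d - del K i * s') - (d - del K i * s) by noncomm_ring, map_sub, hs,
    hs', sub_zero]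

end

/-- Division by `∂_i` on the left, discarding the remainder. -/
def divDel (hK : ∀ m : ℕ, m ≠ 0 → ‖(m : K)‖ = 1) (i : Fin n) : DiffOp K n →+ DiffOp K n :=
  AddMonoidHom.mk' (fun d => (exists_adR_sub_del_mul hK i d).choose) fun d d' => by
    refine eq_of_adR_sub_del_mul hK i (exists_adR_sub_del_mul hK i (d + d')).choose_spec.1 ?_
    rw [show d + d' - del K i * ((exists_adR_sub_del_mul hK i d).choose +
      (exists_adR_sub_del_mul hK i d').choose) =
      (d - del K i * (exists_adR_sub_del_mul hK i d).choose) +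
        (d' - del K i * (exists_adR_sub_del_mul hK i d').choose) by noncomm_ring, map_add,
      (exists_adR_sub_del_mul hK i d).choose_spec.1, (exists_adR_sub_del_mul hK i d').choose_spec.1,
      add_zero]

theorem adR_sub_del_mul_divDel (i : Fin n) (d : DiffOp K n) :
    adR (coordX K i) (d - del K i * divDel hK i d) = 0 :=
  (exists_adR_sub_del_mul hK i d).choose_spec.1

theorem norm_divDel_le (i : Fin n) (d : DiffOp K n) : ‖divDel hK i d‖ ≤ ‖d‖ :=
  (exists_adR_sub_del_mul hK i d).choose_spec.2

theorem divDel_eq {i : Fin n} {d s : DiffOp K n} (h : adR (coordX K i) (d - del K i * s) = 0) :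
    divDel hK i d = s := eq_of_adR_sub_del_mul hK i (adR_sub_del_mul_divDel hK i d) h

theorem divDel_del_mul (i : Fin n) (d : DiffOp K n) : divDel hK i (del K i * d) = d :=
  divDel_eq hK (by rw [sub_self, map_zero])

theorem divDel_del_mul_of_ne {i j : Fin n} (h : j ≠ i) (d : DiffOp K n) :
    divDel hK i (del K j * d) = del K j * divDel hK i d := by
  refine divDel_eq hK ?_
  rw [← mul_assoc, (del_commute K i j).eq, mul_assoc, ← mul_sub, adR_mul, adR_coordX_del,
    if_neg h.symm, zero_mul, adR_sub_del_mul_divDel, mul_zero, add_zero]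

theorem adR_adR_coordX (i j : Fin n) (d : DiffOp K n) :
    adR (coordX K i) (adR (coordX K j) d) = adR (coordX K j) (adR (coordX K i) d) := by
  have h := (coordX_commute (K := K) i j).eq
  simp only [adR_apply, sub_mul, mul_sub]
  rw [mul_assoc d, mul_assoc d, h, ← mul_assoc _ _ d, ← mul_assoc _ _ d, h]
  noncomm_ring

/-- Taking the remainder in direction i does not spoil a remainder already taken in direction j; by
uniqueness the quotient also commutes with xⱼ. -/
theorem adR_divDel {i j : Fin n} (h : j ≠ i) {d : DiffOp K n} (hd : adR (coordX K j) d = 0) :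
    adR (coordX K j) (d - del K i * divDel hK i d) = 0 := by
  have h1 : adR (coordX K j) (divDel hK i d) = 0 := by
    refine eq_zero_of_adR_del_mul hK i ?_
    have h2 := congrArg (adR (coordX K j)) (adR_sub_del_mul_divDel hK i d)
    rw [map_zero, adR_adR_coordX, map_sub, hd, zero_sub, map_neg, neg_eq_zero, adR_mul,
      adR_coordX_del, if_neg h, zero_mul, zero_add] at h2
    exact h2
  rw [map_sub, hd, adR_mul, adR_coordX_del, if_neg h, zero_mul, h1, mul_zero, add_zero, sub_zero]

theorem adR_foldr_divDel (L : List (Fin n)) (d : DiffOp K n) {j : Fin n} (hj : j ∈ L) :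
    adR (coordX K j) (L.foldr (fun i v => v - del K i * divDel hK i v) d) = 0 := by
  induction L with
  | nil => simp at hj
  | cons i L ih =>
    rw [List.foldr_cons]
    by_cases h : j = i
    · rw [h]
      exact adR_sub_del_mul_divDel hK i _
    · exact adR_divDel hK h (ih ((List.mem_cons.mp hj).resolve_left h))

/-- The extension of `divDel` to the completed Weyl algebra. -/
def divDelHat (hK : ∀ m : ℕ, m ≠ 0 → ‖(m : K)‖ = 1) (i : Fin n) :
    CompletedWeylAlgebra K n →+ CompletedWeylAlgebra K n :=
  AddMonoidHom.completion (divDel hK i)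
    (AddMonoidHomClass.continuous_of_bound (divDel hK i) 1 fun d => by
      rw [one_mul]
      exact norm_divDel_le hK i d)

theorem divDelHat_coe (i : Fin n) (d : DiffOp K n) :
    divDelHat hK i (toCompleted K n d) = toCompleted K n (divDel hK i d) :=
  AddMonoidHom.completion_coe _ _ d

theorem continuous_divDelHat (i : Fin n) : Continuous (divDelHat (n := n) hK i) :=
  AddMonoidHom.continuous_completion (divDel hK i) _

theorem divDelHat_del_mul (i : Fin n) (x : CompletedWeylAlgebra K n) :
    divDelHat hK i (toCompleted K n (del K i) * x) = x := by
  refine completed_induction (isClosed_eq ((continuous_divDelHat hK i).comp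
    (continuous_const.mul continuous_id)) continuous_id) (fun d => ?_) x
  change divDelHat hK i (toCompleted K n (del K i) * toCompleted K n d) = toCompleted K n d
  rw [← map_mul, divDelHat_coe, divDel_del_mul]

theorem divDelHat_del_mul_of_ne {i j : Fin n} (h : j ≠ i) (x : CompletedWeylAlgebra K n) :
    divDelHat hK i (toCompleted K n (del K j) * x) = toCompleted K n (del K j) * divDelHat hK i x := by
  refine completed_induction (isClosed_eq ((continuous_divDelHat hK i).comp
    (continuous_const.mul continuous_id)) (continuous_const.mul (continuous_divDelHat hK i)))
    (fun d => ?_) x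
  change divDelHat hK i (toCompleted K n (del K j) * toCompleted K n d) =
    toCompleted K n (del K j) * divDelHat hK i (toCompleted K n d)
  rw [← map_mul, divDelHat_coe, divDel_del_mul_of_ne hK h, divDelHat_coe, map_mul]

theorem eq_mulOp_of_forall_adR {ϖ : K} (h0 : ϖ ≠ 0) (h1 : ‖ϖ‖ < 1)
    (hdisc : ∀ a : K, ‖a‖ < 1 → ‖a‖ ≤ ‖ϖ‖) {d : DiffOp K n}
    (hx : ∀ i, adR (coordX K i) d = 0) : d = mulOp K n (opHom K n d 1) := by
  obtain ⟨k, t, ht⟩ := (isLocalizationAt_unitBall (E := DiffOp K n) h0 h1).surj d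
  have h2 : ϖ ^ k • d = t.1 := by
    rw [Algebra.smul_def, map_pow]
    exact ht
  have h3 := eq_mulOp_of_commute h0 h1 hdisc (d := ϖ ^ k • d) (h2 ▸ t.2) fun i => by
    rw [adR_smul, hx i, smul_zero]
  have h4 : opHom K n (ϖ ^ k • d) 1 = ϖ ^ k • opHom K n d 1 := rfl
  rw [h4, mulOp_smul] at h3
  exact smul_right_injective _ (pow_ne_zero k h0) h3

/-- On D the total remainder commutes with all xᵢ, hence is multiplication by a function. A is
complete and embeds isometrically in D̂, so continuity extends this to D̂. -/
theorem foldr_divDelHat_mem_range [CompleteSpace K] {ϖ : K} (h0 : ϖ ≠ 0) (h1 : ‖ϖ‖ < 1)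
    (hdisc : ∀ a : K, ‖a‖ < 1 → ‖a‖ ≤ ‖ϖ‖) (x : CompletedWeylAlgebra K n) :
    (List.finRange n).foldr (fun i v => v - toCompleted K n (del K i) * divDelHat hK i v) x ∈
      (toCompleted K n).range := by
  have hcont : ∀ L : List (Fin n), Continuous fun x =>
      L.foldr (fun i v => v - toCompleted K n (del K i) * divDelHat hK i v) x := by
    intro L
    induction L with
    | nil => exact continuous_id
    | cons i L ih =>
      simp only [List.foldr_cons]
      exact ih.sub (continuous_const.mul ((continuous_divDelHat hK i).comp ih))
  have hcoe : ∀ (L : List (Fin n)) (d : DiffOp K n),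
      L.foldr (fun i v => v - toCompleted K n (del K i) * divDelHat hK i v) (toCompleted K n d) =
        toCompleted K n (L.foldr (fun i v => v - del K i * divDel hK i v) d) := by
    intro L d
    induction L with
    | nil => rfl
    | cons i L ih =>
      simp only [List.foldr_cons]
      rw [ih, map_sub, map_mul, divDelHat_coe]
  let ψ := (toCompleted K n).comp (mulOp K n)
  have hψ : Isometry ψ := AddMonoidHomClass.isometry_of_norm ψ fun f => by
    rw [← norm_mulOp f, ← norm_toCompleted]
    rfl
  -- It is essential that remainders form the closed subspace A: the image of D itself need not be
  -- closed.
  have hclosed : IsClosed (Set.range ψ) := hψ.isClosedEmbedding.isClosed_range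
  have key : (List.finRange n).foldr
      (fun i v => v - toCompleted K n (del K i) * divDelHat hK i v) x ∈ Set.range ψ := by
    refine completed_induction (p := fun x => (List.finRange n).foldr
      (fun i v => v - toCompleted K n (del K i) * divDelHat hK i v) x ∈ Set.range ψ)
      (hclosed.preimage (hcont _)) (fun d => ?_) x
    rw [hcoe]
    refine ⟨_, congrArg (toCompleted K n) (eq_mulOp_of_forall_adR h0 h1 hdisc fun i =>
      adR_foldr_divDel hK (List.finRange n) d (List.mem_finRange i)).symm⟩
  obtain ⟨f, hf⟩ := key
  exact ⟨mulOp K n f, hf⟩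

end Division

/-! ## Comparison of de Rham complexes -/

section Acyclic

/-- The long exact homology sequence; in a degree without predecessor the monomorphism is inherited
directly. -/
theorem quasiIso_of_exactAt {C ι : Type*} [Category C] [Abelian C] {c : ComplexShape ι}
    {X : ShortComplex (HomologicalComplex C c)} (hX : X.ShortExact) (h : X.X₃.Acyclic) :
    QuasiIso X.f := by
  have h0 : ∀ i, Limits.IsZero (X.X₃.homology i) := fun i =>
    HomologicalComplex.exactAt_iff_isZero_homology _ _ |>.mp (h i)
  rw [quasiIso_iff]
  intro i
  rw [quasiIsoAt_iff_isIso_homologyMap]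
  have hmono : Mono (HomologicalComplex.homologyMap X.f i) := by
    by_cases hi : ∃ j, c.Rel j i
    · obtain ⟨j, hj⟩ := hi
      exact (hX.homology_exact₁ j i hj).mono_g ((h0 j).eq_of_src _ _)
    · have := hX.mono_f
      exact HomologicalComplex.mono_homologyMap_of_mono_of_not_rel X.f i (by simpa using hi)
  have hepi : Epi (HomologicalComplex.homologyMap X.f i) :=
    (hX.homology_exact₂ i).epi_f ((h0 i).eq_of_tgt _ _)
  exact isIso_of_mono_of_epi _

end Acyclic

noncomputable section DeRhamComparison

variable (K : Type u) [NontriviallyNormedField K] [IsUltrametricDist K] {n : ℕ}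

theorem deRhamMap_comp {X Y Z : ModuleCat.{u} (DiffOp K n)} (a : X ⟶ Y) (b : Y ⟶ Z) :
    deRhamMap K (a ≫ b) = deRhamMap K a ≫ deRhamMap K b := rfl

theorem deRhamMap_zero {X Y : ModuleCat.{u} (DiffOp K n)} :
    deRhamMap K (0 : X ⟶ Y) = 0 := rfl

/-- The short complex of de Rham complexes of a short complex of modules. -/
def deRhamShort (X : ShortComplex (ModuleCat.{u} (DiffOp K n))) :
    ShortComplex (CochainComplex (ModuleCat.{u} K) ℕ) :=
  ShortComplex.mk (deRhamMap K X.f) (deRhamMap K X.g) (by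
    rw [← deRhamMap_comp, X.zero, deRhamMap_zero])

theorem deRhamShort_shortExact {X : ShortComplex (ModuleCat.{u} (DiffOp K n))}
    (hX : X.ShortExact) : (deRhamShort K X).ShortExact := by
  have := hX.mono_f
  have := hX.epi_g
  have hi : Function.Injective X.f.hom := (ModuleCat.mono_iff_injective _).mp inferInstance
  have hs : Function.Surjective X.g.hom := (ModuleCat.epi_iff_surjective _).mp inferInstance
  have he : Function.Exact X.f.hom X.g.hom :=
    (ShortComplex.ShortExact.moduleCat_exact_iff_function_exact X).mp hX.exact
  refine HomologicalComplex.shortExact_of_degreewise_shortExact _ fun k => ?_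
  refine shortExact_of_exact (X := (deRhamShort K X).map (HomologicalComplex.eval _ _ k)) ?_ ?_ ?_
  · intro ω ω' h
    exact funext fun I => hi (congrFun h I)
  · intro ω
    constructor
    · intro h
      choose η hη using fun I => (he _).mp (congrFun h I)
      exact ⟨η, funext hη⟩
    · rintro ⟨η, rfl⟩
      exact funext fun I => (he _).mpr ⟨η I, rfl⟩
  · intro ω
    choose η hη using fun I => hs (ω I)
    exact ⟨η, funext hη⟩

variable {K}

/-- The partial inverses descend to Y/φ(X), where total remainders become zero, so its de Rham
complex is acyclic in every degree. -/
theorem quasiIso_deRhamMap {X Y : ModuleCat.{u} (DiffOp K n)} (φ : X ⟶ Y)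
    (hφ : Function.Injective φ.hom) (σ : Fin n → Y →+ Y) (hσδ : ∀ i y, σ i (del K i • y) = y)
    (hσ : ∀ i j, j ≠ i → ∀ y, σ i (del K j • y) = del K j • σ i y)
    (hσφ : ∀ i x, ∃ x', σ i (φ.hom x) = φ.hom x')
    (hproj : ∀ y, ∃ x, (List.finRange n).foldr (fun i v => v - del K i • σ i v) y = φ.hom x) :
    QuasiIso (deRhamMap K φ) := by
  let P : Submodule (DiffOp K n) Y := φ.hom.range
  let Z : ShortComplex (ModuleCat.{u} (DiffOp K n)) :=
    ShortComplex.mk (X₃ := ModuleCat.of _ (Y ⧸ P)) φ (ModuleCat.ofHom P.mkQ)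
      (ModuleCat.hom_ext (LinearMap.ext fun x =>
        (Submodule.Quotient.mk_eq_zero P).mpr ⟨x, rfl⟩))
  have hZ : Z.ShortExact := shortExact_of_exact (X := Z) hφ
    (fun y => Submodule.Quotient.mk_eq_zero P) P.mkQ_surjective
  let τ : Fin n → (Y ⧸ P) →+ (Y ⧸ P) := fun i =>
    QuotientAddGroup.map P.toAddSubgroup P.toAddSubgroup (σ i) (by
      rintro _ ⟨x, rfl⟩
      obtain ⟨x', hx'⟩ := hσφ i x
      exact ⟨x', hx'.symm⟩)
  refine quasiIso_of_exactAt (deRhamShort_shortExact K hZ) fun k => ?_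
  refine formComplex_exactAt (δ := delAction K Z.X₃) (σ := τ) (delAction_commute K Z.X₃) ?_ ?_ ?_
  · intro i v
    obtain ⟨y, rfl⟩ := P.mkQ_surjective v
    exact congrArg P.mkQ (hσδ i y)
  · intro i j hij v
    obtain ⟨y, rfl⟩ := P.mkQ_surjective v
    exact congrArg P.mkQ (hσ i j hij y)
  · intro _ v
    obtain ⟨y, rfl⟩ := P.mkQ_surjective v
    let q : Y → underlying K Z.X₃ := P.mkQ
    let τ' : Fin n → underlying K Z.X₃ →+ underlying K Z.X₃ := τ
    have key : ∀ L : List (Fin n), L.foldr (fun i v => v - delAction K Z.X₃ i (τ' i v)) (q y) =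
        q (L.foldr (fun i v => v - del K i • σ i v) y) := by
      intro L
      induction L with
      | nil => rfl
      | cons i L ih => exact congrArg (fun v => v - delAction K Z.X₃ i (τ' i v)) ih
    obtain ⟨x, hx⟩ := hproj y
    exact (key _).trans ((congrArg q hx).trans ((Submodule.Quotient.mk_eq_zero P).mpr ⟨x, rfl⟩))

section Free

variable [CompleteSpace K] {ϖ : K} (h0 : ϖ ≠ 0) (h1 : ‖ϖ‖ < 1)
  (hdisc : ∀ a : K, ‖a‖ < 1 → ‖a‖ ≤ ‖ϖ‖) (hK : ∀ m : ℕ, m ≠ 0 → ‖(m : K)‖ = 1)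

include h0 h1 hdisc hK

/-- Division by ∂ᵢ is applied coordinate by coordinate on D̂^m; it preserves D^m, and the total
remainders lie in D^m. -/
theorem quasiIso_deRhamComparison_free (m : ℕ) :
    QuasiIso (deRhamComparison K (ModuleCat.of (DiffOp K n) (Fin m → DiffOp K n))) := by
  let f := toCompleted K n
  have hf : Function.Injective f := (injective_iff_map_eq_zero f).mpr fun d hd => by
    rw [← norm_eq_zero, ← norm_toCompleted d]
    exact norm_eq_zero.mpr hd
  let F : ModuleCat.{u} (DiffOp K n) := ModuleCat.of (DiffOp K n) (Fin m → DiffOp K n)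
  let e : baseChange f F ≃+ (Fin m → CompletedWeylAlgebra K n) :=
    AddEquiv.ofBijective (bcFreeHom f m).hom.toAddMonoidHom (bcFreeHom_bijective f m)
  have he : ∀ s z, e (s • z) = s • e z := fun s z => map_smul (bcFreeHom f m).hom s z
  have het : ∀ (v : F) a, e (bcTmul f F 1 v) a = f ((show Fin m → DiffOp K n from v) a) :=
    fun v a => (congrFun (bcFreeHom_tmul f m 1 v) a).trans (one_mul _)
  let σ : Fin n → baseChange f F →+ baseChange f F := fun i =>
    AddMonoidHom.comp e.symm.toAddMonoidHom
      ((AddMonoidHom.compLeft (divDelHat hK i) (Fin m)).comp e.toAddMonoidHom)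
  have hσ : ∀ i z a, e (σ i z) a = divDelHat hK i (e z a) := fun i z a =>
    congrFun (e.apply_symm_apply _) a
  have hext : ∀ z z', (∀ a, e z a = e z' a) → z = z' := fun z z' h => e.injective (funext h)
  have hσδ : ∀ i z, σ i (f (del K i) • z) = z := fun i z => by
    refine hext _ _ fun a => ?_
    rw [hσ, he]
    exact divDelHat_del_mul hK i _
  have hσδ' : ∀ i j, j ≠ i → ∀ z, σ i (f (del K j) • z) = f (del K j) • σ i z := by
    intro i j hij z
    refine hext _ _ fun a => ?_
    rw [hσ, he, he, Pi.smul_apply, Pi.smul_apply, hσ]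
    exact divDelHat_del_mul_of_ne hK hij _
  have hσt : ∀ i v, ∃ v', σ i (bcTmul f F 1 v) = bcTmul f F 1 v' := by
    intro i v
    let v' : F := fun a => divDel hK i ((show Fin m → DiffOp K n from v) a)
    refine ⟨v', hext _ _ fun a => ?_⟩
    rw [hσ, het, het]
    exact divDelHat_coe hK i _
  have hproj : ∀ z, ∃ v, (List.finRange n).foldr (fun i v => v - f (del K i) • σ i v) z =
      bcTmul f F 1 v := by
    intro z
    have key : ∀ (L : List (Fin n)) a,
        e (L.foldr (fun i v => v - f (del K i) • σ i v) z) a =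
          L.foldr (fun i v => v - f (del K i) * divDelHat hK i v) (e z a) := by
      intro L a
      induction L with
      | nil => rfl
      | cons i L ih =>
        simp only [List.foldr_cons]
        rw [← ih, map_sub, he, Pi.sub_apply, Pi.smul_apply, hσ]
        rfl
    choose d hd using fun a => foldr_divDelHat_mem_range hK h0 h1 hdisc (e z a)
    let v : F := d
    refine ⟨v, hext _ _ fun a => ?_⟩
    rw [key, het]
    exact (hd a).symm
  refine quasiIso_deRhamMap (X := F) (Y := (ModuleCat.restrictScalars f).obj (baseChange f F))
    (toBaseChange f F) (fun v w h => funext fun a => hf ?_) σ hσδ hσδ' hσt hproj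
  refine (het v a).symm.trans (Eq.trans ?_ (het w a))
  exact congrArg (fun z => e z a) h

end Free

theorem toBaseChange_naturality {R S : Type u} [Ring R] [Ring S] (f : R →+* S)
    {M N : ModuleCat.{u} R} (g : M ⟶ N) :
    g ≫ toBaseChange f N = toBaseChange f M ≫ (ModuleCat.restrictScalars f).map (bcMap f g) :=
  ModuleCat.hom_ext (LinearMap.ext fun m => (bcMap_tmul f g 1 m).symm)

/-- The comparison of de Rham complexes for a short exact sequence of modules. -/
def comparisonShort (X : ShortComplex (ModuleCat.{u} (DiffOp K n))) :
    deRhamShort K X ⟶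
      deRhamShort K ((bcShortComplex (toCompleted K n) X).map
        (ModuleCat.restrictScalars (toCompleted K n))) where
  τ₁ := deRhamComparison K X.X₁
  τ₂ := deRhamComparison K X.X₂
  τ₃ := deRhamComparison K X.X₃
  comm₁₂ := congrArg (deRhamMap K) (toBaseChange_naturality (toCompleted K n) X.f).symm
  comm₂₃ := congrArg (deRhamMap K) (toBaseChange_naturality (toCompleted K n) X.g).symm

theorem restrictScalars_shortExact {R S : Type u} [Ring R] [Ring S] (f : R →+* S)
    {X : ShortComplex (ModuleCat.{u} S)} (hX : X.ShortExact) :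
    (X.map (ModuleCat.restrictScalars f)).ShortExact := by
  have := hX.mono_f
  have := hX.epi_g
  exact shortExact_of_exact (X := X.map (ModuleCat.restrictScalars f))
    ((ModuleCat.mono_iff_injective X.f).mp inferInstance)
    ((ShortComplex.ShortExact.moduleCat_exact_iff_function_exact X).mp hX.exact)
    ((ModuleCat.epi_iff_surjective X.g).mp inferInstance)

/-- A free presentation stays exact after completion by flatness. The four lemmas compare the two
long exact sequences, the free term being known in all degrees. -/
theorem quasiIso_deRhamComparison [CompleteSpace K] {ϖ : K} (h0 : ϖ ≠ 0) (h1 : ‖ϖ‖ < 1)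
    (hdisc : ∀ a : K, ‖a‖ < 1 → ‖a‖ ≤ ‖ϖ‖) (hK : ∀ m : ℕ, m ≠ 0 → ‖(m : K)‖ = 1)
    (M : ModuleCat.{u} (DiffOp K n)) [Module.Finite (DiffOp K n) M] :
    QuasiIso (deRhamComparison K M) := by
  have hflat := (vflat_toCompleted (n := n) h0 h1 hdisc hK).isFlat
  have := isNoetherianRing_diffOp (n := n) h0 h1 hdisc hK
  have hpres : ∀ M : ModuleCat.{u} (DiffOp K n), Module.Finite (DiffOp K n) M →
      ∃ X : ShortComplex (ModuleCat.{u} (DiffOp K n)), X.ShortExact ∧ X.X₃ = M ∧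
        QuasiIso (deRhamComparison K X.X₂) ∧ Module.Finite (DiffOp K n) X.X₁ := by
    intro M _
    obtain ⟨k, g, hg⟩ := Module.Finite.exists_fin (R := DiffOp K n) (M := M)
    refine ⟨presentationShort M g, presentationShort_shortExact M g hg, rfl,
      quasiIso_deRhamComparison_free h0 h1 hdisc hK k, ?_⟩
    exact inferInstanceAs (Module.Finite _ (LinearMap.ker (Fintype.linearCombination _ g)))
  -- Descending induction on the degree k, starting above n where both homologies vanish.
  have key : ∀ j : ℕ, ∀ k : ℕ, n + 1 ≤ k + j → ∀ M : ModuleCat.{u} (DiffOp K n),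
      Module.Finite (DiffOp K n) M →
      IsIso (HomologicalComplex.homologyMap (deRhamComparison K M) k) := by
    intro j
    induction j with
    | zero =>
      intro k hk M _
      have h2 : ∀ N : ModuleCat.{u} (DiffOp K n),
          Limits.IsZero ((deRham K N).homology k) := fun N =>
        (HomologicalComplex.exactAt_iff_isZero_homology _ _).mp
          (formComplex_exactAt_of_lt (delAction_commute K N) (by omega))
      exact ⟨0, (h2 _).eq_of_src _ _, (h2 _).eq_of_src _ _⟩
    | succ j ih =>
      intro k hk
      have hepi : ∀ M : ModuleCat.{u} (DiffOp K n), Module.Finite (DiffOp K n) M →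
          Epi (HomologicalComplex.homologyMap (deRhamComparison K M) k) := by
        intro M hM
        obtain ⟨X, hX, rfl, hX₂, hX₁⟩ := hpres M hM
        refine HomologicalComplex.HomologySequence.epi_homologyMap_τ₃ (comparisonShort X)
          (deRhamShort_shortExact K hX) (deRhamShort_shortExact K
            (restrictScalars_shortExact _ (hflat.shortExact hX))) k ?_ ?_ ?_
        · change Epi (HomologicalComplex.homologyMap (deRhamComparison K X.X₂) k)
          infer_instance
        · intro l hl
          have := ih l (by simp at hl; omega) X.X₁ hX₁
          change Epi (HomologicalComplex.homologyMap (deRhamComparison K X.X₁) l)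
          infer_instance
        · intro l _
          change Mono (HomologicalComplex.homologyMap (deRhamComparison K X.X₂) l)
          infer_instance
      intro M hM
      have h2 := hepi M hM
      obtain ⟨X, hX, rfl, hX₂, hX₁⟩ := hpres M hM
      -- Injectivity for M needs surjectivity for the syzygy in the same degree, which is why
      -- surjectivity was first proved for all modules.
      have h3 : Mono (HomologicalComplex.homologyMap (deRhamComparison K X.X₃) k) := by
        refine HomologicalComplex.HomologySequence.mono_homologyMap_τ₃ (comparisonShort X)
          (deRhamShort_shortExact K hX) (deRhamShort_shortExact K
            (restrictScalars_shortExact _ (hflat.shortExact hX))) k (hepi _ hX₁) ?_ ?_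
        · change Mono (HomologicalComplex.homologyMap (deRhamComparison K X.X₂) k)
          infer_instance
        · intro l hl
          have := ih l (by simp at hl; omega) X.X₁ hX₁
          change Mono (HomologicalComplex.homologyMap (deRhamComparison K X.X₁) l)
          infer_instance
      exact isIso_of_mono_of_epi _
  rw [quasiIso_iff]
  intro k
  rw [quasiIsoAt_iff_isIso_homologyMap]
  exact key (n + 1) k (by omega) M inferInstance

end DeRhamComparison

/-! ## Vanishing of `Ext` into the ring -/

section ExtRing

variable {R S : Type u} [Ring R] [Ring S]

theorem exists_finite_presentation [IsNoetherianRing R] (M : ModuleCat.{u} R) [Module.Finite R M] :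
    ∃ (k : ℕ) (A : ModuleCat.{u} R) (a : A ⟶ ModuleCat.of R (Fin k → R))
      (b : ModuleCat.of R (Fin k → R) ⟶ M) (w : a ≫ b = 0),
      (ShortComplex.mk a b w).ShortExact ∧ Module.Finite R A := by
  obtain ⟨k, g, hg⟩ := Module.Finite.exists_fin (R := R) (M := M)
  exact ⟨k, _, _, _, _, presentationShort_shortExact M g hg,
    inferInstanceAs (Module.Finite R (LinearMap.ker (Fintype.linearCombination R g)))⟩

/-- The values of ψ on generators solve the relations of N. Flatness of S on the left writes this
solution as a combination of solutions over R, which are homomorphisms from N to R. -/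
theorem exists_eq_sum_lift [IsNoetherianRing R] {f : R →+* S} (hf : VFlat f.op)
    (N : ModuleCat.{u} R) [Module.Finite R N] (ψ : baseChange f N ⟶ ModuleCat.of S S) :
    ∃ (q : ℕ) (t : Fin q → S) (φ : Fin q → N →ₗ[R] R),
      ∀ m, ψ.hom (bcTmul f N 1 m) = ∑ l, f (φ l m) * t l := by
  obtain ⟨p, g, hg⟩ := Module.Finite.exists_fin (R := R) (M := N)
  let L := Fintype.linearCombination R g
  have hL : Function.Surjective L :=
    LinearMap.range_eq_top.mp ((Fintype.range_linearCombination R g).trans hg)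
  obtain ⟨q, r, hr⟩ := Submodule.fg_iff_exists_fin_generating_family.mp
    (IsNoetherian.noetherian (LinearMap.ker L))
  let y : Fin p → S := fun a => ψ.hom (bcTmul f N 1 (g a))
  have hψ : ∀ c : Fin p → R, ψ.hom (bcTmul f N 1 (L c)) = ∑ a, f (c a) * y a := by
    intro c
    rw [show L c = ∑ a, c a • g a from Fintype.linearCombination_apply R g c, map_sum, map_sum]
    refine Finset.sum_congr rfl fun a _ => ?_
    have h1 := smul_bcTmul f (f (c a)) 1 (g a)
    rw [bcTmul_smul, one_mul, ← mul_one (f (c a)), ← h1, map_smul, mul_one]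
    rfl
  obtain ⟨m, t, v, hv, hv'⟩ := hf p q (fun a => MulOpposite.op (y a))
    (fun a x => MulOpposite.op (r x a)) fun x => by
      refine MulOpposite.unop_injective ?_
      rw [Finset.unop_sum]
      refine (hψ (r x)).symm.trans ?_
      rw [show L (r x) = 0 from hr.le (Submodule.subset_span ⟨x, rfl⟩), map_zero, map_zero]
      rfl
  let U : Fin m → (Fin p → R) →ₗ[R] R := fun l =>
    Fintype.linearCombination R fun a => (v l a).unop
  have hU : ∀ l, LinearMap.ker L ≤ LinearMap.ker (U l) := by
    intro l
    rw [← hr, Submodule.span_le]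
    rintro _ ⟨x, rfl⟩
    have h1 := congrArg MulOpposite.unop (hv' l x)
    rw [Finset.unop_sum] at h1
    exact (Fintype.linearCombination_apply R _ _).trans h1
  let e := L.quotKerEquivOfSurjective hL
  refine ⟨m, fun l => (t l).unop, fun l =>
    ((LinearMap.ker L).liftQ (U l) (hU l)) ∘ₗ e.symm.toLinearMap, fun z => ?_⟩
  obtain ⟨c, rfl⟩ := hL z
  have he : e.symm (L c) = (LinearMap.ker L).mkQ c := e.symm_apply_eq.mpr rfl
  rw [hψ]
  have h2 : ∀ a, y a = ∑ l, f ((v l a).unop) * (t l).unop := fun a => by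
    have := congrArg MulOpposite.unop (hv a)
    rw [Finset.unop_sum] at this
    exact this
  simp only [LinearMap.comp_apply, LinearEquiv.coe_coe, he, Submodule.mkQ_apply,
    Submodule.liftQ_apply, U, Fintype.linearCombination_apply, map_sum, smul_eq_mul, map_mul, h2,
    Finset.mul_sum, Finset.sum_mul, mul_assoc]
  exact Finset.sum_comm

/-- Decompose ψ into homomorphisms over R with coefficients in S, and extend each of them. -/
theorem exists_extension_baseChange [IsNoetherianRing R] {f : R →+* S} (hf : VFlat f.op)
    {A B : ModuleCat.{u} R} [Module.Finite R A] (a : A ⟶ B)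
    (ha : ∀ φ : A ⟶ ModuleCat.of R R, ∃ φ' : B ⟶ ModuleCat.of R R, a ≫ φ' = φ)
    (ψ : baseChange f A ⟶ ModuleCat.of S S) :
    ∃ ψ' : baseChange f B ⟶ ModuleCat.of S S, bcMap f a ≫ ψ' = ψ := by
  obtain ⟨q, t, φ, hφ⟩ := exists_eq_sum_lift hf A ψ
  choose φ' hφ' using fun l => ha (ModuleCat.ofHom (φ l))
  have hφ'' : ∀ l x, (φ' l).hom (a.hom x) = φ l x := fun l x =>
    congrArg (fun g : A ⟶ ModuleCat.of R R => g.hom x) (hφ' l)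
  let g : B →+ S := ∑ l, (AddMonoidHom.mulRight (t l)).comp
    ((f : R →+ S).comp (φ' l).hom.toAddMonoidHom)
  have hg : ∀ z, g z = ∑ l, f ((φ' l).hom z) * t l := fun z => by
    rw [AddMonoidHom.finsetSum_apply]
    rfl
  let g' : B →+ ModuleCat.of S S := g
  refine ⟨bcLift f g' fun r z => ?_, bc_hom_ext f fun z => ?_⟩
  · refine (hg _).trans (Eq.trans ?_ (congrArg (f r * ·) (hg z)).symm)
    dsimp only
    rw [Finset.mul_sum]
    refine Finset.sum_congr rfl fun l _ => ?_
    rw [map_smul, smul_eq_mul, map_mul, mul_assoc]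
  · rw [ModuleCat.hom_comp, LinearMap.comp_apply, bcMap_tmul, bcLift_tmul, one_smul, hφ z]
    exact (hg _).trans (Finset.sum_congr rfl fun l _ => by rw [hφ''])

/-- Flatness keeps free presentations exact, so the degree shifts down to Hom, where
`exists_eq_sum_lift` applies. -/
theorem ext_baseChange_eq_zero [IsNoetherianRing R] {f : R →+* S} (hflat : IsFlat f)
    (hf : VFlat f.op) (i : ℕ) (M : ModuleCat.{u} R) [hM : Module.Finite R M]
    (h : ∀ e : Abelian.Ext.{u} M (ModuleCat.of R R) i, e = 0)
    (e : Abelian.Ext.{u} (baseChange f M) (ModuleCat.of S S) i) : e = 0 := by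
  induction i generalizing M with
  | zero =>
    obtain ⟨ψ, rfl⟩ := (Abelian.Ext.mk₀_bijective _ _).2 e
    rw [Abelian.Ext.mk₀_eq_zero_iff]
    obtain ⟨q, t, φ, hφ⟩ := exists_eq_sum_lift hf M ψ
    refine bc_hom_ext f fun m => ?_
    rw [hφ]
    refine Finset.sum_eq_zero fun l _ => ?_
    have h1 := (Abelian.Ext.mk₀_eq_zero_iff _).mp (h (Abelian.Ext.mk₀ (ModuleCat.ofHom (φ l))))
    have h2 : φ l m = 0 := congrArg (fun g : M ⟶ ModuleCat.of R R => g.hom m) h1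
    rw [h2, map_zero, zero_mul]
  | succ i ih =>
    obtain ⟨k, A, a, b, w, hX, hA⟩ := exists_finite_presentation M
    have hY : (ShortComplex.mk (bcMap f a) (bcMap f b) _).ShortExact := hflat.shortExact hX
    obtain ⟨δ, -, -, hδ, -⟩ := exists_connecting hX (ModuleCat.of R R) i
    obtain ⟨δ', hδ', -, -, hδ''⟩ := exists_connecting hY (ModuleCat.of S S) i
    revert e
    rw [add_comm i 1] at h ⊢
    intro e
    obtain ⟨y, rfl⟩ := hδ'' e (ext_eq_zero_of_projective (by omega) _)
    -- Degree one differs: vanishing of Ext¹ says only that maps from the syzygy extend, not that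
    -- they vanish.
    rcases Nat.eq_zero_or_pos i with rfl | hi
    · obtain ⟨ψ, rfl⟩ := (Abelian.Ext.mk₀_bijective _ _).2 y
      obtain ⟨ψ', hψ'⟩ := exists_extension_baseChange hf a (fun φ => by
        obtain ⟨e', he'⟩ := hδ (Abelian.Ext.mk₀ φ) (h _)
        obtain ⟨φ', rfl⟩ := (Abelian.Ext.mk₀_bijective _ _).2 e'
        refine ⟨φ', (Abelian.Ext.mk₀_bijective _ _).1 ?_⟩
        rw [← he', extPre, Abelian.Ext.mk₀_comp_mk₀]) ψ
      rw [← hψ', ← Abelian.Ext.mk₀_comp_mk₀]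
      exact hδ' (Abelian.Ext.mk₀ ψ')
    · have h1 : y = 0 := ih A (fun e' => by
        obtain ⟨e'', rfl⟩ := hδ e' (h _)
        rw [ext_eq_zero_of_projective hi e'', extPre_zero]) y
      rw [h1, map_zero]

theorem ext_pi_eq_zero {N : ModuleCat.{u} R} {p : ℕ}
    (h : ∀ e : Abelian.Ext.{u} N (ModuleCat.of R R) p, e = 0) (k : ℕ)
    (e : Abelian.Ext.{u} N (ModuleCat.of R (Fin k → R)) p) : e = 0 := by
  let P := ModuleCat.of R (Fin k → R)
  let T : (P ⟶ P) →+ Abelian.Ext.{u} N P p :=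
    AddMonoidHom.mk' (fun φ => e.comp (Abelian.Ext.mk₀ φ) (add_zero p)) fun φ φ' => by
      rw [Abelian.Ext.mk₀_add, Abelian.Ext.comp_add]
  let pr : Fin k → (P ⟶ ModuleCat.of R R) := fun a => ModuleCat.ofHom (LinearMap.proj a)
  let inc : Fin k → (ModuleCat.of R R ⟶ P) := fun a => ModuleCat.ofHom (LinearMap.single R (fun _ : Fin k => R) a)
  have h1 : 𝟙 P = ∑ a, pr a ≫ inc a := by
    refine ModuleCat.hom_ext (LinearMap.ext fun v => ?_)
    rw [ModuleCat.hom_sum, LinearMap.sum_apply]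
    exact (Finset.univ_sum_single (show Fin k → R from v)).symm
  have h2 : e = T (𝟙 P) := (Abelian.Ext.comp_mk₀_id e).symm
  rw [h2, h1, map_sum]
  refine Finset.sum_eq_zero fun a _ => ?_
  change e.comp (Abelian.Ext.mk₀ (pr a ≫ inc a)) (add_zero p) = 0
  rw [← Abelian.Ext.mk₀_comp_mk₀, ← Abelian.Ext.comp_assoc (a₁₂ := p) (a₂₃ := 0) _ _ _ (by omega) (by omega) (by omega),
    h (e.comp (Abelian.Ext.mk₀ (pr a)) (add_zero p)), Abelian.Ext.zero_comp]

/-- In the top degree Ext^p(N, -) is right exact, so it is enough to kill it on a free cover of L.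
-/
theorem ext_eq_zero_of_finite [IsNoetherianRing R] {N : ModuleCat.{u} R} {p : ℕ}
    (hN : HasProjectiveDimensionLT N (p + 1))
    (h : ∀ e : Abelian.Ext.{u} N (ModuleCat.of R R) p, e = 0) (L : ModuleCat.{u} R)
    [Module.Finite R L] (e : Abelian.Ext.{u} N L p) : e = 0 := by
  obtain ⟨k, A, a, b, w, hX, -⟩ := exists_finite_presentation L
  obtain ⟨e', rfl⟩ := Abelian.Ext.covariant_sequence_exact₃ N hX e rfl
    (Abelian.Ext.eq_zero_of_hasProjectiveDimensionLT _ (p + 1) le_rfl)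
  rw [ext_pi_eq_zero h k e', Abelian.Ext.zero_comp]

/-- Finitely generated test modules suffice because syzygies are finitely generated: if Ext¹ into
the syzygy vanishes, its identity extends and the presentation splits. -/
theorem hasProjectiveDimensionLT_of_ext [IsNoetherianRing R] (p : ℕ) (N : ModuleCat.{u} R)
    [Module.Finite R N] (hN : HasProjectiveDimensionLT N (p + 1))
    (h : ∀ L : ModuleCat.{u} R, Module.Finite R L → ∀ e : Abelian.Ext.{u} N L p, e = 0) :
    HasProjectiveDimensionLT N p := by
  induction p generalizing N with
  | zero =>
    rw [hasProjectiveDimensionLT_zero_iff_isZero, Limits.IsZero.iff_id_eq_zero]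
    exact (Abelian.Ext.mk₀_eq_zero_iff _).mp (h N inferInstance _)
  | succ p ih =>
    obtain ⟨k, A, a, b, w, hX, hA⟩ := exists_finite_presentation N
    rcases Nat.eq_zero_or_pos p with rfl | hp
    · obtain ⟨δ, -, -, hδ, -⟩ := exists_connecting hX A 0
      obtain ⟨e, he⟩ := hδ (Abelian.Ext.mk₀ (𝟙 A)) (h A hA _)
      obtain ⟨r, rfl⟩ := (Abelian.Ext.mk₀_bijective _ _).2 e
      rw [extPre, Abelian.Ext.mk₀_comp_mk₀] at he
      have hr := (Abelian.Ext.mk₀_bijective _ _).1 he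
      have hkill := KillsEnd.of_retraction hX r hr
      refine HasProjectiveDimensionLT.mk fun i hi Y e => ?_
      rw [← extPre_id e]
      exact hkill Y i (by omega) e
    · have hA' : HasProjectiveDimensionLT A (p + 1) :=
        (hX.hasProjectiveDimensionLT_X₃_iff p (projective_of_pi k)).mp hN
      have := ih A hA' fun L hL e => by
        obtain ⟨δ, -, -, hδ, -⟩ := exists_connecting hX L p
        have h1 : δ e = 0 := by
          have h2 := h L hL
          rw [add_comm p 1] at h2
          exact h2 _
        obtain ⟨e', rfl⟩ := hδ e h1
        rw [ext_eq_zero_of_projective hp e', extPre_zero]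
      obtain ⟨p, rfl⟩ : ∃ q, p = q + 1 := ⟨p - 1, by omega⟩
      exact (hX.hasProjectiveDimensionLT_X₃_iff p (projective_of_pi k)).mpr this

/-- A nonzero finitely generated module of finite projective dimension over a Noetherian ring has
grade at most its projective dimension. -/
theorem grade_le_projectiveDimension [IsNoetherianRing R] (N : ModuleCat.{u} R) [Module.Finite R N]
    (hN : ¬ Subsingleton N) {d : ℕ} (hd : HasProjectiveDimensionLT N d) :
    (grade N : WithBot ℕ∞) ≤ projectiveDimension N := by
  classical
  have hex : ∃ d, HasProjectiveDimensionLT N d := ⟨d, hd⟩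
  have h0 : Nat.find hex ≠ 0 := fun h => hN (by
    have h1 := Nat.find_spec hex
    rw [h, hasProjectiveDimensionLT_zero_iff_isZero] at h1
    exact ModuleCat.isZero_iff_subsingleton.mp h1)
  -- p is the projective dimension; if Ext^p(N, R) were zero, the dimension would drop.
  obtain ⟨p, hp⟩ := Nat.exists_eq_succ_of_ne_zero h0
  have h1 : HasProjectiveDimensionLT N (p + 1) := by
    have := Nat.find_spec hex
    rwa [hp] at this
  have h2 : ¬ HasProjectiveDimensionLT N p := Nat.find_min hex (by omega)
  have h3 : Nontrivial (Abelian.Ext.{u} N (ModuleCat.of R R) p) := by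
    rw [← not_subsingleton_iff_nontrivial]
    intro h
    exact h2 (hasProjectiveDimensionLT_of_ext p N h1 fun L _ e =>
      ext_eq_zero_of_finite h1 (fun e => Subsingleton.elim _ _) L e)
  have h4 : grade N ≤ p := sInf_le ⟨p, rfl, h3⟩
  refine le_trans (WithBot.coe_le_coe.mpr h4) ?_
  exact (projectiveDimension_ge_iff N p).mpr h2

end ExtRing

/-! ## The global dimension of the ring of differential operators -/

noncomputable section TateModule

variable {K : Type u} [NontriviallyNormedField K] [IsUltrametricDist K] {n : ℕ}

variable (K n) in
/-- The Tate algebra as a left `𝒟ₙ`-module. -/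
def tateModule : ModuleCat.{u} (DiffOp K n) :=
  letI : Module (DiffOp K n) (TateAlgebra K n) :=
    Module.compHom (TateAlgebra K n) (opHom K n).toRingHom
  ModuleCat.of (DiffOp K n) (TateAlgebra K n)

variable (K n) in
/-- The constant function `1` in the module `tateModule`. -/
def tateOne : tateModule K n := (1 : TateAlgebra K n)

theorem tateOne_ne_zero : tateOne K n ≠ 0 := (one_ne_zero : (1 : TateAlgebra K n) ≠ 0)

instance finite_tateModule : Module.Finite (DiffOp K n) (tateModule K n) := by
  refine ⟨⟨{tateOne K n}, ?_⟩⟩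
  rw [eq_top_iff]
  intro f _
  have h1 : mulOp K n (show TateAlgebra K n from f) • tateOne K n = f :=
    mul_one (show TateAlgebra K n from f)
  rw [← h1]
  exact Submodule.smul_mem _ _ (Submodule.subset_span (by simp))

theorem del_smul_tateOne (i : Fin n) : del K i • tateOne K n = 0 := by
  have h1 : partialOp K i (1 : TateAlgebra K n) = 0 := by
    refine Subtype.ext ?_
    rw [partialOp_coe]
    exact (MvPowerSeries.pderiv K i).map_one_eq_zero
  exact h1

/-- The constant function 1 is a nonzero horizontal section. -/
theorem not_exactAt_zero_tateModule : ¬ (deRham K (tateModule K n)).ExactAt 0 := by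
  intro h
  rw [HomologicalComplex.exactAt_iff' _ 0 0 1 (by simp) (by simp),
    ShortComplex.moduleCat_exact_iff] at h
  let ω : FormIndex n 0 → underlying K (tateModule K n) := fun _ => tateOne K n
  have hω : formDifferential (delAction K (tateModule K n)) 0 ω = 0 := by
    funext J
    rw [formDifferential_apply]
    refine Finset.sum_eq_zero fun j _ => ?_
    have h1 : delAction K (tateModule K n) j (ω (J.erase j)) = 0 := del_smul_tateOne j.1
    rw [h1, smul_zero]
  obtain ⟨y, hy⟩ := h ω ((formComplex_d_apply (delAction_commute K (tateModule K n)) 0 ω).trans hω)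
  have h2 : (deRham K (tateModule K n)).d 0 0 = 0 := HomologicalComplex.shape _ _ _ (by simp)
  have h3 : ((deRham K (tateModule K n)).d 0 0).hom y = ω := hy
  rw [h2] at h3
  exact tateOne_ne_zero (congrFun h3 ⟨∅, rfl⟩).symm

variable (hK : ∀ m : ℕ, m ≠ 0 → ‖(m : K)‖ = 1)

include hK in
-- Division by the ∂ᵢ contracts the complex outside the top degree, where the remainder need not
-- vanish.
theorem exactAt_deRham_free (m : ℕ) {i : ℕ} (hi : i ≠ n) :
    (deRham K (ModuleCat.of (DiffOp K n) (Fin m → DiffOp K n))).ExactAt i := by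
  let F := ModuleCat.of (DiffOp K n) (Fin m → DiffOp K n)
  let σ : Fin n → underlying K F →+ underlying K F := fun i =>
    AddMonoidHom.compLeft (divDel hK i) (Fin m)
  exact formComplex_exactAt (δ := delAction K F) (σ := σ) (delAction_commute K F)
    (fun i v => funext fun a => divDel_del_mul hK i _)
    (fun i j hij v => funext fun a => divDel_del_mul_of_ne hK hij _) fun h => absurd h hi

include hK in
-- Free modules have cohomology only in degree n, so each step of a resolution costs one degree of
-- vanishing.
theorem exactAt_deRham_of_projectiveDimension [IsNoetherianRing (DiffOp K n)] (p i : ℕ)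
    (hi : i + p < n) (M : ModuleCat.{u} (DiffOp K n)) [hM : Module.Finite (DiffOp K n) M]
    (hp : HasProjectiveDimensionLT M (p + 1)) : (deRham K M).ExactAt i := by
  induction p generalizing i M with
  | zero =>
    obtain ⟨k, A, a, b, w, hX, -⟩ := exists_finite_presentation M
    have : Projective M := (projective_iff_hasProjectiveDimensionLT_one (X := M)).mpr hp
    have := hX.epi_g
    have hs := Projective.factorThru_comp (𝟙 M) b
    rw [HomologicalComplex.exactAt_iff_isZero_homology, Limits.IsZero.iff_id_eq_zero]
    have h0 := (HomologicalComplex.exactAt_iff_isZero_homology _ _).mp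
      (exactAt_deRham_free (n := n) hK k (i := i) (by omega))
    have h1 : 𝟙 (deRham K M) = deRhamMap K (Projective.factorThru (𝟙 M) b) ≫ deRhamMap K b := by
      rw [← deRhamMap_comp, hs]
      rfl
    rw [← HomologicalComplex.homologyMap_id, h1, HomologicalComplex.homologyMap_comp,
      h0.eq_of_tgt (HomologicalComplex.homologyMap _ i) 0, Limits.zero_comp]
  | succ p ih =>
    obtain ⟨k, A, a, b, w, hX, hA⟩ := exists_finite_presentation M
    have hA' : HasProjectiveDimensionLT A (p + 1) :=
      (hX.hasProjectiveDimensionLT_X₃_iff p (projective_of_pi k)).mp hp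
    have h0 := (HomologicalComplex.exactAt_iff_isZero_homology _ _).mp
      (exactAt_deRham_free (n := n) hK k (i := i) (by omega))
    refine (deRhamShort_shortExact K hX).exactAt_X₃ i ⟨fun _ _ _ => h0.eq_of_src _ _⟩ fun j hj => ?_
    have hij : j = i + 1 := by simpa using hj.symm
    have h1 := (HomologicalComplex.exactAt_iff_isZero_homology _ _).mp
      (ih j (by omega) A hA')
    exact ⟨fun _ _ _ => h1.eq_of_tgt _ _⟩

include hK in
theorem le_globalDim_diffOp [IsNoetherianRing (DiffOp K n)] : (n : WithBot ℕ∞) ≤ globalDim (DiffOp K n) := by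
  refine le_trans ?_ (le_iSup (fun M : ModuleCat.{u} (DiffOp K n) => projectiveDimension M)
    (tateModule K n))
  rw [projectiveDimension_ge_iff]
  intro h
  rcases Nat.eq_zero_or_pos n with rfl | hn
  · rw [hasProjectiveDimensionLT_zero_iff_isZero] at h
    have := ModuleCat.isZero_iff_subsingleton.mp h
    exact tateOne_ne_zero (Subsingleton.elim (tateOne K 0) 0)
  · obtain ⟨p, rfl⟩ : ∃ p, n = p + 1 := ⟨n - 1, by omega⟩
    exact not_exactAt_zero_tateModule (exactAt_deRham_of_projectiveDimension hK p 0 (by omega) _ h)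

variable {ϖ : K} (h0 : ϖ ≠ 0) (h1 : ‖ϖ‖ < 1) (hdisc : ∀ a : K, ‖a‖ < 1 → ‖a‖ ≤ ‖ϖ‖)

include h0 h1 hdisc hK in
-- All terms of the chain n ≤ gl.dim D = grade M ≤ grade M̂ ≤ pd M̂ ≤ gl.dim D̂ ≤ n coincide once M̂
-- is nonzero; M is then nonzero as well.
theorem isOfMinimalDimension_completedModule [CompleteSpace K] {M : ModuleCat.{u} (DiffOp K n)}
    (hM : IsOfMinimalDimension M) : IsOfMinimalDimension (completedModule K M) := by
  have hfin := hM.1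
  have := isNoetherianRing_diffOp (n := n) h0 h1 hdisc hK
  have := isNoetherianRing_completed (n := n) h0 h1 hdisc hK
  have hfin' : Module.Finite (CompletedWeylAlgebra K n) (completedModule K M) :=
    finite_baseChange _
  refine ⟨hfin', ?_⟩
  by_cases hs : Subsingleton (completedModule K M)
  · exact Or.inl hs
  rcases hM.2 with hM0 | hgrade
  · exact absurd (subsingleton_baseChange _) hs
  refine Or.inr (le_antisymm ?_ ?_)
  · have hpd : projectiveDimension (completedModule K M) ≤ globalDim (CompletedWeylAlgebra K n) :=
      le_iSup (fun N : ModuleCat.{u} (CompletedWeylAlgebra K n) => projectiveDimension N) _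
    have hd : HasProjectiveDimensionLT (completedModule K M) (n + 1) :=
      (projectiveDimension_le_iff _ n).mp (hpd.trans (globalDim_completed_le h0 h1 hdisc hK))
    exact (grade_le_projectiveDimension _ hs hd).trans hpd
  · refine (globalDim_completed_le h0 h1 hdisc hK).trans ?_
    have hn : (n : ℕ∞) ≤ grade M := by
      have := (le_globalDim_diffOp (n := n) hK).trans_eq hgrade.symm
      exact WithBot.coe_le_coe.mp this
    refine WithBot.coe_le_coe.mpr (le_sInf ?_)
    rintro _ ⟨i, rfl, hi⟩
    refine Nat.cast_le.mpr (not_lt.mp fun hlt => ?_)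
    refine not_subsingleton_iff_nontrivial.mpr hi (subsingleton_of_forall_eq 0 fun e => ?_)
    refine ext_baseChange_eq_zero (vflat_toCompleted h0 h1 hdisc hK).isFlat
      (vflat_op_toCompleted h0 h1 hdisc hK) i M (fun e => ?_) e
    have hsub : Subsingleton (Abelian.Ext.{u} M (ModuleCat.of (DiffOp K n) (DiffOp K n)) i) := by
      rw [← not_nontrivial_iff_subsingleton]
      intro hnt
      have h2 : grade M ≤ i := sInf_le ⟨i, rfl, hnt⟩
      exact absurd (Nat.cast_le.mp (hn.trans h2)) (not_le.mpr hlt)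
    exact Subsingleton.elim _ _

end TateModule

end CompletedWeyl

theorem lemma3p4 (K : Type u) [NontriviallyNormedField K] [IsUltrametricDist K] [CompleteSpace K]
    [IsDiscreteValuationRing (NormedField.valuation (K := K)).valuationSubring]
    [CharZero (IsLocalRing.ResidueField (NormedField.valuation (K := K)).valuationSubring)]
    (n : ℕ) (M : ModuleCat.{u} (CompletedWeyl.DiffOp K n))
    [Module.Finite (CompletedWeyl.DiffOp K n) M] :
    (CompletedWeyl.IsOfMinimalDimension M →
      CompletedWeyl.IsOfMinimalDimension (CompletedWeyl.completedModule K M)) ∧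
    QuasiIso (CompletedWeyl.deRhamComparison K M) := by
  -- Discreteness and residue characteristic zero enter only through these norm statements.
  obtain ⟨ϖ, h0, h1, hdisc⟩ := CompletedWeyl.exists_uniformizer (K := K)
  have hK : ∀ m : ℕ, m ≠ 0 → ‖(m : K)‖ = 1 := fun m hm => CompletedWeyl.norm_natCast_eq_one hm
  exact ⟨CompletedWeyl.isOfMinimalDimension_completedModule hK h0 h1 hdisc,
    CompletedWeyl.quasiIso_deRhamComparison h0 h1 hdisc hK M⟩
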